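/- **Conventions.** Composition is written in diagrammatic order: $fg : A \to C$ for $f : A \to B$, $g : B \to C$. All monoidal structure is strict. **Right-strict Elgot categories.** A *right-strict Elgot category* is a tuple $(\mathbb{C},(+,0,\sigma^+),(\otimes,I),(\mu,\eta),\mathsf{Tr},\delta^l,(N,\iota))$ such that: * $(\mathbb{C},+,0,\sigma^+)$ is a symmetric strict monoidal category, and $\mu_A : A+A\to A$, $\eta_A : 0 \to A$ are monoidal natural transformations making each $(A,\mu_A,\eta_A)$ a commutative monoid (a cocartesian monoidal category); $(\mathbb{C},\otimes,I)$ is a strict monoidal category (juxtaposition denotes $\otimes$ on objects). * (Identity annihilators and right distributor.) $A0=0=0A$ and $(A+B)C=AC+BC$ on objects; $f\otimes 1_0=1_0=1_0\otimes f$ and $(f+g)\otimes h=(f\otimes h)+(g\otimes h)$ on morphisms. * $\delta^l_{A,B,C}:A(B+C)\to AB+AC$ is a natural isomorphism and, for all objects $A,B,C,D$: $\delta^l_{0,A,B}=1_0$; $\delta^l_{A,0,B}=1_{AB}=\delta^l_{A,B,0}$; $\delta^l_{I,A,B}=1_{A+B}$; $\delta^l_{A,B,C}\sigma^+_{AB,AC}=(1_A\otimes\sigma^+_{B,C})\delta^l_{A,C,B}$;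 $\sigma^+_{AC,BC}=\sigma^+_{A,B}\otimes 1_C$; $\delta^l_{A,B+C,D}(\delta^l_{A,B,C}+1_{AD})=\delta^l_{A,B,C+D}(1_{AB}+\delta^l_{A,C,D})$; $\delta^l_{AB,C,D}=(1_A\otimes\delta^l_{B,C,D})\delta^l_{A,BC,BD}$; $\delta^l_{A,BD,CD}=\delta^l_{A,B,C}\otimes 1_D$; $\delta^l_{A+B,C,D}=(\delta^l_{A,C,D}+\delta^l_{B,C,D})(1_{AC}+\sigma^+_{AD,BC}+1_{BD})$. * $\mathsf{Tr}^C_{A,B}:\mathbb{C}(A+C,B+C)\to\mathbb{C}(A,B)$ is a trace for $(+,0,\sigma^+)$: $\mathsf{Tr}^0_{A,B}(f)=f$; $\mathsf{Tr}^{C+D}_{A,B}(f)=\mathsf{Tr}^C_{A,B}(\mathsf{Tr}^D_{A+C,B+C}(f))$; $g\,\mathsf{Tr}^C(f)\,h=\mathsf{Tr}^C((g+1_C)f(h+1_C))$; $1_D+\mathsf{Tr}^C(f)=\mathsf{Tr}^C(1_D+f)$; $\mathsf{Tr}^C_{A,B}((1_A+h)f)=\mathsf{Tr}^D_{A,B}(f(1_B+h))$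 for $h:C\to D$, $f:A+D\to B+C$; $\mathsf{Tr}^A_{A,A}(\sigma^+_{A,A})=1_A$. It is *uniform*: for $f:A+C\to B+C$, $g:A+D\to B+D$ and $h:C\to D$, if $f(1_B+h)=(1_A+h)g$ then $\mathsf{Tr}^C_{A,B}(f)=\mathsf{Tr}^D_{A,B}(g)$. * $N$ is an object and $\iota:I+N\to N$ is an isomorphism. **The category $\mathbb{A}$.** Monomials are the elements $U,V,W,\dots$ of the free monoid $\{N\}^*$, with unit $I$. Objects of $\mathbb{A}$ are polynomials $P,Q,R,\dots$, the elements of the free monoid $(\{N\}^*)^*$, written additively with unit $0$. Arrows are generated, for monomials $U,V,W$ and polynomials $P,Q,R,S$, by $$\mathsf{succ}_{U,V}:UNV\to UNV,\quad \mathsf{zero}_{U,V}:UV\to UNV,\quad \mathsf{pred}_{U,V}:UNV\to UV+UNV,$$ $$1_U:U\to U,\quad 1_0:0\to 0,\quad \eta_U:0\to U,\quad \mu_U:U+U\to U,\quad \sigma^+_{U,W}:U+W\to W+U,$$ under composition, sums $f+g:P+R\to Q+S$ of $f:P\to Q$, $g:R\to S$, and traces $\mathsf{Tr}^W_{P,Q}(f):P\to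 Q$ of $f:P+W\to Q+W$. For polynomials put * $1_{U+Q}=1_U+1_Q$; * $\sigma^+_{U,0}=1_U$, $\sigma^+_{U,V+Q}=(\sigma^+_{U,V}+1_Q)(1_V+\sigma^+_{U,Q})$, $\sigma^+_{0,Q}=1_Q$, $\sigma^+_{U+P,Q}=(1_U+\sigma^+_{P,Q})(\sigma^+_{U,Q}+1_P)$; * $\eta_0=1_0$, $\eta_{U+P}=\eta_U+\eta_P$, $\mu_0=1_0$, $\mu_{U+P}=(1_U+\sigma^+_{P,U}+1_P)(\mu_U+\mu_P)$; * $\mathsf{Tr}^0_{P,Q}(f)=f$, $\mathsf{Tr}^{W+R}_{P,Q}(f)=\mathsf{Tr}^W_{P,Q}(\mathsf{Tr}^R_{P+W,Q+W}(f))$. Arrows are taken modulo the least congruence containing the following equations (for all well-typed instances). * [S1] $(fg)h=f(gh)$; [S2] $1_Pf=f=f1_Q$; [S3] $(f+g)(h+k)=fh+gk$; [S4] $1_0+f=f=f+1_0$; [S5] $(f+g)+h=f+(g+h)$; [S6] $\sigma^+_{P,Q}\sigma^+_{Q,P}=1_{P+Q}$; [S7] $(f+1_Q)\sigma^+_{P',Q}=\sigma^+_{P,Q}(1_Q+f)$;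 * [S8] $(\mu_P+1_P)\mu_P=(1_P+\mu_P)\mu_P$; [S9] $\sigma^+_{P,P}\mu_P=\mu_P$; [S10] $(\eta_P+1_P)\mu_P=1_P$; [S11] $(f+f)\mu_Q=\mu_Pf$; [S12] $\eta_Pf=\eta_Q$; * [S13] $g\,\mathsf{Tr}^R(f)\,h=\mathsf{Tr}^R((g+1_R)f(h+1_R))$; [S14] $1_S+\mathsf{Tr}^R(f)=\mathsf{Tr}^R(1_S+f)$; [S15] $\mathsf{Tr}^R((1_P+h)f)=\mathsf{Tr}^{R'}(f(1_Q+h))$; [S16] $\mathsf{Tr}^P(\sigma^+_{P,P})=1_P$; * uniformity: if $f(1_Q+h)=(1_P+h)g$ for $f:P+R\to Q+R$, $g:P+R'\to Q+R'$, $h:R\to R'$, then $\mathsf{Tr}^R_{P,Q}(f)=\mathsf{Tr}^{R'}_{P,Q}(g)$; * [N1] $(\mathsf{zero}_{U,V}+\mathsf{succ}_{U,V})\mu_{UNV}\mathsf{pred}_{U,V}=1_{UV+UNV}$; [N2] $\mathsf{pred}_{U,V}(\mathsf{zero}_{U,V}+\mathsf{succ}_{U,V})\mu_{UNV}=1_{UNV}$;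 * [N3] $\mathsf{succ}_{U,VNW}\mathsf{succ}_{UNV,W}=\mathsf{succ}_{UNV,W}\mathsf{succ}_{U,VNW}$; [N4] $\mathsf{succ}_{U,VW}\mathsf{zero}_{UNV,W}=\mathsf{zero}_{UNV,W}\mathsf{succ}_{U,VNW}$; [N5] $\mathsf{zero}_{U,VNW}\mathsf{succ}_{UNV,W}=\mathsf{succ}_{UV,W}\mathsf{zero}_{U,VNW}$; [N6] $\mathsf{zero}_{U,VW}\mathsf{zero}_{UNV,W}=\mathsf{zero}_{UV,W}\mathsf{zero}_{U,VNW}$; * [N7] $\mathsf{succ}_{U,VNW}\mathsf{pred}_{UNV,W}=\mathsf{pred}_{UNV,W}(\mathsf{succ}_{U,VW}+\mathsf{succ}_{U,VNW})$; [N8] $\mathsf{zero}_{U,VNW}\mathsf{pred}_{UNV,W}=\mathsf{pred}_{UV,W}(\mathsf{zero}_{U,VW}+\mathsf{zero}_{U,VNW})$; [N9] $\mathsf{succ}_{UNV,W}\mathsf{pred}_{U,VNW}=\mathsf{pred}_{U,VNW}(\mathsf{succ}_{UV,W}+\mathsf{succ}_{UNV,W})$; [N10] $\mathsf{zero}_{UNV,W}\mathsf{pred}_{U,VNW}=\mathsf{pred}_{U,VW}(\mathsf{zero}_{UV,W}+\mathsf{zero}_{UNV,W})$;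 * [N11] $\mathsf{pred}_{U,VNW}(\mathsf{pred}_{UV,W}+\mathsf{pred}_{UNV,W})=\mathsf{pred}_{UNV,W}(\mathsf{pred}_{U,VW}+\mathsf{pred}_{U,VNW})(1_{UVW}+\sigma^+_{UNVW,UVNW}+1_{UNVNW})$. **The multiplicative structure of $\mathbb{A}$.** On objects $U0=0$, $U(V+Q)=UV+UQ$, $0Q=0$, $(U+P)Q=UQ+PQ$, and $I$ is the empty monomial. For a monomial $U$, $U\ltimes-$ is the endofunctor which commutes with composition, sum, and trace ($U\ltimes\mathsf{Tr}^W(f)=\mathsf{Tr}^{UW}(U\ltimes f)$), fixes $1_0$, sends $\mathsf{succ}_{V,W},\mathsf{zero}_{V,W},\mathsf{pred}_{V,W}$ to $\mathsf{succ}_{UV,W},\mathsf{zero}_{UV,W},\mathsf{pred}_{UV,W}$, and sends $1_V,\eta_V,\mu_V,\sigma^+_{V,W}$ to $1_{UV},\eta_{UV},\mu_{UV},\sigma^+_{UV,UW}$; the endofunctor $-\rtimes U$ is defined symmetrically, with $\mathsf{succ}_{V,W}\rtimes U=\mathsf{succ}_{V,WU}$, $1_V\rtimes U=1_{VU}$,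 and so on. The left distributor is $$\delta^l_{0,Q,R}=1_0,\qquad \delta^l_{U+P,Q,R}=(1_{UQ+UR}+\delta^l_{P,Q,R})(1_{UQ}+\sigma^+_{UR,PQ}+1_{PR}).$$ For $f:R\to S$ put $0\ltimes f=1_0$, $(U+P)\ltimes f=(U\ltimes f)+(P\ltimes f)$, $f\rtimes 0=1_0$, $f\rtimes(U+P)=\delta^l_{R,U,P}((f\rtimes U)+(f\rtimes P))(\delta^l_{S,U,P})^{-1}$. For $f:R\to S$ and $g:R'\to S'$ put $f\otimes g=(f\rtimes R')(S\ltimes g)$. **Theorem.** With this structure, $$(\mathbb{A},(+,0,\sigma^+),(\otimes,I),(\mu,\eta),\mathsf{Tr},\delta^l,(N,(\mathsf{zero}_{I,I}+\mathsf{succ}_{I,I})\mu_N))$$ is a right-strict Elgot category. Moreover $f\otimes g=(R\ltimes g)(f\rtimes S')$ for all $f:R\to S$ and $g:R'\to S'$. -/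

import Mathlib

open CategoryTheory

/-! ## Right-strict Elgot categories

All monoidal structure is strict.  Equalities of objects coming from strictness are
transported along with `eqToHom`, which plays the role of the (identity) coherence morphisms.
Composition `f ≫ g` is written in diagrammatic order. -/

namespace Elgot

universe v u

section General

variable {C : Type u} [Category.{v} C]

/-- The data of a tensor product: its action on objects and morphisms, and a unit object. -/
structure Tensor (C : Type u) [Category.{v} C] where
  obj : C → C → C
  unit : C
  hom : ∀ {A A' B B' : C}, (A ⟶ A') → (B ⟶ B') → (obj A B ⟶ obj A' B')

/-- `(C, T)` is a strict monoidal category. -/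
structure Tensor.IsMonoidal (T : Tensor C) : Prop where
  assoc : ∀ A B D : C, T.obj (T.obj A B) D = T.obj A (T.obj B D)
  unit_obj : ∀ A : C, T.obj T.unit A = A
  obj_unit : ∀ A : C, T.obj A T.unit = A
  hom_id : ∀ A B : C, T.hom (𝟙 A) (𝟙 B) = 𝟙 (T.obj A B)
  hom_comp : ∀ {A A' A'' B B' B'' : C} (f : A ⟶ A') (f' : A' ⟶ A'') (g : B ⟶ B') (g' : B' ⟶ B''),
    T.hom (f ≫ f') (g ≫ g') = T.hom f g ≫ T.hom f' g'
  hom_assoc : ∀ {A A' B B' D D' : C} (f : A ⟶ A') (g : B ⟶ B') (h : D ⟶ D'),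
    T.hom (T.hom f g) h =
      eqToHom (assoc A B D) ≫ T.hom f (T.hom g h) ≫ eqToHom (assoc A' B' D').symm
  unit_hom : ∀ {A A' : C} (f : A ⟶ A'),
    T.hom (𝟙 T.unit) f = eqToHom (unit_obj A) ≫ f ≫ eqToHom (unit_obj A').symm
  hom_unit : ∀ {A A' : C} (f : A ⟶ A'),
    T.hom f (𝟙 T.unit) = eqToHom (obj_unit A) ≫ f ≫ eqToHom (obj_unit A').symm

/-- `(C, T, σ)` is a symmetric strict monoidal category. -/
structure Tensor.IsSymmetric (T : Tensor C) (σ : ∀ A B : C, T.obj A B ⟶ T.obj B A) : Prop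
    extends T.IsMonoidal where
  sigma_natural : ∀ {A A' B B' : C} (f : A ⟶ A') (g : B ⟶ B'),
    T.hom f g ≫ σ A' B' = σ A B ≫ T.hom g f
  sigma_sigma : ∀ A B : C, σ A B ≫ σ B A = 𝟙 (T.obj A B)
  sigma_tensor : ∀ A B D : C,
    σ A (T.obj B D) =
      eqToHom (assoc A B D).symm ≫ T.hom (σ A B) (𝟙 D) ≫ eqToHom (assoc B A D) ≫
        T.hom (𝟙 B) (σ A D) ≫ eqToHom (assoc B D A).symm

/-- The middle interchange `1_A + σ_{B,D} + 1_E : A + B + D + E ⟶ A + D + B + E`. -/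
def Tensor.midSwap (T : Tensor C) (hT : T.IsMonoidal) (σ : ∀ A B : C, T.obj A B ⟶ T.obj B A)
    (A B D E : C) : T.obj (T.obj A B) (T.obj D E) ⟶ T.obj (T.obj A D) (T.obj B E) :=
  eqToHom (by simp only [hT.assoc]) ≫
    T.hom (𝟙 A) (T.hom (σ B D) (𝟙 E)) ≫ eqToHom (by simp only [hT.assoc])

/-- `((C, T, σ), (μ, η))` is a cocartesian monoidal category: `μ` and `η` are monoidal natural
transformations, and each `(A, μ_A, η_A)` is a commutative monoid. -/
structure Tensor.IsCocartesian (T : Tensor C) (σ : ∀ A B : C, T.obj A B ⟶ T.obj B A)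
    (μ : ∀ A : C, T.obj A A ⟶ A) (η : ∀ A : C, T.unit ⟶ A) : Prop
    extends T.IsSymmetric σ where
  mu_natural : ∀ {A B : C} (f : A ⟶ B), μ A ≫ f = T.hom f f ≫ μ B
  eta_natural : ∀ {A B : C} (f : A ⟶ B), η A ≫ f = η B
  mu_unit : μ T.unit = eqToHom (unit_obj T.unit)
  mu_tensor : ∀ A B : C,
    μ (T.obj A B) = T.midSwap toIsMonoidal σ A B A B ≫ T.hom (μ A) (μ B)
  eta_unit : η T.unit = 𝟙 T.unit
  eta_tensor : ∀ A B : C,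
    η (T.obj A B) = eqToHom (unit_obj T.unit).symm ≫ T.hom (η A) (η B)
  mu_assoc : ∀ A : C,
    T.hom (μ A) (𝟙 A) ≫ μ A = eqToHom (assoc A A A) ≫ T.hom (𝟙 A) (μ A) ≫ μ A
  mu_comm : ∀ A : C, σ A A ≫ μ A = μ A
  one_eta_mu : ∀ A : C, T.hom (𝟙 A) (η A) ≫ μ A = eqToHom (obj_unit A)
  eta_one_mu : ∀ A : C, T.hom (η A) (𝟙 A) ≫ μ A = eqToHom (unit_obj A)

/-- `((C, T, σ), Tr)` is a traced monoidal category. Here `Tr D A B f` is `Tr^D_{A,B}(f)`. -/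
structure Tensor.IsTraced (T : Tensor C) (σ : ∀ A B : C, T.obj A B ⟶ T.obj B A)
    (Tr : ∀ D A B : C, (T.obj A D ⟶ T.obj B D) → (A ⟶ B)) : Prop
    extends T.IsSymmetric σ where
  tr_unit : ∀ {A B : C} (f : T.obj A T.unit ⟶ T.obj B T.unit),
    Tr T.unit A B f = eqToHom (obj_unit A).symm ≫ f ≫ eqToHom (obj_unit B)
  tr_tensor : ∀ {A B D E : C} (f : T.obj A (T.obj D E) ⟶ T.obj B (T.obj D E)),
    Tr (T.obj D E) A B f =
      Tr D A B (Tr E (T.obj A D) (T.obj B D)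
        (eqToHom (assoc A D E) ≫ f ≫ eqToHom (assoc B D E).symm))
  tr_natural : ∀ {A A' B B' D : C} (g : A' ⟶ A) (f : T.obj A D ⟶ T.obj B D) (h : B ⟶ B'),
    g ≫ Tr D A B f ≫ h = Tr D A' B' (T.hom g (𝟙 D) ≫ f ≫ T.hom h (𝟙 D))
  tr_superpose : ∀ {A B D : C} (E : C) (f : T.obj A D ⟶ T.obj B D),
    T.hom (𝟙 E) (Tr D A B f) =
      Tr D (T.obj E A) (T.obj E B)
        (eqToHom (assoc E A D) ≫ T.hom (𝟙 E) f ≫ eqToHom (assoc E B D).symm)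
  tr_slide : ∀ {A B D E : C} (h : D ⟶ E) (f : T.obj A E ⟶ T.obj B D),
    Tr D A B (T.hom (𝟙 A) h ≫ f) = Tr E A B (f ≫ T.hom (𝟙 B) h)
  tr_yank : ∀ A : C, Tr A A A (σ A A) = 𝟙 A

/-- The trace is uniform (with respect to all morphisms `h`). -/
def Tensor.IsUniform (T : Tensor C)
    (Tr : ∀ D A B : C, (T.obj A D ⟶ T.obj B D) → (A ⟶ B)) : Prop :=
  ∀ {A B D E : C} (f : T.obj A D ⟶ T.obj B D) (g : T.obj A E ⟶ T.obj B E) (h : D ⟶ E),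
    f ≫ T.hom (𝟙 B) h = T.hom (𝟙 A) h ≫ g → Tr D A B f = Tr E A B g

/-- The data `(C, (+, 0, σ), (⊗, I), (μ, η), Tr, δ, (N, ι))` of a right-strict Elgot category.
The annihilators and the right distributor are identities, hence not part of the data. -/
structure ElgotData (C : Type u) [Category.{v} C] where
  add : Tensor C
  sigma : ∀ A B : C, add.obj A B ⟶ add.obj B A
  mul : Tensor C
  mu : ∀ A : C, add.obj A A ⟶ A
  eta : ∀ A : C, add.unit ⟶ A
  tr : ∀ D A B : C, (add.obj A D ⟶ add.obj B D) → (A ⟶ B)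
  delta : ∀ A B D : C, mul.obj A (add.obj B D) ⟶ add.obj (mul.obj A B) (mul.obj A D)
  nat : C
  iota : add.obj mul.unit nat ⟶ nat

/-- The right-strict distributive monoidal category axioms: the left and right annihilators and
the right distributor are identity natural transformations, the left distributor is a natural
isomorphism, and the coherence conditions of a distributive monoidal category hold. -/
structure ElgotData.IsRightStrictDistributive (E : ElgotData C) : Prop where
  additive : E.add.IsCocartesian E.sigma E.mu E.eta
  multiplicative : E.mul.IsMonoidal
  mul_zero : ∀ A : C, E.mul.obj A E.add.unit = E.add.unit
  zero_mul : ∀ A : C, E.mul.obj E.add.unit A = E.add.unit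
  add_mul : ∀ A B D : C,
    E.mul.obj (E.add.obj A B) D = E.add.obj (E.mul.obj A D) (E.mul.obj B D)
  hom_mul_zero : ∀ {A A' : C} (f : A ⟶ A'),
    E.mul.hom f (𝟙 E.add.unit) = eqToHom ((mul_zero A).trans (mul_zero A').symm)
  hom_zero_mul : ∀ {A A' : C} (f : A ⟶ A'),
    E.mul.hom (𝟙 E.add.unit) f = eqToHom ((zero_mul A).trans (zero_mul A').symm)
  hom_add_mul : ∀ {A A' B B' D D' : C} (f : A ⟶ A') (g : B ⟶ B') (h : D ⟶ D'),
    E.mul.hom (E.add.hom f g) h =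
      eqToHom (add_mul A B D) ≫ E.add.hom (E.mul.hom f h) (E.mul.hom g h) ≫
        eqToHom (add_mul A' B' D').symm
  delta_natural : ∀ {A A' B B' D D' : C} (f : A ⟶ A') (g : B ⟶ B') (h : D ⟶ D'),
    E.delta A B D ≫ E.add.hom (E.mul.hom f g) (E.mul.hom f h) =
      E.mul.hom f (E.add.hom g h) ≫ E.delta A' B' D'
  delta_iso : ∀ A B D : C, IsIso (E.delta A B D)
  delta_zero_left : ∀ A B : C,
    E.delta E.add.unit A B =
      eqToHom (by simp only [zero_mul, additive.unit_obj])
  delta_zero_mid : ∀ A B : C,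
    E.delta A E.add.unit B =
      eqToHom (by simp only [mul_zero, additive.unit_obj])
  delta_zero_right : ∀ A B : C,
    E.delta A B E.add.unit =
      eqToHom (by simp only [mul_zero, additive.obj_unit])
  delta_unit : ∀ A B : C,
    E.delta E.mul.unit A B = eqToHom (by simp only [multiplicative.unit_obj])
  delta_sigma : ∀ A B D : C,
    E.delta A B D ≫ E.sigma (E.mul.obj A B) (E.mul.obj A D) =
      E.mul.hom (𝟙 A) (E.sigma B D) ≫ E.delta A D B
  sigma_mul : ∀ A B D : C,
    E.mul.hom (E.sigma A B) (𝟙 D) =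
      eqToHom (add_mul A B D) ≫ E.sigma (E.mul.obj A D) (E.mul.obj B D) ≫
        eqToHom (add_mul B A D).symm
  delta_add_right : ∀ A B D F : C,
    E.delta A (E.add.obj B D) F ≫ E.add.hom (E.delta A B D) (𝟙 (E.mul.obj A F)) =
      eqToHom (by simp only [additive.assoc]) ≫
        E.delta A B (E.add.obj D F) ≫ E.add.hom (𝟙 (E.mul.obj A B)) (E.delta A D F) ≫
          eqToHom (by simp only [additive.assoc])
  delta_mul_left : ∀ A B D F : C,
    E.delta (E.mul.obj A B) D F =
      eqToHom (by simp only [multiplicative.assoc]) ≫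
        E.mul.hom (𝟙 A) (E.delta B D F) ≫ E.delta A (E.mul.obj B D) (E.mul.obj B F) ≫
          eqToHom (by simp only [multiplicative.assoc])
  delta_mul_right : ∀ A B D F : C,
    E.delta A (E.mul.obj B F) (E.mul.obj D F) =
      eqToHom (by simp only [multiplicative.assoc, add_mul]) ≫
        E.mul.hom (E.delta A B D) (𝟙 F) ≫
          eqToHom (by simp only [multiplicative.assoc, add_mul])
  delta_add_left : ∀ A B D F : C,
    E.delta (E.add.obj A B) D F =
      eqToHom (add_mul A B (E.add.obj D F)) ≫ E.add.hom (E.delta A D F) (E.delta B D F) ≫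
        E.add.midSwap additive.toIsMonoidal E.sigma
          (E.mul.obj A D) (E.mul.obj A F) (E.mul.obj B D) (E.mul.obj B F) ≫
          eqToHom (by simp only [add_mul])

/-- A right-strict Elgot category: a right-strict distributive monoidal category with a uniform
trace on the additive structure and an isomorphism `ι : I + N ⟶ N`. -/
structure ElgotData.IsRightStrictElgot (E : ElgotData C) : Prop where
  distributive : E.IsRightStrictDistributive
  traced : E.add.IsTraced E.sigma E.tr
  uniform : E.add.IsUniform E.tr
  iota_iso : IsIso E.iota

end General

end Elgot

/-! ## The category of abacus programs -/

namespace Abacus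

/-- Monomials over a single generator `N`: the free monoid `{N}^*`. The unique letter is `()`,
the empty monomial is `I`, and `U N V` is `U ++ () :: V`. -/
abbrev Mon : Type := List Unit

/-- Polynomials over `N`: the free monoid `({N}^*)^*`. The empty polynomial is `0`,
the sum is `++`, and `U + Q` is `U :: Q` for a monomial `U`. -/
abbrev Poly : Type := List Mon

/-- Raw expressions for the arrows. -/
inductive Tm : Type
  | succ (U V : Mon)
  | zero (U V : Mon)
  | pred (U V : Mon)
  | one (U : Mon)
  | eta (U : Mon)
  | mu (U : Mon)
  | oneZ
  | sigma (U W : Mon)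
  | comp (f g : Tm)
  | add (f g : Tm)
  | tr (W : Mon) (f : Tm)

/-- The formation rules: `HasType f P Q` says that `f : P ⟶ Q` is a well-formed arrow. Since
monomials and polynomials are elements of free monoids, `U N (V N W)` and `(U N V) N W` and so on
are literally equal, and no coercions between equal objects occur in the rules. -/
inductive HasType : Tm → Poly → Poly → Prop
  | succ (U V : Mon) : HasType (.succ U V) [U ++ () :: V] [U ++ () :: V]
  | zero (U V : Mon) : HasType (.zero U V) [U ++ V] [U ++ () :: V]
  | pred (U V : Mon) : HasType (.pred U V) [U ++ () :: V] [U ++ V, U ++ () :: V]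
  | one (U : Mon) : HasType (.one U) [U] [U]
  | eta (U : Mon) : HasType (.eta U) [] [U]
  | mu (U : Mon) : HasType (.mu U) [U, U] [U]
  | oneZ : HasType .oneZ [] []
  | sigma (U W : Mon) : HasType (.sigma U W) [U, W] [W, U]
  | comp {f g : Tm} {P Q R : Poly} :
      HasType f P Q → HasType g Q R → HasType (.comp f g) P R
  | add {f g : Tm} {P Q R S : Poly} :
      HasType f P Q → HasType g R S → HasType (.add f g) (P ++ R) (Q ++ S)
  | tr {f : Tm} {W : Mon} {P Q : Poly} :
      HasType f (P ++ [W]) (Q ++ [W]) → HasType (.tr W f) P Q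

/-! ### Derived structural arrows -/

/-- `1_P`. -/
def idT : Poly → Tm
  | [] => .oneZ
  | U :: Q => .add (.one U) (idT Q)

/-- `σ_{U,Q}` for a monomial `U`. -/
def sigmaM (U : Mon) : Poly → Tm
  | [] => .one U
  | V :: Q => .comp (.add (.sigma U V) (idT Q)) (.add (.one V) (sigmaM U Q))

/-- `σ_{P,Q}`. -/
def sigmaT : Poly → Poly → Tm
  | [], Q => idT Q
  | U :: P, Q => .comp (.add (.one U) (sigmaT P Q)) (.add (sigmaM U Q) (idT P))

/-- `η_P`. -/
def etaT : Poly → Tm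
  | [] => .oneZ
  | U :: P => .add (.eta U) (etaT P)

/-- `μ_P`. -/
def muT : Poly → Tm
  | [] => .oneZ
  | U :: P => .comp (.add (.one U) (.add (sigmaT P [U]) (idT P))) (.add (.mu U) (muT P))

/-- `Tr^R(f)`. -/
def trT : Poly → Tm → Tm
  | [], f => f
  | W :: R, f => .tr W (trT R f)

/-! ### Equations -/

/-- `Eqn P Q f g` says that `f = g : P ⟶ Q` is derivable. -/
inductive Eqn : Poly → Poly → Tm → Tm → Prop
  -- equivalence and congruence
  | refl {f P Q} : HasType f P Q → Eqn P Q f f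
  | symm {f g P Q} : Eqn P Q f g → Eqn P Q g f
  | trans {f g h P Q} : Eqn P Q f g → Eqn P Q g h → Eqn P Q f h
  | comp {f f' g g' P Q R} : Eqn P Q f f' → Eqn Q R g g' → Eqn P R (.comp f g) (.comp f' g')
  | add {f f' g g' P Q R S} :
      Eqn P Q f f' → Eqn R S g g' → Eqn (P ++ R) (Q ++ S) (.add f g) (.add f' g')
  | tr {f f' W P Q} : Eqn (P ++ [W]) (Q ++ [W]) f f' → Eqn P Q (.tr W f) (.tr W f')
  -- monoidal category
  | S1 {f g h P Q R S} : HasType f P Q → HasType g Q R → HasType h R S →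
      Eqn P S (.comp (.comp f g) h) (.comp f (.comp g h))
  | S2l {f P Q} : HasType f P Q → Eqn P Q (.comp (idT P) f) f
  | S2r {f P Q} : HasType f P Q → Eqn P Q (.comp f (idT Q)) f
  | S3 {f g h k P Q R P' Q' R'} :
      HasType f P Q → HasType g P' Q' → HasType h Q R → HasType k Q' R' →
      Eqn (P ++ P') (R ++ R') (.comp (.add f g) (.add h k)) (.add (.comp f h) (.comp g k))
  | S4l {f P Q} : HasType f P Q → Eqn P Q (.add .oneZ f) f
  | S4r {f P Q} : HasType f P Q → Eqn P Q (.add f .oneZ) f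
  | S5 {f g h P Q P' Q' P'' Q''} : HasType f P Q → HasType g P' Q' → HasType h P'' Q'' →
      Eqn (P ++ P' ++ P'') (Q ++ Q' ++ Q'') (.add (.add f g) h) (.add f (.add g h))
  -- symmetry
  | S6 (P Q : Poly) : Eqn (P ++ Q) (P ++ Q) (.comp (sigmaT P Q) (sigmaT Q P)) (idT (P ++ Q))
  | S7 {f P P'} (Q : Poly) : HasType f P P' →
      Eqn (P ++ Q) (Q ++ P') (.comp (.add f (idT Q)) (sigmaT P' Q))
        (.comp (sigmaT P Q) (.add (idT Q) f))
  -- cocartesian structure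
  | S8 (P : Poly) : Eqn (P ++ P ++ P) P
      (.comp (.add (muT P) (idT P)) (muT P)) (.comp (.add (idT P) (muT P)) (muT P))
  | S9 (P : Poly) : Eqn (P ++ P) P (.comp (sigmaT P P) (muT P)) (muT P)
  | S10 (P : Poly) : Eqn P P (.comp (.add (etaT P) (idT P)) (muT P)) (idT P)
  | S11 {f P Q} : HasType f P Q →
      Eqn (P ++ P) Q (.comp (.add f f) (muT Q)) (.comp (muT P) f)
  | S12 {f P Q} : HasType f P Q → Eqn [] Q (.comp (etaT P) f) (etaT Q)
  -- trace
  | S13 {f g h P P' Q Q' R} :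
      HasType g P' P → HasType f (P ++ R) (Q ++ R) → HasType h Q Q' →
      Eqn P' Q' (.comp g (.comp (trT R f) h))
        (trT R (.comp (.add g (idT R)) (.comp f (.add h (idT R)))))
  | S14 {f P Q R} (S : Poly) : HasType f (P ++ R) (Q ++ R) →
      Eqn (S ++ P) (S ++ Q) (.add (idT S) (trT R f)) (trT R (.add (idT S) f))
  | S15 {f h P Q R R'} : HasType h R R' → HasType f (P ++ R') (Q ++ R) →
      Eqn P Q (trT R (.comp (.add (idT P) h) f)) (trT R' (.comp f (.add (idT Q) h)))
  | S16 (P : Poly) : Eqn P P (trT P (sigmaT P P)) (idT P)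
  -- uniformity of the trace
  | unif {f g h P Q R R'} :
      HasType f (P ++ R) (Q ++ R) → HasType g (P ++ R') (Q ++ R') → HasType h R R' →
      Eqn (P ++ R) (Q ++ R') (.comp f (.add (idT Q) h)) (.comp (.add (idT P) h) g) →
      Eqn P Q (trT R f) (trT R' g)
  -- successor, zero and predecessor
  | N1 (U V : Mon) : Eqn [U ++ V, U ++ () :: V] [U ++ V, U ++ () :: V]
      (.comp (.comp (.add (.zero U V) (.succ U V)) (.mu (U ++ () :: V))) (.pred U V))
      (idT [U ++ V, U ++ () :: V])
  | N2 (U V : Mon) : Eqn [U ++ () :: V] [U ++ () :: V]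
      (.comp (.pred U V) (.comp (.add (.zero U V) (.succ U V)) (.mu (U ++ () :: V))))
      (.one (U ++ () :: V))
  | N3 (U V W : Mon) : Eqn [U ++ () :: V ++ () :: W] [U ++ () :: V ++ () :: W]
      (.comp (.succ U (V ++ () :: W)) (.succ (U ++ () :: V) W))
      (.comp (.succ (U ++ () :: V) W) (.succ U (V ++ () :: W)))
  | N4 (U V W : Mon) : Eqn [U ++ () :: V ++ W] [U ++ () :: V ++ () :: W]
      (.comp (.succ U (V ++ W)) (.zero (U ++ () :: V) W))
      (.comp (.zero (U ++ () :: V) W) (.succ U (V ++ () :: W)))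
  | N5 (U V W : Mon) : Eqn [U ++ V ++ () :: W] [U ++ () :: V ++ () :: W]
      (.comp (.zero U (V ++ () :: W)) (.succ (U ++ () :: V) W))
      (.comp (.succ (U ++ V) W) (.zero U (V ++ () :: W)))
  | N6 (U V W : Mon) : Eqn [U ++ V ++ W] [U ++ () :: V ++ () :: W]
      (.comp (.zero U (V ++ W)) (.zero (U ++ () :: V) W))
      (.comp (.zero (U ++ V) W) (.zero U (V ++ () :: W)))
  | N7 (U V W : Mon) : Eqn [U ++ () :: V ++ () :: W]
      [U ++ () :: V ++ W, U ++ () :: V ++ () :: W]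
      (.comp (.succ U (V ++ () :: W)) (.pred (U ++ () :: V) W))
      (.comp (.pred (U ++ () :: V) W) (.add (.succ U (V ++ W)) (.succ U (V ++ () :: W))))
  | N8 (U V W : Mon) : Eqn [U ++ V ++ () :: W]
      [U ++ () :: V ++ W, U ++ () :: V ++ () :: W]
      (.comp (.zero U (V ++ () :: W)) (.pred (U ++ () :: V) W))
      (.comp (.pred (U ++ V) W) (.add (.zero U (V ++ W)) (.zero U (V ++ () :: W))))
  | N9 (U V W : Mon) : Eqn [U ++ () :: V ++ () :: W]
      [U ++ V ++ () :: W, U ++ () :: V ++ () :: W]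
      (.comp (.succ (U ++ () :: V) W) (.pred U (V ++ () :: W)))
      (.comp (.pred U (V ++ () :: W)) (.add (.succ (U ++ V) W) (.succ (U ++ () :: V) W)))
  | N10 (U V W : Mon) : Eqn [U ++ () :: V ++ W]
      [U ++ V ++ () :: W, U ++ () :: V ++ () :: W]
      (.comp (.zero (U ++ () :: V) W) (.pred U (V ++ () :: W)))
      (.comp (.pred U (V ++ W)) (.add (.zero (U ++ V) W) (.zero (U ++ () :: V) W)))
  | N11 (U V W : Mon) : Eqn [U ++ () :: V ++ () :: W]
      [U ++ V ++ W, U ++ V ++ () :: W, U ++ () :: V ++ W, U ++ () :: V ++ () :: W]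
      (.comp (.pred U (V ++ () :: W)) (.add (.pred (U ++ V) W) (.pred (U ++ () :: V) W)))
      (.comp (.pred (U ++ () :: V) W)
        (.comp (.add (.pred U (V ++ W)) (.pred U (V ++ () :: W)))
          (.add (.one (U ++ V ++ W))
            (.add (.sigma (U ++ () :: V ++ W) (U ++ V ++ () :: W))
              (.one (U ++ () :: V ++ () :: W))))))

/-! ### Typing of the derived arrows -/

theorem HasType.cast {f : Tm} {P Q P' Q' : Poly} (h : HasType f P Q) (hP : P = P') (hQ : Q = Q') :
    HasType f P' Q' := by subst hP hQ; exact h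

theorem Eqn.cast {f g f' g' : Tm} {P Q P' Q' : Poly} (h : Eqn P Q f g) (hP : P = P') (hQ : Q = Q')
    (hf : f = f') (hg : g = g') : Eqn P' Q' f' g' := by subst hP hQ hf hg; exact h

theorem idT_type : ∀ P : Poly, HasType (idT P) P P
  | [] => .oneZ
  | U :: Q => .add (.one U) (idT_type Q)

theorem sigmaM_type (U : Mon) : ∀ Q : Poly, HasType (sigmaM U Q) (U :: Q) (Q ++ [U])
  | [] => .one U
  | V :: Q => .comp (HasType.add (.sigma U V) (idT_type Q))
      (HasType.add (P := [V]) (Q := [V]) (.one V) (sigmaM_type U Q))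

theorem sigmaT_type : ∀ P Q : Poly, HasType (sigmaT P Q) (P ++ Q) (Q ++ P)
  | [], Q => (idT_type Q).cast rfl (by simp)
  | U :: P, Q => .comp (Q := U :: (Q ++ P))
      (HasType.add (P := [U]) (Q := [U]) (.one U) (sigmaT_type P Q))
      ((HasType.add (sigmaM_type U Q) (idT_type P)).cast (by simp) (by simp))

theorem etaT_type : ∀ P : Poly, HasType (etaT P) [] P
  | [] => .oneZ
  | U :: P => .add (.eta U) (etaT_type P)

theorem muT_type : ∀ P : Poly, HasType (muT P) (P ++ P) P
  | [] => .oneZ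
  | U :: P => .comp
      ((HasType.add (.one U) (.add (sigmaT_type P [U]) (idT_type P))).cast (by simp) rfl)
      ((HasType.add (.mu U) (muT_type P)).cast (by simp) rfl)

theorem trT_type : ∀ (R : Poly) {P Q : Poly} {f : Tm}, HasType f (P ++ R) (Q ++ R) →
    HasType (trT R f) P Q
  | [], _, _, _, h => h.cast (by simp) (by simp)
  | _ :: R, _, _, _, h => .tr (trT_type R (h.cast (by simp) (by simp)))

theorem trT_congr : ∀ (R : Poly) {P Q : Poly} {f g : Tm}, Eqn (P ++ R) (Q ++ R) f g →
    Eqn P Q (trT R f) (trT R g)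
  | [], _, _, _, _, h => h.cast (by simp) (by simp) rfl rfl
  | _ :: R, _, _, _, _, h => .tr (trT_congr R (h.cast (by simp) (by simp) rfl rfl))

/-! ### The category -/

/-- Provable equality of well-formed arrows `P ⟶ Q`. -/
def homSetoid (P Q : Poly) : Setoid {f : Tm // HasType f P Q} where
  r f g := Eqn P Q f.1 g.1
  iseqv := ⟨fun f => .refl f.2, .symm, .trans⟩

/-- Arrows `P ⟶ Q`: well-formed expressions modulo the equations. -/
def Hom (P Q : Poly) : Type := Quotient (homSetoid P Q)

/-- The arrow given by a well-formed expression. -/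
def Hom.mk {P Q : Poly} (f : Tm) (hf : HasType f P Q) : Hom P Q :=
  Quotient.mk (homSetoid P Q) ⟨f, hf⟩

/-- Composition, in diagrammatic order. -/
def Hom.comp {P Q R : Poly} (f : Hom P Q) (g : Hom Q R) : Hom P R :=
  Quotient.map₂ (sa := homSetoid P Q) (sb := homSetoid Q R) (sc := homSetoid P R)
    (fun f g => ⟨.comp f.1 g.1, .comp f.2 g.2⟩) (fun _ _ h _ _ k => Eqn.comp h k) f g

/-- The sum of arrows. -/
def Hom.add {P Q R S : Poly} (f : Hom P Q) (g : Hom R S) : Hom (P ++ R) (Q ++ S) :=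
  Quotient.map₂ (sa := homSetoid P Q) (sb := homSetoid R S) (sc := homSetoid (P ++ R) (Q ++ S))
    (fun f g => ⟨.add f.1 g.1, .add f.2 g.2⟩) (fun _ _ h _ _ k => Eqn.add h k) f g

/-- The trace `Tr^R_{P,Q}`. -/
def Hom.tr (R P Q : Poly) (f : Hom (P ++ R) (Q ++ R)) : Hom P Q :=
  Quotient.map (sa := homSetoid (P ++ R) (Q ++ R)) (sb := homSetoid P Q)
    (fun f => ⟨trT R f.1, trT_type R f.2⟩) (fun _ _ h => trT_congr R h) f

end Abacus

/-- The objects of the category of abacus programs: polynomials over `N`. -/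
def Abacus : Type := Abacus.Poly

namespace Abacus

instance category : Category.{0} Abacus where
  Hom P Q := Hom P Q
  id P := Hom.mk (idT P) (idT_type P)
  comp f g := Hom.comp f g
  id_comp := by
    rintro P Q ⟨f, hf⟩
    exact Quotient.sound (s := homSetoid P Q) (Eqn.S2l hf)
  comp_id := by
    rintro P Q ⟨f, hf⟩
    exact Quotient.sound (s := homSetoid P Q) (Eqn.S2r hf)
  assoc := by
    rintro P Q R S ⟨f, hf⟩ ⟨g, hg⟩ ⟨h, hh⟩
    exact Quotient.sound (s := homSetoid P S) (Eqn.S1 hf hg hh)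

/-! ### Monomial whiskering -/

/-- `U ⊗ P` for a monomial `U`. -/
def mulL (U : Mon) (P : Poly) : Poly := P.map (fun V => U ++ V)

/-- `P ⊗ U` for a monomial `U`. -/
def mulR (U : Mon) (P : Poly) : Poly := P.map (fun V => V ++ U)

/-- `P ⊗ Q`. -/
def mulObj : Poly → Poly → Poly
  | [], _ => []
  | U :: P, Q => mulL U Q ++ mulObj P Q

/-- Monomial left whiskering `U ⋉ f`. -/
def lwM (U : Mon) : Tm → Tm
  | .succ V W => .succ (U ++ V) W
  | .zero V W => .zero (U ++ V) W
  | .pred V W => .pred (U ++ V) W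
  | .one V => .one (U ++ V)
  | .eta V => .eta (U ++ V)
  | .mu V => .mu (U ++ V)
  | .oneZ => .oneZ
  | .sigma V W => .sigma (U ++ V) (U ++ W)
  | .comp f g => .comp (lwM U f) (lwM U g)
  | .add f g => .add (lwM U f) (lwM U g)
  | .tr W f => .tr (U ++ W) (lwM U f)

/-- Monomial right whiskering `f ⋊ U`. -/
def rwM (U : Mon) : Tm → Tm
  | .succ V W => .succ V (W ++ U)
  | .zero V W => .zero V (W ++ U)
  | .pred V W => .pred V (W ++ U)
  | .one V => .one (V ++ U)
  | .eta V => .eta (V ++ U)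
  | .mu V => .mu (V ++ U)
  | .oneZ => .oneZ
  | .sigma V W => .sigma (V ++ U) (W ++ U)
  | .comp f g => .comp (rwM U f) (rwM U g)
  | .add f g => .add (rwM U f) (rwM U g)
  | .tr W f => .tr (W ++ U) (rwM U f)

theorem mulL_append (U : Mon) (P Q : Poly) : mulL U (P ++ Q) = mulL U P ++ mulL U Q := by
  simp [mulL]

theorem lwM_idT (U : Mon) (P : Poly) : lwM U (idT P) = idT (mulL U P) := by
  induction P with
  | nil => rfl
  | cons V P ih => simp_all [idT, lwM, mulL]

theorem lwM_sigmaM (U V : Mon) (P : Poly) :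
    lwM U (sigmaM V P) = sigmaM (U ++ V) (mulL U P) := by
  induction P with
  | nil => rfl
  | cons W P ih =>
    simp only [sigmaM, lwM, ih, lwM_idT]; rfl

theorem lwM_sigmaT (U : Mon) (P Q : Poly) :
    lwM U (sigmaT P Q) = sigmaT (mulL U P) (mulL U Q) := by
  induction P with
  | nil => exact lwM_idT U Q
  | cons W P ih =>
    simp only [sigmaT, lwM, ih, lwM_sigmaM, lwM_idT]; rfl

theorem lwM_etaT (U : Mon) (P : Poly) : lwM U (etaT P) = etaT (mulL U P) := by
  induction P with
  | nil => rfl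
  | cons V P ih => simp_all [etaT, lwM, mulL]

theorem lwM_muT (U : Mon) (P : Poly) : lwM U (muT P) = muT (mulL U P) := by
  induction P with
  | nil => rfl
  | cons V P ih =>
    simp only [muT, lwM, ih, lwM_sigmaT, lwM_idT]; rfl

theorem lwM_trT (U : Mon) (R : Poly) (f : Tm) :
    lwM U (trT R f) = trT (mulL U R) (lwM U f) := by
  induction R with
  | nil => rfl
  | cons V R ih => simp only [trT, lwM, ih]; rfl

theorem lwM_type (U : Mon) {f : Tm} {P Q : Poly} (h : HasType f P Q) :
    HasType (lwM U f) (mulL U P) (mulL U Q) := by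
  induction h with
  | succ V W => exact (HasType.succ (U ++ V) W).cast (by simp [mulL]) (by simp [mulL])
  | zero V W => exact (HasType.zero (U ++ V) W).cast (by simp [mulL]) (by simp [mulL])
  | pred V W => exact (HasType.pred (U ++ V) W).cast (by simp [mulL]) (by simp [mulL])
  | one V => exact .one _
  | eta V => exact .eta _
  | mu V => exact .mu _
  | oneZ => exact .oneZ
  | sigma V W => exact .sigma _ _
  | comp _ _ hf hg => exact .comp hf hg
  | add _ _ hf hg => exact (HasType.add hf hg).cast (mulL_append ..).symm (mulL_append ..).symm
  | tr _ hf => exact .tr (hf.cast (mulL_append ..) (mulL_append ..))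

theorem lwM_congr (U : Mon) {f g : Tm} {P Q : Poly} (h : Eqn P Q f g) :
    Eqn (mulL U P) (mulL U Q) (lwM U f) (lwM U g) := by
  have ap := mulL_append U
  induction h with
  | refl h => exact .refl (lwM_type U h)
  | symm _ ih => exact .symm ih
  | trans _ _ ih ih' => exact .trans ih ih'
  | comp _ _ ih ih' => exact .comp ih ih'
  | add _ _ ih ih' => exact (Eqn.add ih ih').cast (ap ..).symm (ap ..).symm rfl rfl
  | tr _ ih => exact .tr (ih.cast (ap ..) (ap ..) rfl rfl)
  | S1 hf hg hh => exact .S1 (lwM_type U hf) (lwM_type U hg) (lwM_type U hh)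
  | S2l hf => exact (Eqn.S2l (lwM_type U hf)).cast rfl rfl (by simp only [lwM, lwM_idT]) rfl
  | S2r hf => exact (Eqn.S2r (lwM_type U hf)).cast rfl rfl (by simp only [lwM, lwM_idT]) rfl
  | S3 hf hg hh hk =>
    exact (Eqn.S3 (lwM_type U hf) (lwM_type U hg) (lwM_type U hh) (lwM_type U hk)).cast
      (ap ..).symm (ap ..).symm rfl rfl
  | S4l hf => exact .S4l (lwM_type U hf)
  | S4r hf => exact .S4r (lwM_type U hf)
  | S5 hf hg hh =>
    exact (Eqn.S5 (lwM_type U hf) (lwM_type U hg) (lwM_type U hh)).cast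
      (by simp only [ap]) (by simp only [ap]) rfl rfl
  | S6 P Q =>
    exact (Eqn.S6 (mulL U P) (mulL U Q)).cast (ap ..).symm (ap ..).symm
      (by simp only [lwM, lwM_sigmaT]) (by simp only [lwM_idT, ap])
  | S7 Q hf =>
    exact (Eqn.S7 (mulL U Q) (lwM_type U hf)).cast (ap ..).symm (ap ..).symm
      (by simp only [lwM, lwM_sigmaT, lwM_idT]) (by simp only [lwM, lwM_sigmaT, lwM_idT])
  | S8 P =>
    exact (Eqn.S8 (mulL U P)).cast (by simp only [ap]) rfl
      (by simp only [lwM, lwM_muT, lwM_idT]) (by simp only [lwM, lwM_muT, lwM_idT])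
  | S9 P =>
    exact (Eqn.S9 (mulL U P)).cast (by simp only [ap]) rfl
      (by simp only [lwM, lwM_muT, lwM_sigmaT]) (by simp only [lwM_muT])
  | S10 P =>
    exact (Eqn.S10 (mulL U P)).cast rfl rfl
      (by simp only [lwM, lwM_muT, lwM_etaT, lwM_idT]) (by simp only [lwM_idT])
  | S11 hf =>
    exact (Eqn.S11 (lwM_type U hf)).cast (ap ..).symm rfl
      (by simp only [lwM, lwM_muT]) (by simp only [lwM, lwM_muT])
  | S12 hf =>
    exact (Eqn.S12 (lwM_type U hf)).cast rfl rfl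
      (by simp only [lwM, lwM_etaT]) (by simp only [lwM_etaT])
  | S13 hg hf hh =>
    exact (Eqn.S13 (lwM_type U hg) ((lwM_type U hf).cast (ap ..) (ap ..)) (lwM_type U hh)).cast
      rfl rfl (by simp only [lwM, lwM_trT]) (by simp only [lwM, lwM_trT, lwM_idT])
  | S14 S hf =>
    exact (Eqn.S14 (mulL U S) ((lwM_type U hf).cast (ap ..) (ap ..))).cast (ap ..).symm
      (ap ..).symm (by simp only [lwM, lwM_trT, lwM_idT]) (by simp only [lwM, lwM_trT, lwM_idT])
  | S15 hh hf =>
    exact (Eqn.S15 (lwM_type U hh) ((lwM_type U hf).cast (ap ..) (ap ..))).cast rfl rfl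
      (by simp only [lwM, lwM_trT, lwM_idT]) (by simp only [lwM, lwM_trT, lwM_idT])
  | S16 P =>
    exact (Eqn.S16 (mulL U P)).cast rfl rfl
      (by simp only [lwM_trT, lwM_sigmaT]) (by simp only [lwM_idT])
  | unif hf hg hh _ ih =>
    exact (Eqn.unif ((lwM_type U hf).cast (ap ..) (ap ..)) ((lwM_type U hg).cast (ap ..) (ap ..))
      (lwM_type U hh) (ih.cast (ap ..) (ap ..) (by simp only [lwM, lwM_idT])
        (by simp only [lwM, lwM_idT]))).cast rfl rfl
      (by simp only [lwM_trT]) (by simp only [lwM_trT])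
  | N1 V W =>
    exact (Eqn.N1 (U ++ V) W).cast (by simp [mulL]) (by simp [mulL])
      (by simp [lwM]) (by simp [lwM, idT])
  | N2 V W =>
    exact (Eqn.N2 (U ++ V) W).cast (by simp [mulL]) (by simp [mulL])
      (by simp [lwM]) (by simp [lwM])
  | N3 V W X =>
    exact (Eqn.N3 (U ++ V) W X).cast (by simp [mulL]) (by simp [mulL])
      (by simp [lwM]) (by simp [lwM])
  | N4 V W X =>
    exact (Eqn.N4 (U ++ V) W X).cast (by simp [mulL]) (by simp [mulL])
      (by simp [lwM]) (by simp [lwM])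
  | N5 V W X =>
    exact (Eqn.N5 (U ++ V) W X).cast (by simp [mulL]) (by simp [mulL])
      (by simp [lwM]) (by simp [lwM])
  | N6 V W X =>
    exact (Eqn.N6 (U ++ V) W X).cast (by simp [mulL]) (by simp [mulL])
      (by simp [lwM]) (by simp [lwM])
  | N7 V W X =>
    exact (Eqn.N7 (U ++ V) W X).cast (by simp [mulL]) (by simp [mulL])
      (by simp [lwM]) (by simp [lwM])
  | N8 V W X =>
    exact (Eqn.N8 (U ++ V) W X).cast (by simp [mulL]) (by simp [mulL])
      (by simp [lwM]) (by simp [lwM])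
  | N9 V W X =>
    exact (Eqn.N9 (U ++ V) W X).cast (by simp [mulL]) (by simp [mulL])
      (by simp [lwM]) (by simp [lwM])
  | N10 V W X =>
    exact (Eqn.N10 (U ++ V) W X).cast (by simp [mulL]) (by simp [mulL])
      (by simp [lwM]) (by simp [lwM])
  | N11 V W X =>
    exact (Eqn.N11 (U ++ V) W X).cast (by simp [mulL]) (by simp [mulL])
      (by simp [lwM]) (by simp [lwM])

theorem mulR_append (U : Mon) (P Q : Poly) : mulR U (P ++ Q) = mulR U P ++ mulR U Q := by
  simp [mulR]

theorem rwM_idT (U : Mon) (P : Poly) : rwM U (idT P) = idT (mulR U P) := by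
  induction P with
  | nil => rfl
  | cons V P ih => simp_all [idT, rwM, mulR]

theorem rwM_sigmaM (U V : Mon) (P : Poly) :
    rwM U (sigmaM V P) = sigmaM (V ++ U) (mulR U P) := by
  induction P with
  | nil => rfl
  | cons W P ih =>
    simp only [sigmaM, rwM, ih, rwM_idT]; rfl

theorem rwM_sigmaT (U : Mon) (P Q : Poly) :
    rwM U (sigmaT P Q) = sigmaT (mulR U P) (mulR U Q) := by
  induction P with
  | nil => exact rwM_idT U Q
  | cons W P ih =>
    simp only [sigmaT, rwM, ih, rwM_sigmaM, rwM_idT]; rfl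

theorem rwM_etaT (U : Mon) (P : Poly) : rwM U (etaT P) = etaT (mulR U P) := by
  induction P with
  | nil => rfl
  | cons V P ih => simp_all [etaT, rwM, mulR]

theorem rwM_muT (U : Mon) (P : Poly) : rwM U (muT P) = muT (mulR U P) := by
  induction P with
  | nil => rfl
  | cons V P ih =>
    simp only [muT, rwM, ih, rwM_sigmaT, rwM_idT]; rfl

theorem rwM_trT (U : Mon) (R : Poly) (f : Tm) :
    rwM U (trT R f) = trT (mulR U R) (rwM U f) := by
  induction R with
  | nil => rfl
  | cons V R ih => simp only [trT, rwM, ih]; rfl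

theorem rwM_type (U : Mon) {f : Tm} {P Q : Poly} (h : HasType f P Q) :
    HasType (rwM U f) (mulR U P) (mulR U Q) := by
  induction h with
  | succ V W => exact (HasType.succ V (W ++ U)).cast (by simp [mulR]) (by simp [mulR])
  | zero V W => exact (HasType.zero V (W ++ U)).cast (by simp [mulR]) (by simp [mulR])
  | pred V W => exact (HasType.pred V (W ++ U)).cast (by simp [mulR]) (by simp [mulR])
  | one V => exact .one _
  | eta V => exact .eta _
  | mu V => exact .mu _
  | oneZ => exact .oneZ
  | sigma V W => exact .sigma _ _
  | comp _ _ hf hg => exact .comp hf hg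
  | add _ _ hf hg => exact (HasType.add hf hg).cast (mulR_append ..).symm (mulR_append ..).symm
  | tr _ hf => exact .tr (hf.cast (mulR_append ..) (mulR_append ..))

theorem rwM_congr (U : Mon) {f g : Tm} {P Q : Poly} (h : Eqn P Q f g) :
    Eqn (mulR U P) (mulR U Q) (rwM U f) (rwM U g) := by
  have ap := mulR_append U
  induction h with
  | refl h => exact .refl (rwM_type U h)
  | symm _ ih => exact .symm ih
  | trans _ _ ih ih' => exact .trans ih ih'
  | comp _ _ ih ih' => exact .comp ih ih'
  | add _ _ ih ih' => exact (Eqn.add ih ih').cast (ap ..).symm (ap ..).symm rfl rfl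
  | tr _ ih => exact .tr (ih.cast (ap ..) (ap ..) rfl rfl)
  | S1 hf hg hh => exact .S1 (rwM_type U hf) (rwM_type U hg) (rwM_type U hh)
  | S2l hf => exact (Eqn.S2l (rwM_type U hf)).cast rfl rfl (by simp only [rwM, rwM_idT]) rfl
  | S2r hf => exact (Eqn.S2r (rwM_type U hf)).cast rfl rfl (by simp only [rwM, rwM_idT]) rfl
  | S3 hf hg hh hk =>
    exact (Eqn.S3 (rwM_type U hf) (rwM_type U hg) (rwM_type U hh) (rwM_type U hk)).cast
      (ap ..).symm (ap ..).symm rfl rfl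
  | S4l hf => exact .S4l (rwM_type U hf)
  | S4r hf => exact .S4r (rwM_type U hf)
  | S5 hf hg hh =>
    exact (Eqn.S5 (rwM_type U hf) (rwM_type U hg) (rwM_type U hh)).cast
      (by simp only [ap]) (by simp only [ap]) rfl rfl
  | S6 P Q =>
    exact (Eqn.S6 (mulR U P) (mulR U Q)).cast (ap ..).symm (ap ..).symm
      (by simp only [rwM, rwM_sigmaT]) (by simp only [rwM_idT, ap])
  | S7 Q hf =>
    exact (Eqn.S7 (mulR U Q) (rwM_type U hf)).cast (ap ..).symm (ap ..).symm
      (by simp only [rwM, rwM_sigmaT, rwM_idT]) (by simp only [rwM, rwM_sigmaT, rwM_idT])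
  | S8 P =>
    exact (Eqn.S8 (mulR U P)).cast (by simp only [ap]) rfl
      (by simp only [rwM, rwM_muT, rwM_idT]) (by simp only [rwM, rwM_muT, rwM_idT])
  | S9 P =>
    exact (Eqn.S9 (mulR U P)).cast (by simp only [ap]) rfl
      (by simp only [rwM, rwM_muT, rwM_sigmaT]) (by simp only [rwM_muT])
  | S10 P =>
    exact (Eqn.S10 (mulR U P)).cast rfl rfl
      (by simp only [rwM, rwM_muT, rwM_etaT, rwM_idT]) (by simp only [rwM_idT])
  | S11 hf =>
    exact (Eqn.S11 (rwM_type U hf)).cast (ap ..).symm rfl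
      (by simp only [rwM, rwM_muT]) (by simp only [rwM, rwM_muT])
  | S12 hf =>
    exact (Eqn.S12 (rwM_type U hf)).cast rfl rfl
      (by simp only [rwM, rwM_etaT]) (by simp only [rwM_etaT])
  | S13 hg hf hh =>
    exact (Eqn.S13 (rwM_type U hg) ((rwM_type U hf).cast (ap ..) (ap ..)) (rwM_type U hh)).cast
      rfl rfl (by simp only [rwM, rwM_trT]) (by simp only [rwM, rwM_trT, rwM_idT])
  | S14 S hf =>
    exact (Eqn.S14 (mulR U S) ((rwM_type U hf).cast (ap ..) (ap ..))).cast (ap ..).symm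
      (ap ..).symm (by simp only [rwM, rwM_trT, rwM_idT]) (by simp only [rwM, rwM_trT, rwM_idT])
  | S15 hh hf =>
    exact (Eqn.S15 (rwM_type U hh) ((rwM_type U hf).cast (ap ..) (ap ..))).cast rfl rfl
      (by simp only [rwM, rwM_trT, rwM_idT]) (by simp only [rwM, rwM_trT, rwM_idT])
  | S16 P =>
    exact (Eqn.S16 (mulR U P)).cast rfl rfl
      (by simp only [rwM_trT, rwM_sigmaT]) (by simp only [rwM_idT])
  | unif hf hg hh _ ih =>
    exact (Eqn.unif ((rwM_type U hf).cast (ap ..) (ap ..)) ((rwM_type U hg).cast (ap ..) (ap ..))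
      (rwM_type U hh) (ih.cast (ap ..) (ap ..) (by simp only [rwM, rwM_idT])
        (by simp only [rwM, rwM_idT]))).cast rfl rfl
      (by simp only [rwM_trT]) (by simp only [rwM_trT])
  | N1 V W =>
    exact (Eqn.N1 V (W ++ U)).cast (by simp [mulR]) (by simp [mulR])
      (by simp [rwM]) (by simp [rwM, idT])
  | N2 V W =>
    exact (Eqn.N2 V (W ++ U)).cast (by simp [mulR]) (by simp [mulR])
      (by simp [rwM]) (by simp [rwM])
  | N3 V W X =>
    exact (Eqn.N3 V W (X ++ U)).cast (by simp [mulR]) (by simp [mulR])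
      (by simp [rwM]) (by simp [rwM])
  | N4 V W X =>
    exact (Eqn.N4 V W (X ++ U)).cast (by simp [mulR]) (by simp [mulR])
      (by simp [rwM]) (by simp [rwM])
  | N5 V W X =>
    exact (Eqn.N5 V W (X ++ U)).cast (by simp [mulR]) (by simp [mulR])
      (by simp [rwM]) (by simp [rwM])
  | N6 V W X =>
    exact (Eqn.N6 V W (X ++ U)).cast (by simp [mulR]) (by simp [mulR])
      (by simp [rwM]) (by simp [rwM])
  | N7 V W X =>
    exact (Eqn.N7 V W (X ++ U)).cast (by simp [mulR]) (by simp [mulR])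
      (by simp [rwM]) (by simp [rwM])
  | N8 V W X =>
    exact (Eqn.N8 V W (X ++ U)).cast (by simp [mulR]) (by simp [mulR])
      (by simp [rwM]) (by simp [rwM])
  | N9 V W X =>
    exact (Eqn.N9 V W (X ++ U)).cast (by simp [mulR]) (by simp [mulR])
      (by simp [rwM]) (by simp [rwM])
  | N10 V W X =>
    exact (Eqn.N10 V W (X ++ U)).cast (by simp [mulR]) (by simp [mulR])
      (by simp [rwM]) (by simp [rwM])
  | N11 V W X =>
    exact (Eqn.N11 V W (X ++ U)).cast (by simp [mulR]) (by simp [mulR])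
      (by simp [rwM]) (by simp [rwM])

/-! ### The left distributor -/

theorem mulObj_mon (P : Poly) (U : Mon) : mulObj P [U] = mulR U P := by
  induction P with
  | nil => rfl
  | cons V P ih => simp_all [mulObj, mulL, mulR]

theorem mulObj_nil (P : Poly) : mulObj P [] = [] := by
  induction P with
  | nil => rfl
  | cons V P ih => simp [mulObj, mulL, ih]

/-- `δ_{P,Q,R} : P(Q + R) ⟶ PQ + PR`. -/
def deltaT : Poly → Poly → Poly → Tm
  | [], _, _ => .oneZ
  | U :: P, Q, R =>
    .comp (.add (idT (mulL U Q ++ mulL U R)) (deltaT P Q R))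
      (.add (idT (mulL U Q)) (.add (sigmaT (mulL U R) (mulObj P Q)) (idT (mulObj P R))))

/-- The inverse of `δ_{P,Q,R}`. -/
def deltaInvT : Poly → Poly → Poly → Tm
  | [], _, _ => .oneZ
  | U :: P, Q, R =>
    .comp (.add (idT (mulL U Q)) (.add (sigmaT (mulObj P Q) (mulL U R)) (idT (mulObj P R))))
      (.add (idT (mulL U Q ++ mulL U R)) (deltaInvT P Q R))

theorem deltaT_type : ∀ P Q R : Poly,
    HasType (deltaT P Q R) (mulObj P (Q ++ R)) (mulObj P Q ++ mulObj P R)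
  | [], _, _ => .oneZ
  | U :: P, Q, R => .comp
      ((HasType.add (idT_type (mulL U Q ++ mulL U R)) (deltaT_type P Q R)).cast
        (by simp [mulObj, mulL_append]) rfl)
      ((HasType.add (idT_type (mulL U Q))
        (.add (sigmaT_type (mulL U R) (mulObj P Q)) (idT_type (mulObj P R)))).cast
        (by simp) (by simp [mulObj]))

theorem deltaInvT_type : ∀ P Q R : Poly,
    HasType (deltaInvT P Q R) (mulObj P Q ++ mulObj P R) (mulObj P (Q ++ R))
  | [], _, _ => .oneZ
  | U :: P, Q, R => .comp
      ((HasType.add (idT_type (mulL U Q))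
        (.add (sigmaT_type (mulObj P Q) (mulL U R)) (idT_type (mulObj P R)))).cast
        (by simp [mulObj]) (by simp))
      ((HasType.add (idT_type (mulL U Q ++ mulL U R)) (deltaInvT_type P Q R)).cast
        rfl (by simp [mulObj, mulL_append]))

theorem idT_append : ∀ P Q : Poly, Eqn (P ++ Q) (P ++ Q) (.add (idT P) (idT Q)) (idT (P ++ Q))
  | [], Q => .S4l (idT_type Q)
  | U :: P, Q => .trans (.S5 (.one U) (idT_type P) (idT_type Q))
      (.add (P := [U]) (Q := [U]) (.refl (.one U)) (idT_append P Q))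

theorem add_inv {f f' g g' : Tm} {P Q R S : Poly} (hf : HasType f P Q) (hf' : HasType f' Q P)
    (hg : HasType g R S) (hg' : HasType g' S R)
    (h : Eqn P P (.comp f f') (idT P)) (k : Eqn R R (.comp g g') (idT R)) :
    Eqn (P ++ R) (P ++ R) (.comp (.add f g) (.add f' g')) (idT (P ++ R)) :=
  .trans (.S3 hf hg hf' hg') (.trans (.add h k) (idT_append P R))

theorem comp_inv {f f' g g' : Tm} {P Q R : Poly} (hf : HasType f P Q) (hf' : HasType f' Q P)
    (hg : HasType g Q R) (hg' : HasType g' R Q)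
    (h : Eqn P P (.comp f f') (idT P)) (k : Eqn Q Q (.comp g g') (idT Q)) :
    Eqn P P (.comp (.comp f g) (.comp g' f')) (idT P) :=
  .trans (.S1 hf hg (.comp hg' hf')) <|
    .trans (.comp (.refl hf) <| .trans (.symm (.S1 hg hg' hf')) <|
      .trans (.comp k (.refl hf')) (.S2l hf')) h

theorem id_inv (P : Poly) : Eqn P P (.comp (idT P) (idT P)) (idT P) := .S2l (idT_type P)

theorem swap_type (A B D E : Poly) :
    HasType (.add (idT A) (.add (sigmaT B D) (idT E))) (A ++ (B ++ D ++ E)) (A ++ (D ++ B ++ E)) :=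
  .add (idT_type A) (.add (sigmaT_type B D) (idT_type E))

theorem swap_inv (A B D E : Poly) :
    Eqn (A ++ (B ++ D ++ E)) (A ++ (B ++ D ++ E))
      (.comp (.add (idT A) (.add (sigmaT B D) (idT E))) (.add (idT A) (.add (sigmaT D B) (idT E))))
      (idT (A ++ (B ++ D ++ E))) :=
  add_inv (idT_type A) (idT_type A) (.add (sigmaT_type B D) (idT_type E))
    (.add (sigmaT_type D B) (idT_type E)) (id_inv A)
    (add_inv (sigmaT_type B D) (sigmaT_type D B) (idT_type E) (idT_type E) (.S6 B D) (id_inv E))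

theorem deltaT_deltaInvT : ∀ P Q R : Poly,
    Eqn (mulObj P (Q ++ R)) (mulObj P (Q ++ R))
      (.comp (deltaT P Q R) (deltaInvT P Q R)) (idT (mulObj P (Q ++ R)))
  | [], _, _ => id_inv []
  | U :: P, Q, R => by
    have e : mulObj (U :: P) (Q ++ R) = (mulL U Q ++ mulL U R) ++ mulObj P (Q ++ R) := by
      simp [mulObj, mulL_append]
    rw [e]
    have hs := swap_type (mulL U Q) (mulL U R) (mulObj P Q) (mulObj P R)
    have hs' := swap_type (mulL U Q) (mulObj P Q) (mulL U R) (mulObj P R)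
    have e' : mulL U Q ++ (mulL U R ++ mulObj P Q ++ mulObj P R) =
      (mulL U Q ++ mulL U R) ++ (mulObj P Q ++ mulObj P R) := by simp
    exact comp_inv (.add (idT_type _) (deltaT_type P Q R)) (.add (idT_type _) (deltaInvT_type P Q R))
      (hs.cast e' rfl) (hs'.cast rfl e')
      (add_inv (idT_type _) (idT_type _) (deltaT_type P Q R) (deltaInvT_type P Q R)
        (id_inv _) (deltaT_deltaInvT P Q R))
      ((swap_inv ..).cast e' e' rfl (by rw [e']))

theorem deltaInvT_deltaT : ∀ P Q R : Poly,
    Eqn (mulObj P Q ++ mulObj P R) (mulObj P Q ++ mulObj P R)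
      (.comp (deltaInvT P Q R) (deltaT P Q R)) (idT (mulObj P Q ++ mulObj P R))
  | [], _, _ => id_inv []
  | U :: P, Q, R => by
    have e : mulObj (U :: P) Q ++ mulObj (U :: P) R =
        mulL U Q ++ (mulObj P Q ++ mulL U R ++ mulObj P R) := by
      simp [mulObj]
    rw [e]
    have hs := swap_type (mulL U Q) (mulL U R) (mulObj P Q) (mulObj P R)
    have hs' := swap_type (mulL U Q) (mulObj P Q) (mulL U R) (mulObj P R)
    have e' : mulL U Q ++ (mulL U R ++ mulObj P Q ++ mulObj P R) =
      (mulL U Q ++ mulL U R) ++ (mulObj P Q ++ mulObj P R) := by simp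
    exact comp_inv (hs'.cast rfl e') (hs.cast e' rfl)
      (.add (idT_type _) (deltaInvT_type P Q R)) (.add (idT_type _) (deltaT_type P Q R))
      (swap_inv ..)
      (add_inv (idT_type _) (idT_type _) (deltaInvT_type P Q R) (deltaT_type P Q R)
        (id_inv _) (deltaInvT_deltaT P Q R))

/-! ### Polynomial whiskering -/

/-- Polynomial left whiskering `P ⋉ f`. -/
def lwT : Poly → Tm → Tm
  | [], _ => .oneZ
  | U :: P, f => .add (lwM U f) (lwT P f)

/-- Polynomial right whiskering `f ⋊ P` of `f : R ⟶ S`. -/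
def rwT (R S : Poly) (f : Tm) : Poly → Tm
  | [] => .oneZ
  | U :: P =>
    .comp (deltaT R [U] P) (.comp (.add (rwM U f) (rwT R S f P)) (deltaInvT S [U] P))

theorem lwT_type {f : Tm} {R S : Poly} (h : HasType f R S) : ∀ P : Poly,
    HasType (lwT P f) (mulObj P R) (mulObj P S)
  | [] => .oneZ
  | U :: P => .add (lwM_type U h) (lwT_type h P)

theorem lwT_congr {f g : Tm} {R S : Poly} (h : Eqn R S f g) : ∀ P : Poly,
    Eqn (mulObj P R) (mulObj P S) (lwT P f) (lwT P g)
  | [] => .refl .oneZ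
  | U :: P => .add (lwM_congr U h) (lwT_congr h P)

theorem rwT_type {f : Tm} {R S : Poly} (h : HasType f R S) : ∀ P : Poly,
    HasType (rwT R S f P) (mulObj R P) (mulObj S P)
  | [] => HasType.oneZ.cast (mulObj_nil R).symm (mulObj_nil S).symm
  | U :: P => .comp (deltaT_type R [U] P) (.comp
      ((HasType.add (rwM_type U h) (rwT_type h P)).cast
        (by rw [mulObj_mon]) (by rw [mulObj_mon])) (deltaInvT_type S [U] P))

theorem rwT_congr {f g : Tm} {R S : Poly} (h : Eqn R S f g) : ∀ P : Poly,
    Eqn (mulObj R P) (mulObj S P) (rwT R S f P) (rwT R S g P)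
  | [] => (Eqn.refl .oneZ).cast (mulObj_nil R).symm (mulObj_nil S).symm rfl rfl
  | U :: P => .comp (.refl (deltaT_type R [U] P)) (.comp
      ((Eqn.add (rwM_congr U h) (rwT_congr h P)).cast
        (by rw [mulObj_mon]) (by rw [mulObj_mon]) rfl rfl) (.refl (deltaInvT_type S [U] P)))

/-- `P ⋉ f : P ⊗ R ⟶ P ⊗ S` for `f : R ⟶ S`. -/
def Hom.whiskerLeft (P : Poly) {R S : Poly} (f : Hom R S) : Hom (mulObj P R) (mulObj P S) :=
  Quotient.map (sa := homSetoid R S) (sb := homSetoid (mulObj P R) (mulObj P S))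
    (fun f => ⟨lwT P f.1, lwT_type f.2 P⟩) (fun _ _ h => lwT_congr h P) f

/-- `f ⋊ P : R ⊗ P ⟶ S ⊗ P` for `f : R ⟶ S`. -/
def Hom.whiskerRight {R S : Poly} (f : Hom R S) (P : Poly) : Hom (mulObj R P) (mulObj S P) :=
  Quotient.map (sa := homSetoid R S) (sb := homSetoid (mulObj R P) (mulObj S P))
    (fun f => ⟨rwT R S f.1 P, rwT_type f.2 P⟩) (fun _ _ h => rwT_congr h P) f

/-! ### The right-strict Elgot category data on abacus programs -/

/-- The additive tensor product `(+, 0)`. -/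
def addTensor : Elgot.Tensor Abacus where
  obj P Q := (List.append P Q : Poly)
  unit := ([] : Poly)
  hom f g := Hom.add f g

/-- The multiplicative tensor product `(⊗, I)`, with `f ⊗ g = (f ⋊ R') (S ⋉ g)` for `f : R ⟶ S`
and `g : R' ⟶ S'`. -/
def mulTensor : Elgot.Tensor Abacus where
  obj P Q := mulObj P Q
  unit := ([[]] : Poly)
  hom {_ S R' _} f g := Hom.comp (Hom.whiskerRight f R') (Hom.whiskerLeft S g)

/-- The structure `((+, 0, σ), (⊗, I), (μ, η), Tr, δ, (N, (zero_{I,I} + succ_{I,I}) μ_N))`. -/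
def elgotData : Elgot.ElgotData Abacus where
  add := addTensor
  sigma P Q := Hom.mk (sigmaT P Q) (sigmaT_type P Q)
  mul := mulTensor
  mu P := Hom.mk (muT P) (muT_type P)
  eta P := Hom.mk (etaT P) (etaT_type P)
  tr R P Q f := Hom.tr R P Q f
  delta P Q R := Hom.mk (deltaT P Q R) (deltaT_type P Q R)
  nat := ([[()]] : Poly)
  iota := Hom.mk (.comp (.add (.zero [] []) (.succ [] [])) (.mu [()]))
    (.comp (Q := [[()], [()]]) (.add (.zero [] []) (.succ [] [])) (.mu [()]))

end Abacus

/-!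
An arrow of the category is a class of expressions indexed by its endpoints, and the laws to be
proved hold only modulo transports along equalities of polynomials such as
`(P + Q) + R = P + (Q + R)`. The proof works with arrows bundled with their endpoints (`Arr`), for which these transports
vanish, and returns to the category at the end through `toArr_inj`.

The rules for `η` and `μ` make the sum a coproduct (`hom_ext`): arrows out of `P + Q` are equal as
soon as they agree on the two injections. The decomposition of `σ` and `μ` at sums, and the
combinatorial part of the equations on the left distributor `δ`, are checked on injections. As `δ`
is defined by recursion on its left factor, its coherence (`delta_append`, `delta_mul_sig`,
`delta_add_right`, `delta_mulObj`) follows by induction on that factor.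

Left whiskering by a polynomial is a sum of whiskerings by monomials, and right whiskering is such a
sum conjugated by `δ`; whiskerings by monomials are strict with respect to all the structure. Hence
`δ` is natural (`lwPoly_add_mul_delta`, `rwPoly_append_mul_delta`), and whiskering is associative
(`rwPoly_rwPoly`, `rwPoly_lwPoly`, `lwPoly_lwPoly`). Since a sum of two traces is a trace of a sum
(`tr_add_tr`), whiskering by a polynomial also commutes with traces, up to `δ` on the left
(`lwPoly_tr`, `rwPoly_tr`).

What remains is the interchange law `(f ⋊ R') (S ⋉ g) = (R ⋉ g) (f ⋊ S')`, which is both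
functoriality of the product and the last assertion of the theorem. It is stable under composition,
sum and trace in either variable; for a trace this is uniformity, applied along the whiskering of
the other arrow (`Interchange.tr_left`, `Interchange.tr_right`). Structural arrows satisfy it by
naturality. An induction on each variable thus reduces it to two arithmetic generators acting on
different factors of a monomial, and for these it is one of the defining equations of the category.
-/

namespace Abacus

/-! ### Arrows with bundled endpoints -/

/-- The arrow that never terminates, `Tr^P(μ_P (η_Q + 1_P)) : P ⟶ Q`. It only serves as the default
value of the partial operations on `Arr`. -/
def Hom.bot (P Q : Poly) : Hom P Q :=
  Hom.mk (trT P (.comp (muT P) (.add (etaT Q) (idT P))))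
    (trT_type P (.comp (muT_type P) (HasType.add (P := []) (etaT_type Q) (idT_type P))))

/-- An arrow of the category of abacus programs bundled with its domain and its codomain. Equality
of bundled arrows absorbs the transports along equalities of objects. -/
structure Arr where
  dom : Poly
  cod : Poly
  hom : Hom dom cod

namespace Arr

/-- The bundled arrow denoted by a well-formed expression. -/
def ofTm (t : Tm) {P Q : Poly} (h : HasType t P Q) : Arr := ⟨P, Q, Hom.mk t h⟩

/-- Every bundled arrow is denoted by a well-formed expression. Laws of arrows are read off the
derivation rules for expressions through this eliminator. -/
@[elab_as_elim]
theorem rec_ofTm {p : Arr → Prop} (H : ∀ (t : Tm) (P Q : Poly) (h : HasType t P Q), p (ofTm t h))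
    (f : Arr) : p f := by
  obtain ⟨P, Q, f⟩ := f
  induction f using Quotient.inductionOn with
  | h t => exact H t.1 P Q t.2

@[simp] theorem dom_ofTm {t : Tm} {P Q : Poly} (h : HasType t P Q) : (ofTm t h).dom = P := (rfl)
@[simp] theorem cod_ofTm {t : Tm} {P Q : Poly} (h : HasType t P Q) : (ofTm t h).cod = Q := (rfl)

/-- Derivably equal expressions denote the same arrow. The endpoints may be given up to
propositional equality, which is where associativity of lists of monomials is absorbed. -/
theorem ofTm_eq {s t : Tm} {P Q P' Q' : Poly} (e : Eqn P Q s t) (hs : HasType s P' Q')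
    (ht : HasType t P Q) (hP : P' = P) (hQ : Q' = Q) : ofTm s hs = ofTm t ht := by
  subst hP hQ
  have : Hom.mk s hs = Hom.mk t ht := Quotient.sound (s := homSetoid _ _) e
  rw [ofTm, ofTm, this]

theorem ofTm_congr {s t : Tm} {P Q P' Q' : Poly} (e : s = t) (hs : HasType s P' Q')
    (ht : HasType t P Q) (hP : P' = P) (hQ : Q' = Q) : ofTm s hs = ofTm t ht := by
  subst hP hQ e; rfl

/-- Composition `f * g`, in diagrammatic order; the value is meaningful only if `f.cod = g.dom`. -/
instance : Mul Arr where
  mul f g := ⟨f.dom, g.cod,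
    if h : f.cod = g.dom then f.hom.comp (cast (by rw [h]) g.hom) else Hom.bot f.dom g.cod⟩

/-- The sum `f + g` of arrows. -/
instance : Add Arr where
  add f g := ⟨f.dom ++ g.dom, f.cod ++ g.cod, f.hom.add g.hom⟩

/-- The identity `1_P`. -/
def id (P : Poly) : Arr := ofTm (idT P) (idT_type P)

/-- The symmetry `σ_{P,Q}`. -/
def sig (P Q : Poly) : Arr := ofTm (sigmaT P Q) (sigmaT_type P Q)

/-- The codiagonal `μ_P`. -/
def mu (P : Poly) : Arr := ofTm (muT P) (muT_type P)

/-- The initial arrow `η_P`. -/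
def eta (P : Poly) : Arr := ofTm (etaT P) (etaT_type P)

/-- The left distributor `δ_{P,Q,R}`. -/
def delta (P Q R : Poly) : Arr := ofTm (deltaT P Q R) (deltaT_type P Q R)

/-- The inverse of the left distributor `δ_{P,Q,R}`. -/
def deltaInv (P Q R : Poly) : Arr := ofTm (deltaInvT P Q R) (deltaInvT_type P Q R)

/-- The trace `Tr^R_{P,Q}(f)`; the value is meaningful only if `f : P + R ⟶ Q + R`. -/
def tr (R P Q : Poly) (f : Arr) : Arr :=
  ⟨P, Q, if h : f.dom = P ++ R ∧ f.cod = Q ++ R then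
    Hom.tr R P Q (cast (by rw [h.1, h.2]) f.hom) else Hom.bot P Q⟩

/-- Monomial left whiskering `U ⋉ f`. -/
def lwMon (U : Mon) (f : Arr) : Arr :=
  ⟨mulL U f.dom, mulL U f.cod, Quotient.map (sa := homSetoid _ _) (sb := homSetoid _ _)
    (fun t => ⟨lwM U t.1, lwM_type U t.2⟩) (fun _ _ h => lwM_congr U h) f.hom⟩

/-- Monomial right whiskering `f ⋊ U`. -/
def rwMon (U : Mon) (f : Arr) : Arr :=
  ⟨mulR U f.dom, mulR U f.cod, Quotient.map (sa := homSetoid _ _) (sb := homSetoid _ _)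
    (fun t => ⟨rwM U t.1, rwM_type U t.2⟩) (fun _ _ h => rwM_congr U h) f.hom⟩

/-- Polynomial left whiskering `P ⋉ f`. -/
def lwPoly (P : Poly) (f : Arr) : Arr := ⟨mulObj P f.dom, mulObj P f.cod, Hom.whiskerLeft P f.hom⟩

/-- Polynomial right whiskering `f ⋊ P`. -/
def rwPoly (f : Arr) (P : Poly) : Arr := ⟨mulObj f.dom P, mulObj f.cod P, Hom.whiskerRight f.hom P⟩

section Endpoints
variable (f g : Arr) (P Q R : Poly) (U : Mon)

-- The proofs are written `(rfl)` so that `simp` applies these equations as rewrites and not by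
-- definitional unfolding.
@[simp] theorem dom_mul : (f * g).dom = f.dom := (rfl)
@[simp] theorem cod_mul : (f * g).cod = g.cod := (rfl)
@[simp] theorem dom_add : (f + g).dom = f.dom ++ g.dom := (rfl)
@[simp] theorem cod_add : (f + g).cod = f.cod ++ g.cod := (rfl)
@[simp] theorem dom_id : (id P).dom = P := (rfl)
@[simp] theorem cod_id : (id P).cod = P := (rfl)
@[simp] theorem dom_sig : (sig P Q).dom = P ++ Q := (rfl)
@[simp] theorem cod_sig : (sig P Q).cod = Q ++ P := (rfl)
@[simp] theorem dom_mu : (mu P).dom = P ++ P := (rfl)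
@[simp] theorem cod_mu : (mu P).cod = P := (rfl)
@[simp] theorem dom_eta : (eta P).dom = [] := (rfl)
@[simp] theorem cod_eta : (eta P).cod = P := (rfl)
@[simp] theorem dom_delta : (delta P Q R).dom = mulObj P (Q ++ R) := (rfl)
@[simp] theorem cod_delta : (delta P Q R).cod = mulObj P Q ++ mulObj P R := (rfl)
@[simp] theorem dom_deltaInv : (deltaInv P Q R).dom = mulObj P Q ++ mulObj P R := (rfl)
@[simp] theorem cod_deltaInv : (deltaInv P Q R).cod = mulObj P (Q ++ R) := (rfl)
@[simp] theorem dom_tr : (tr R P Q f).dom = P := (rfl)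
@[simp] theorem cod_tr : (tr R P Q f).cod = Q := (rfl)
@[simp] theorem dom_lwMon : (lwMon U f).dom = mulL U f.dom := (rfl)
@[simp] theorem cod_lwMon : (lwMon U f).cod = mulL U f.cod := (rfl)
@[simp] theorem dom_rwMon : (rwMon U f).dom = mulR U f.dom := (rfl)
@[simp] theorem cod_rwMon : (rwMon U f).cod = mulR U f.cod := (rfl)
@[simp] theorem dom_lwPoly : (lwPoly P f).dom = mulObj P f.dom := (rfl)
@[simp] theorem cod_lwPoly : (lwPoly P f).cod = mulObj P f.cod := (rfl)
@[simp] theorem dom_rwPoly : (rwPoly f P).dom = mulObj f.dom P := (rfl)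
@[simp] theorem cod_rwPoly : (rwPoly f P).cod = mulObj f.cod P := (rfl)

end Endpoints

/-! ### Operations on expressions -/

theorem ofTm_mul {s t : Tm} {P Q Q' R : Poly} (hs : HasType s P Q) (ht : HasType t Q' R)
    (e : Q = Q') (h : HasType (.comp s t) P R) : ofTm s hs * ofTm t ht = ofTm (.comp s t) h := by
  subst e
  change Arr.mk _ _ (dite _ _ _) = _
  exact congrArg (Arr.mk P R) (dif_pos rfl)

/-- The composite of expressions denotes the composite of arrows, when the endpoints agree only up
to propositional equality. -/
theorem ofTm_comp {s t : Tm} {P Q P' Q' R R' : Poly} (h : HasType (.comp s t) P R)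
    (hs : HasType s P' Q) (ht : HasType t Q' R') (hP : P = P') (e : Q = Q') (hR : R = R') :
    ofTm (.comp s t) h = ofTm s hs * ofTm t ht := by
  subst hP hR
  exact (ofTm_mul hs ht e h).symm

theorem ofTm_add {s t : Tm} {P Q P' Q' : Poly} (hs : HasType s P Q) (ht : HasType t P' Q') :
    ofTm s hs + ofTm t ht = ofTm (.add s t) (.add hs ht) := rfl

theorem tr_ofTm {t : Tm} {P Q R P' Q' : Poly} (ht : HasType t P' Q') (hP : P' = P ++ R)
    (hQ : Q' = Q ++ R) (h : HasType (trT R t) P Q) :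
    tr R P Q (ofTm t ht) = ofTm (trT R t) h := by
  subst hP hQ
  rw [tr, dif_pos ⟨rfl, rfl⟩]
  rfl

theorem lwMon_ofTm {t : Tm} {P Q : Poly} (U : Mon) (ht : HasType t P Q) :
    lwMon U (ofTm t ht) = ofTm (lwM U t) (lwM_type U ht) := rfl

theorem rwMon_ofTm {t : Tm} {P Q : Poly} (U : Mon) (ht : HasType t P Q) :
    rwMon U (ofTm t ht) = ofTm (rwM U t) (rwM_type U ht) := rfl

/-! ### The additive structure -/

@[simp] theorem mul_assoc {f g h : Arr} (e : f.cod = g.dom) (e' : g.cod = h.dom) :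
    f * g * h = f * (g * h) := by
  induction f using rec_ofTm with | H s P Q hs => ?_
  induction g using rec_ofTm with | H t P' Q' ht => ?_
  induction h using rec_ofTm with | H u P'' Q'' hu => ?_
  simp only [cod_ofTm, dom_ofTm] at e e'
  subst e e'
  rw [ofTm_mul hs ht rfl (.comp hs ht), ofTm_mul ht hu rfl (.comp ht hu),
    ofTm_mul _ _ rfl (.comp (.comp hs ht) hu), ofTm_mul _ _ rfl (.comp hs (.comp ht hu))]
  exact ofTm_eq (.S1 hs ht hu) _ _ rfl rfl

@[simp] theorem id_mul {f : Arr} {P : Poly} (e : f.dom = P) : id P * f = f := by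
  induction f using rec_ofTm with | H s P' Q hs => ?_
  simp only [dom_ofTm] at e
  subst e
  rw [id, ofTm_mul _ _ rfl (.comp (idT_type _) hs)]
  exact ofTm_eq (.S2l hs) _ _ rfl rfl

@[simp] theorem mul_id {f : Arr} {P : Poly} (e : f.cod = P) : f * id P = f := by
  induction f using rec_ofTm with | H s P' Q hs => ?_
  simp only [cod_ofTm] at e
  subst e
  rw [id, ofTm_mul _ _ rfl (.comp hs (idT_type _))]
  exact ofTm_eq (.S2r hs) _ _ rfl rfl

theorem add_mul_add {f g h k : Arr} (e : f.cod = h.dom) (e' : g.cod = k.dom) :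
    (f + g) * (h + k) = f * h + g * k := by
  induction f using rec_ofTm with | H s P Q hs => ?_
  induction g using rec_ofTm with | H t P' Q' ht => ?_
  induction h using rec_ofTm with | H u R S hu => ?_
  induction k using rec_ofTm with | H v R' S' hv => ?_
  simp only [cod_ofTm, dom_ofTm] at e e'
  subst e e'
  rw [ofTm_mul hs hu rfl (.comp hs hu), ofTm_mul ht hv rfl (.comp ht hv)]
  simp only [ofTm_add]
  rw [ofTm_mul _ _ rfl (.comp (.add hs ht) (.add hu hv))]
  exact ofTm_eq (.S3 hs ht hu hv) _ _ rfl rfl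

@[simp] theorem id_nil_add (f : Arr) : id [] + f = f := by
  induction f using rec_ofTm with | H s P Q hs => ?_
  exact ofTm_eq (.S4l hs) _ _ rfl rfl

@[simp] theorem add_id_nil (f : Arr) : f + id [] = f := by
  induction f using rec_ofTm with | H s P Q hs => ?_
  exact ofTm_eq (.S4r hs) _ _ (by simp) (by simp)

theorem add_assoc (f g h : Arr) : f + g + h = f + (g + h) := by
  induction f using rec_ofTm with | H s P Q hs => ?_
  induction g using rec_ofTm with | H t P' Q' ht => ?_
  induction h using rec_ofTm with | H u R S hu => ?_
  exact (ofTm_eq (.symm (.S5 hs ht hu)) _ _ (by simp) (by simp)).symm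

@[simp] theorem id_append (P Q : Poly) : id (P ++ Q) = id P + id Q :=
  (ofTm_eq (idT_append P Q) _ _ rfl rfl).symm

@[simp] theorem sig_mul_sig (P Q : Poly) : sig P Q * sig Q P = id P + id Q := by
  rw [← id_append, sig, sig, ofTm_mul _ _ rfl (.comp (sigmaT_type P Q) (sigmaT_type Q P))]
  exact ofTm_eq (.S6 P Q) _ _ rfl rfl

@[simp] theorem sig_nil_left (P : Poly) : sig [] P = id P :=
  ofTm_congr rfl _ _ rfl (by simp)

@[simp] theorem sig_nil_right (P : Poly) : sig P [] = id P := by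
  have h := sig_mul_sig P []
  rwa [sig_nil_left, mul_id (by simp), add_id_nil] at h

/-- Naturality of the symmetry in its first variable; the other variable follows because the
symmetry is its own inverse. -/
theorem add_id_mul_sig {f : Arr} {P : Poly} (Q : Poly) (e : f.cod = P) :
    (f + id Q) * sig P Q = sig f.dom Q * (id Q + f) := by
  induction f using rec_ofTm with | H s P' Q' hs => ?_
  simp only [cod_ofTm] at e
  subst e
  simp only [id, sig, ofTm_add, dom_ofTm]
  rw [ofTm_mul _ _ rfl (.comp (.add hs (idT_type _)) (sigmaT_type _ _)),
    ofTm_mul _ _ rfl (.comp (sigmaT_type _ _) (.add (idT_type _) hs))]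
  exact ofTm_eq (.S7 Q hs) _ _ rfl rfl

theorem id_add_mul_sig {g : Arr} {Q : Poly} (P : Poly) (e : g.cod = Q) :
    (id P + g) * sig P Q = sig P g.dom * (g + id P) := by
  subst e
  have h := add_id_mul_sig (f := g) P rfl
  have h1 : sig P g.dom * ((g + id P) * sig g.cod P) * sig P g.cod = sig P g.dom * (g + id P) := by
    rw [mul_assoc (by simp) (by simp), mul_assoc (by simp) (by simp), sig_mul_sig, ← id_append,
      mul_id (by simp)]
  rw [← h1, h, ← mul_assoc (by simp) (by simp), sig_mul_sig, ← id_append, id_mul (by simp)]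

theorem add_mul_sig {f g : Arr} {P Q : Poly} (e : f.cod = P) (e' : g.cod = Q) :
    (f + g) * sig P Q = sig f.dom g.dom * (g + f) := by
  have h : f + g = (f + id g.dom) * (id f.cod + g) := by
    rw [add_mul_add (by simp) (by simp), mul_id rfl, id_mul rfl]
  have h' : g + f = (id g.dom + f) * (g + id f.cod) := by
    rw [add_mul_add (by simp) (by simp), mul_id rfl, id_mul rfl]
  subst e e'
  rw [h, mul_assoc (by simp) (by simp), id_add_mul_sig _ rfl, ← mul_assoc (by simp) (by simp),
    add_id_mul_sig _ rfl, mul_assoc (by simp) (by simp), h']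

theorem mu_assoc (P : Poly) : (mu P + id P) * mu P = (id P + mu P) * mu P := by
  simp only [id, mu, ofTm_add]
  rw [ofTm_mul _ _ rfl (.comp (.add (muT_type _) (idT_type _)) (muT_type _)),
    ofTm_mul _ _ rfl (.comp (.add (idT_type _) (muT_type _)) (muT_type _))]
  exact ofTm_eq ((Eqn.S8 P).cast (by simp) rfl rfl rfl) _ _ (by simp) rfl

@[simp] theorem sig_mul_mu (P : Poly) : sig P P * mu P = mu P := by
  rw [sig, mu, ofTm_mul _ _ rfl (.comp (sigmaT_type _ _) (muT_type _))]
  exact ofTm_eq (.S9 P) _ _ rfl rfl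

theorem eta_add_id_mul_mu (P : Poly) : (eta P + id P) * mu P = id P := by
  simp only [eta, id, mu, ofTm_add]
  rw [ofTm_mul _ _ rfl (.comp (.add (etaT_type _) (idT_type _)) (muT_type _))]
  exact ofTm_eq (.S10 P) _ _ rfl rfl

theorem id_add_eta_mul_mu (P : Poly) : (id P + eta P) * mu P = id P := by
  rw [← sig_mul_mu, ← mul_assoc (by simp) (by simp), id_add_mul_sig P (by simp)]
  rw [dom_eta, sig_nil_right, mul_assoc (by simp) (by simp), eta_add_id_mul_mu,
    id_mul (by simp)]

theorem add_self_mul_mu (f : Arr) : (f + f) * mu f.cod = mu f.dom * f := by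
  induction f using rec_ofTm with | H s P Q hs => ?_
  simp only [mu, ofTm_add, dom_ofTm, cod_ofTm]
  rw [ofTm_mul _ _ rfl (.comp (.add hs hs) (muT_type _)),
    ofTm_mul _ _ rfl (.comp (muT_type _) hs)]
  exact ofTm_eq (.S11 hs) _ _ rfl rfl

theorem eta_mul {f : Arr} {P : Poly} (e : f.dom = P) : eta P * f = eta f.cod := by
  induction f using rec_ofTm with | H s P Q hs => ?_
  simp only [dom_ofTm] at e
  subst e
  simp only [eta, cod_ofTm]
  rw [ofTm_mul _ _ rfl (.comp (etaT_type _) hs)]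
  exact ofTm_eq (.S12 hs) _ _ rfl rfl

@[simp] theorem eta_nil : eta [] = id [] := rfl

/-- The zero object is initial. -/
theorem eq_eta {f : Arr} (e : f.dom = []) : f = eta f.cod := by
  rw [← eta_mul e, eta_nil, id_mul e]

@[simp] theorem eta_append (P Q : Poly) : eta (P ++ Q) = eta P + eta Q :=
  (eq_eta (f := eta P + eta Q) (by simp)).symm

@[simp] theorem mu_nil : mu [] = id [] := rfl

theorem ofTm_one (U : Mon) : ofTm (.one U) (.one U) = id [U] :=
  (add_id_nil (ofTm (.one U) (.one U))).symm

theorem ofTm_eta (U : Mon) : ofTm (.eta U) (.eta U) = eta [U] :=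
  (add_id_nil (ofTm (.eta U) (.eta U))).symm

/-- The auxiliary symmetry of a monomial past a polynomial is the symmetry at the one-term
polynomial. -/
theorem sigmaM_eq (U : Mon) (P : Poly) : ofTm (sigmaM U P) (sigmaM_type U P) = sig [U] P := by
  have e : sig [U] P = (id [U] + id P) * (ofTm (sigmaM U P) (sigmaM_type U P) + id []) := by
    rw [← ofTm_one]
    exact ofTm_comp _ (HasType.add (.one U) (idT_type P))
      (HasType.add (sigmaM_type U P) .oneZ) rfl (by simp) (by simp)
  rw [e, ← id_append, id_mul (by simp), add_id_nil]

/-- The defining clause of the codiagonal. The codiagonal at a monomial is still the generator here;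
`ofTm_mu` identifies it with `mu [U]`, which yields `mu_cons`. -/
theorem mu_cons' (U : Mon) (P : Poly) :
    mu (U :: P) = (id [U] + (sig P [U] + id P)) * (ofTm (.mu U) (.mu U) + mu P) := by
  rw [← ofTm_one]
  exact ofTm_comp _ (HasType.add (.one U) (.add (sigmaT_type P [U]) (idT_type P)))
    (HasType.add (.mu U) (muT_type P)) (by simp) (by simp) rfl

theorem ofTm_mu (U : Mon) : ofTm (.mu U) (.mu U) = mu [U] := by
  rw [mu_cons', mu_nil, add_id_nil, add_id_nil, sig_nil_left, ← id_append, id_mul (by simp)]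

theorem mu_cons (U : Mon) (P : Poly) :
    mu (U :: P) = (id [U] + (sig P [U] + id P)) * (mu [U] + mu P) := by
  rw [mu_cons', ofTm_mu]

theorem ofTm_sigma (U V : Mon) : ofTm (.sigma U V) (.sigma U V) = sig [U] [V] := by
  have e : ofTm (sigmaM U [V]) (sigmaM_type U [V]) =
      (ofTm (.sigma U V) (.sigma U V) + id []) * (id [V] + id [U]) := by
    rw [← ofTm_one, ← ofTm_one]
    exact (ofTm_mul (HasType.add (.sigma U V) .oneZ) (HasType.add (.one V) (.one U)) rfl _).symm
  rw [← sigmaM_eq, e, add_id_nil, ← id_append]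
  exact (mul_id rfl).symm

/-! ### The sum is a coproduct -/

/-- The first injection `P ⟶ P + Q`. -/
def inl (P Q : Poly) : Arr := id P + eta Q

/-- The second injection `Q ⟶ P + Q`. -/
def inr (P Q : Poly) : Arr := eta P + id Q

section Injections
variable {f g k : Arr} {P Q R : Poly}

@[simp] theorem dom_inl : (inl P Q).dom = P := by simp [inl]
@[simp] theorem cod_inl : (inl P Q).cod = P ++ Q := by simp [inl]
@[simp] theorem dom_inr : (inr P Q).dom = Q := by simp [inr]
@[simp] theorem cod_inr : (inr P Q).cod = P ++ Q := by simp [inr]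

theorem inr_nil_left : inr [] Q = id Q := by simp [inr]

theorem mul_inl (e : f.cod = P) : f * inl P Q = f + eta Q := by
  have h := add_mul_add (f := f) (g := id []) (h := id P) (k := eta Q) (by simp [e]) (by simp)
  rwa [add_id_nil, mul_id e, id_mul (dom_eta Q)] at h

theorem mul_inr (e : f.cod = Q) : f * inr P Q = eta P + f := by
  have h := add_mul_add (f := id []) (g := f) (h := eta P) (k := id Q) (by simp) (by simp [e])
  rwa [id_nil_add, mul_id e, id_mul (dom_eta P)] at h

@[simp] theorem inl_add (e : f.dom = P) (e' : g.dom = Q) :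
    inl P Q * (f + g) = f * inl f.cod g.cod := by
  rw [mul_inl rfl, inl, add_mul_add (by simp [e]) (by simp [e']), eta_mul e', id_mul e]

@[simp] theorem inr_add (e : f.dom = P) (e' : g.dom = Q) :
    inr P Q * (f + g) = g * inr f.cod g.cod := by
  rw [mul_inr rfl, inr, add_mul_add (by simp [e]) (by simp [e']), eta_mul e, id_mul e']

@[simp] theorem inl_sig : inl P Q * sig P Q = inr Q P := by
  rw [inl, inr, id_add_mul_sig P (by simp), dom_eta, sig_nil_right, id_mul (by simp)]

@[simp] theorem inr_sig : inr P Q * sig P Q = inl Q P := by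
  rw [inl, inr, add_id_mul_sig Q (by simp), dom_eta, sig_nil_left, id_mul (by simp)]

@[simp] theorem inl_mu : inl P P * mu P = id P := id_add_eta_mul_mu P
@[simp] theorem inr_mu : inr P P * mu P = id P := eta_add_id_mul_mu P

@[simp] theorem inl_inl : inl P Q * inl (P ++ Q) R = inl P (Q ++ R) := by
  rw [mul_inl (by simp), inl, inl, eta_append, add_assoc]

theorem inr_inr : inr Q R * inr P (Q ++ R) = inr (P ++ Q) R := by
  rw [mul_inr (by simp), inr, inr, eta_append, add_assoc]

@[simp] theorem inr_inl : inr P Q * inl (P ++ Q) R = inl Q R * inr P (Q ++ R) := by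
  rw [mul_inl (by simp), mul_inr (by simp), inr, inl, add_assoc]

@[simp] theorem inr_append : inr (P ++ Q) R = inr Q R * inr P (Q ++ R) := inr_inr.symm

end Injections

/-- The identity of `U + P` is the copairing of the two injections. With the
naturality of `μ`, this makes the sum a coproduct. -/
theorem inl_add_inr_mul_mu_cons (U : Mon) (P : Poly) :
    (inl [U] P + inr [U] P) * mu (U :: P) = id (U :: P) := by
  have e : (eta P + eta [U]) * sig P [U] = eta [U] + eta P := by
    rw [add_mul_sig (by simp) (by simp), dom_eta, dom_eta, sig_nil_left, id_mul (by simp)]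
  have h : inl [U] P + inr [U] P = id [U] + (eta P + eta [U] + id P) := by
    simp only [inl, inr, add_assoc]
  have h' : id (U :: P) = id [U] + id P := id_append [U] P
  have h1 : (id [U] + (eta P + eta [U] + id P)) * (id [U] + (sig P [U] + id P)) =
      (id [U] + eta [U]) + (eta P + id P) := by
    rw [add_mul_add (by simp) (by simp), add_mul_add (by simp) (by simp), e,
      id_mul (dom_id _), id_mul (dom_id _), add_assoc, add_assoc]
  rw [mu_cons, h, ← mul_assoc (by simp) (by simp), h1, add_mul_add (by simp) (by simp),
    id_add_eta_mul_mu, eta_add_id_mul_mu, h']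

theorem hom_ext_cons {f g : Arr} {U : Mon} {P : Poly} (hf : f.dom = U :: P) (hg : g.dom = U :: P)
    (e : f.cod = g.cod) (hl : inl [U] P * f = inl [U] P * g) (hr : inr [U] P * f = inr [U] P * g) :
    f = g := by
  have key : ∀ k : Arr, k.dom = U :: P →
      k = (inl [U] P * k + inr [U] P * k) * mu k.cod := by
    intro k hk
    -- `k = (inl + inr) μ k`, and `μ k = (k + k) μ` moves `k` past the codiagonal.
    rw [← add_mul_add (by simp [hk]) (by simp [hk]), mul_assoc (by simp [hk]) (by simp),
      add_self_mul_mu, ← mul_assoc (by simp [hk]) (by simp), hk, inl_add_inr_mul_mu_cons,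
      id_mul hk]
  rw [key f hf, key g hg, hl, hr, e]

/-- The sum is a coproduct: arrows out of `P + Q` agree if they agree on both injections. The
additive coherence equations, and those of the distributor, are checked through this principle. -/
theorem hom_ext {f g : Arr} {P Q : Poly} (hf : f.dom = P ++ Q) (hg : g.dom = P ++ Q)
    (e : f.cod = g.cod) (hl : inl P Q * f = inl P Q * g) (hr : inr P Q * f = inr P Q * g) :
    f = g := by
  induction P generalizing f g with
  | nil => simpa [inr_nil_left, hf, hg] using hr
  | cons U P ih =>
    have h2 : inl [U] (P ++ Q) = inl [U] P * inl (U :: P) Q := (inl_inl (P := [U])).symm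
    refine hom_ext_cons (P := P ++ Q) hf hg e ?_ (ih (by simp) (by simp) e ?_ ?_)
    · rw [h2, mul_assoc (by simp) (by simp [hf]), hl, mul_assoc (by simp) (by simp [hg])]
    · have h3 : inl P Q * inr [U] (P ++ Q) = inr [U] P * inl (U :: P) Q := (inr_inl (P := [U])).symm
      rw [← mul_assoc (by simp) (by simp [hf]), ← mul_assoc (by simp) (by simp [hg]), h3,
        mul_assoc (by simp) (by simp [hf]), hl, mul_assoc (by simp) (by simp [hg])]
    · rw [← mul_assoc (by simp) (by simp [hf]), ← mul_assoc (by simp) (by simp [hg]), inr_inr]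
      exact hr

end Arr
end Abacus
namespace Abacus
namespace Arr

/-! ### Coherence of the additive structure -/

section Reassoc
variable {f g k : Arr} {P Q R S : Poly}

@[simp] theorem id_add_id_mul (e : f.dom = P ++ Q) : (id P + id Q) * f = f := by
  rw [← id_append, id_mul e]

@[simp] theorem mul_id_add_id (e : f.cod = P ++ Q) : f * (id P + id Q) = f := by
  rw [← id_append, mul_id e]

/-- Together with `add_mul_eq`, this rewrites a sum of composites as a composite of sums, which is
the form in which the rules for injections apply. -/
theorem mul_add_eq (e : f.cod = g.dom) (k : Arr) : f * g + k = (f + id k.dom) * (g + k) := by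
  rw [add_mul_add e (by simp), id_mul rfl]

theorem add_mul_eq (e : f.cod = g.dom) (k : Arr) : k + f * g = (k + f) * (id k.cod + g) := by
  rw [add_mul_add (by simp) e, mul_id rfl]

@[simp] theorem id_add_id_add_id_mul (e : f.dom = P ++ (Q ++ R)) :
    (id P + (id Q + id R)) * f = f := by
  rw [← id_append, id_add_id_mul e]

-- The rules for injections followed by a sum, a symmetry or a codiagonal, in the form that applies
-- to composites associated to the right.
@[simp] theorem inl_add_assoc (e : f.dom = P) (e' : g.dom = Q) (h : f.cod ++ g.cod = k.dom) :
    inl P Q * ((f + g) * k) = f * (inl f.cod g.cod * k) := by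
  rw [← mul_assoc (by simp [e, e']) (by simp [h]), inl_add e e', mul_assoc (by simp) (by simp [h])]

@[simp] theorem inr_add_assoc (e : f.dom = P) (e' : g.dom = Q) (h : f.cod ++ g.cod = k.dom) :
    inr P Q * ((f + g) * k) = g * (inr f.cod g.cod * k) := by
  rw [← mul_assoc (by simp [e, e']) (by simp [h]), inr_add e e', mul_assoc (by simp) (by simp [h])]

@[simp] theorem inl_sig_assoc (h : Q ++ P = k.dom) :
    inl P Q * (sig P Q * k) = inr Q P * k := by
  rw [← mul_assoc (by simp) (by simp [h]), inl_sig]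

@[simp] theorem inr_sig_assoc (h : Q ++ P = k.dom) :
    inr P Q * (sig P Q * k) = inl Q P * k := by
  rw [← mul_assoc (by simp) (by simp [h]), inr_sig]

@[simp] theorem inl_mu_assoc (h : P = k.dom) : inl P P * (mu P * k) = k := by
  rw [← mul_assoc (by simp) (by simp [h]), inl_mu, id_mul h.symm]

@[simp] theorem inr_mu_assoc (h : P = k.dom) : inr P P * (mu P * k) = k := by
  rw [← mul_assoc (by simp) (by simp [h]), inr_mu, id_mul h.symm]

@[simp] theorem inl_inl_assoc (h : P ++ (Q ++ R) = k.dom) :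
    inl P Q * (inl (P ++ Q) R * k) = inl P (Q ++ R) * k := by
  rw [← mul_assoc (by simp) (by simp [h]), inl_inl]

theorem inr_inr_assoc (h : P ++ (Q ++ R) = k.dom) :
    inr Q R * (inr P (Q ++ R) * k) = inr (P ++ Q) R * k := by
  rw [← mul_assoc (by simp) (by simp [h]), inr_inr]

@[simp] theorem inr_inl_assoc (h : P ++ (Q ++ R) = k.dom) :
    inr P Q * (inl (P ++ Q) R * k) = inl Q R * (inr P (Q ++ R) * k) := by
  rw [← mul_assoc (by simp) (by simp [h]), inr_inl, mul_assoc (by simp) (by simp [h])]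

-- In the next rules the summands of `f + g` do not match the injection: `f` is defined on the first
-- two of the three summands.
@[simp] theorem inl_two_add (e : f.dom = P ++ Q) (e' : g.dom = R) :
    inl P (Q ++ R) * (f + g) = inl P Q * (f * inl f.cod g.cod) := by
  rw [← inl_inl, mul_assoc (by simp) (by simp [e, e']), inl_add e e']

@[simp] theorem inl_two_add_assoc (e : f.dom = P ++ Q) (e' : g.dom = R)
    (h : f.cod ++ g.cod = k.dom) :
    inl P (Q ++ R) * ((f + g) * k) = inl P Q * (f * (inl f.cod g.cod * k)) := by
  rw [← inl_inl, mul_assoc (by simp) (by simp [e, e']), inl_add_assoc e e' h]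

@[simp] theorem inl_inr_two_add (e : f.dom = P ++ Q) (e' : g.dom = R) :
    inl Q R * (inr P (Q ++ R) * (f + g)) = inr P Q * (f * inl f.cod g.cod) := by
  rw [← inr_inl_assoc (by simp [e, e']), inl_add e e']

@[simp] theorem inl_inr_two_add_assoc (e : f.dom = P ++ Q) (e' : g.dom = R)
    (h : f.cod ++ g.cod = k.dom) :
    inl Q R * (inr P (Q ++ R) * ((f + g) * k)) = inr P Q * (f * (inl f.cod g.cod * k)) := by
  rw [← inr_inl_assoc (by simp [e, e']), inl_add_assoc e e' h]

@[simp] theorem inr_inr_two_add (e : f.dom = P ++ Q) (e' : g.dom = R) :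
    inr Q R * (inr P (Q ++ R) * (f + g)) = g * inr f.cod g.cod := by
  rw [inr_inr_assoc (by simp [e, e']), inr_add e e']

@[simp] theorem inr_inr_two_add_assoc (e : f.dom = P ++ Q) (e' : g.dom = R)
    (h : f.cod ++ g.cod = k.dom) :
    inr Q R * (inr P (Q ++ R) * ((f + g) * k)) = g * (inr f.cod g.cod * k) := by
  rw [inr_inr_assoc (by simp [e, e']), inr_add_assoc e e' h]

end Reassoc

theorem hom_ext₃ {f g : Arr} {P Q R : Poly} (hf : f.dom = P ++ (Q ++ R))
    (hg : g.dom = P ++ (Q ++ R)) (e : f.cod = g.cod)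
    (h₁ : inl P (Q ++ R) * f = inl P (Q ++ R) * g)
    (h₂ : inl Q R * (inr P (Q ++ R) * f) = inl Q R * (inr P (Q ++ R) * g))
    (h₃ : inr Q R * (inr P (Q ++ R) * f) = inr Q R * (inr P (Q ++ R) * g)) : f = g :=
  hom_ext hf hg e h₁ (hom_ext (by simp) (by simp) (by simp [e]) h₂ h₃)

theorem hom_ext₄ {f g : Arr} {P Q R S : Poly} (hf : f.dom = P ++ (Q ++ (R ++ S)))
    (hg : g.dom = P ++ (Q ++ (R ++ S))) (e : f.cod = g.cod)
    (h₁ : inl P (Q ++ (R ++ S)) * f = inl P (Q ++ (R ++ S)) * g)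
    (h₂ : inl Q (R ++ S) * (inr P (Q ++ (R ++ S)) * f) =
      inl Q (R ++ S) * (inr P (Q ++ (R ++ S)) * g))
    (h₃ : inl R S * (inr Q (R ++ S) * (inr P (Q ++ (R ++ S)) * f)) =
      inl R S * (inr Q (R ++ S) * (inr P (Q ++ (R ++ S)) * g)))
    (h₄ : inr R S * (inr Q (R ++ S) * (inr P (Q ++ (R ++ S)) * f)) =
      inr R S * (inr Q (R ++ S) * (inr P (Q ++ (R ++ S)) * g))) : f = g :=
  hom_ext₃ hf hg e h₁ h₂ (hom_ext (by simp) (by simp) (by simp [e]) h₃ h₄)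

theorem sig_append_left (P Q R : Poly) :
    sig (P ++ Q) R = (id P + sig Q R) * (sig P R + id Q) := by
  apply hom_ext₃ (P := P) (Q := Q) (R := R) (by simp) (by simp) (by simp)
  · rw [← inl_inl, mul_assoc (by simp) (by simp), inl_sig]
    simp
  · rw [← inr_inl_assoc (by simp), inl_sig]
    simp
  · rw [inr_inr_assoc (by simp), inr_sig]
    simp

theorem sig_append_right (P Q R : Poly) :
    sig P (Q ++ R) = (sig P Q + id R) * (id Q + sig P R) := by
  apply hom_ext₃ (P := P) (Q := Q) (R := R) (by simp) (by simp) (by simp)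
  · simp
  · rw [inr_sig]
    simp
  · rw [inr_sig]
    simp

theorem mu_append (P Q : Poly) :
    mu (P ++ Q) = (id P + (sig Q P + id Q)) * (mu P + mu Q) := by
  apply hom_ext₄ (P := P) (Q := Q) (R := P) (S := Q) (by simp) (by simp) (by simp)
  · rw [← inl_inl (P := P) (Q := Q) (R := P ++ Q), mul_assoc (by simp) (by simp), inl_mu]
    simp
  · rw [← inr_inl_assoc (P := P) (Q := Q) (R := P ++ Q) (by simp), inl_mu]
    simp
  · rw [inr_inr_assoc (P := P) (Q := Q) (R := P ++ Q) (by simp), inr_mu]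
    simp
  · rw [inr_inr_assoc (P := P) (Q := Q) (R := P ++ Q) (by simp), inr_mu]
    simp

end Arr
end Abacus
namespace Abacus
namespace Arr

/-! ### The trace -/

theorem _root_.Abacus.trT_append (R S : Poly) (t : Tm) : trT (R ++ S) t = trT R (trT S t) := by
  induction R with
  | nil => rfl
  | cons U R ih => exact congrArg (Tm.tr U) ih

section Trace
variable {f g h : Arr} {P P' Q Q' R R' S : Poly}

theorem tr_nil (hP : f.dom = P) (hQ : f.cod = Q) : tr [] P Q f = f := by
  induction f using rec_ofTm with | H s A B hs => ?_
  simp only [dom_ofTm, cod_ofTm] at hP hQ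
  subst hP hQ
  exact tr_ofTm (R := []) hs (by simp) (by simp) (show HasType (trT [] s) _ _ from hs)

theorem tr_append (hP : f.dom = P ++ (R ++ S)) (hQ : f.cod = Q ++ (R ++ S)) :
    tr (R ++ S) P Q f = tr R P Q (tr S (P ++ R) (Q ++ R) f) := by
  induction f using rec_ofTm with | H s A B hs => ?_
  simp only [dom_ofTm, cod_ofTm] at hP hQ
  subst hP hQ
  have hs' : HasType (trT S s) (P ++ R) (Q ++ R) :=
    trT_type S (hs.cast (by simp) (by simp))
  rw [tr_ofTm hs rfl rfl (trT_type _ hs),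
    tr_ofTm (P := P ++ R) (Q := Q ++ R) hs (by simp) (by simp) hs',
    tr_ofTm hs' rfl rfl (trT_type _ hs')]
  exact ofTm_congr (trT_append _ _ _) _ _ rfl rfl

/-- Naturality of the trace in both variables. -/
theorem mul_tr_mul (hf : f.dom = P ++ R) (hf' : f.cod = Q ++ R) (hg : g.cod = P)
    (hh : h.dom = Q) (hP : g.dom = P') (hQ : h.cod = Q') :
    g * (tr R P Q f * h) = tr R P' Q' ((g + id R) * (f * (h + id R))) := by
  induction f using rec_ofTm with | H s A B hs => ?_
  induction g using rec_ofTm with | H t A' B' ht => ?_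
  induction h using rec_ofTm with | H u A'' B'' hu => ?_
  simp only [dom_ofTm, cod_ofTm] at hf hf' hg hh hP hQ
  subst hf hf' hg hh hP hQ
  rw [tr_ofTm hs rfl rfl (trT_type _ hs), ofTm_mul _ hu rfl (.comp (trT_type _ hs) hu),
    ofTm_mul ht _ rfl (.comp ht (.comp (trT_type _ hs) hu))]
  simp only [id, ofTm_add]
  rw [ofTm_mul hs _ rfl (.comp hs (.add hu (idT_type R))),
    ofTm_mul _ _ rfl (.comp (.add ht (idT_type R)) (.comp hs (.add hu (idT_type R)))),
    tr_ofTm _ rfl rfl (trT_type _ (.comp (.add ht (idT_type R)) (.comp hs (.add hu (idT_type R)))))]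
  exact ofTm_eq (.S13 ht hs hu) _ _ rfl rfl

theorem id_add_tr (S : Poly) (hf : f.dom = P ++ R) (hf' : f.cod = Q ++ R) :
    id S + tr R P Q f = tr R (S ++ P) (S ++ Q) (id S + f) := by
  induction f using rec_ofTm with | H s A B hs => ?_
  simp only [dom_ofTm, cod_ofTm] at hf hf'
  subst hf hf'
  have ht : HasType (trT R (.add (idT S) s)) (S ++ P) (S ++ Q) :=
    trT_type R ((HasType.add (idT_type S) hs).cast (by simp) (by simp))
  rw [tr_ofTm hs rfl rfl (trT_type _ hs)]
  simp only [id, ofTm_add]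
  rw [tr_ofTm _ (by simp) (by simp) ht]
  exact ofTm_eq (.S14 S hs) _ _ rfl rfl

theorem tr_slide (hh : h.dom = R) (hh' : h.cod = R') (hf : f.dom = P ++ R') (hf' : f.cod = Q ++ R) :
    tr R P Q ((id P + h) * f) = tr R' P Q (f * (id Q + h)) := by
  induction f using rec_ofTm with | H s A B hs => ?_
  induction h using rec_ofTm with | H t A' B' ht => ?_
  simp only [dom_ofTm, cod_ofTm] at hf hf' hh hh'
  subst hf hf' hh hh'
  have h1 := HasType.comp (.add (idT_type P) ht) hs
  have h2 := HasType.comp hs (.add (idT_type Q) ht)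
  simp only [id, ofTm_add]
  rw [ofTm_mul _ _ rfl h1, ofTm_mul _ _ rfl h2, tr_ofTm h1 rfl rfl (trT_type _ h1),
    tr_ofTm h2 rfl rfl (trT_type _ h2)]
  exact ofTm_eq (.S15 ht hs) _ _ rfl rfl

theorem tr_sig (P : Poly) : tr P P P (sig P P) = id P := by
  rw [sig, tr_ofTm _ rfl rfl (trT_type _ (sigmaT_type P P))]
  exact ofTm_eq (.S16 P) _ _ rfl rfl

theorem tr_uniform (hf : f.dom = P ++ R) (hf' : f.cod = Q ++ R) (hg : g.dom = P ++ R')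
    (hg' : g.cod = Q ++ R') (hh : h.dom = R) (hh' : h.cod = R')
    (e : f * (id Q + h) = (id P + h) * g) : tr R P Q f = tr R' P Q g := by
  induction f using rec_ofTm with | H s A B hs => ?_
  induction g using rec_ofTm with | H t A' B' ht => ?_
  induction h using rec_ofTm with | H u A'' B'' hu => ?_
  simp only [dom_ofTm, cod_ofTm] at hf hf' hg hg' hh hh'
  subst hf hf' hg hg' hh hh'
  have h1 := HasType.comp hs (.add (idT_type Q) hu)
  have h2 := HasType.comp (.add (idT_type P) hu) ht
  simp only [id, ofTm_add] at e
  rw [ofTm_mul _ _ rfl h1, ofTm_mul _ _ rfl h2] at e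
  have e' : Hom.mk _ h1 = Hom.mk _ h2 := by
    simpa [ofTm] using e
  have e'' : Eqn _ _ _ _ := Quotient.exact (s := homSetoid _ _) e'
  rw [tr_ofTm hs rfl rfl (trT_type _ hs), tr_ofTm ht rfl rfl (trT_type _ ht)]
  exact ofTm_eq (.unif hs ht hu e'') _ _ rfl rfl

/-- Naturality of the trace in its domain. -/
theorem mul_tr (hf : f.dom = P ++ R) (hf' : f.cod = Q ++ R) (hg : g.cod = P) (hP : g.dom = P') :
    g * tr R P Q f = tr R P' Q ((g + id R) * f) := by
  have e := mul_tr_mul hf hf' hg (dom_id Q) hP (cod_id Q)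
  rwa [← id_append, mul_id (by simp), mul_id (by simp [hf'])] at e

/-- Naturality of the trace in its codomain. -/
theorem tr_mul (hf : f.dom = P ++ R) (hf' : f.cod = Q ++ R) (hh : h.dom = Q) (hQ : h.cod = Q') :
    tr R P Q f * h = tr R P Q' (f * (h + id R)) := by
  have e := mul_tr_mul hf hf' (cod_id P) hh (dom_id P) hQ
  rwa [← id_append, id_mul (by simp), id_mul (by simp [hf])] at e

/-- Superposition on the right: superposition on the left conjugated by symmetries. -/
theorem tr_add_id (S : Poly) (hf : f.dom = P ++ R) (hf' : f.cod = Q ++ R) :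
    tr R P Q f + id S = tr R (P ++ S) (Q ++ S)
      ((id P + sig S R) * ((f + id S) * (id Q + sig R S))) := by
  have h1 : tr R P Q f + id S = sig P S * ((id S + tr R P Q f) * sig S Q) := by
    rw [add_mul_sig (by simp) (by simp), ← mul_assoc (by simp) (by simp)]
    simp only [dom_id, dom_tr, sig_mul_sig]
    rw [← id_append, id_mul (by simp)]
  have h2 : f + id S = sig (P ++ R) S * ((id S + f) * sig S (Q ++ R)) := by
    rw [add_mul_sig (by simp) (by simp [hf']), ← mul_assoc (by simp [hf]) (by simp [hf])]
    simp only [dom_id, hf, sig_mul_sig]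
    rw [← id_append, id_mul (by simp [hf])]
  have h3 : (id P + sig S R) * sig (P ++ R) S = sig P S + id R := by
    apply hom_ext₃ (P := P) (Q := S) (R := R) (by simp) (by simp) (by simp) <;>
      simp [sig_append_left]
  have h4 : sig S (Q ++ R) * (id Q + sig R S) = sig S Q + id R := by
    apply hom_ext₃ (P := S) (Q := Q) (R := R) (by simp) (by simp) (by simp) <;>
      simp [sig_append_right]
  rw [h1, id_add_tr S hf hf', mul_tr_mul (P' := P ++ S) (Q' := Q ++ S) (by simp [hf])
    (by simp [hf']) (by simp) (by simp) (by simp) (by simp), h2, ← h3, ← h4]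
  congr 1
  simp [hf, hf']

/-- The sum of two traces is a trace of the sum, conjugated by middle interchanges. Whiskering by a
polynomial is a sum of whiskerings by monomials, so this is what lets it commute with traces. -/
theorem tr_add_tr {A A' B B' C D : Poly} (hf : f.dom = A ++ C) (hf' : f.cod = B ++ C)
    (hg : g.dom = A' ++ D) (hg' : g.cod = B' ++ D) :
    tr C A B f + tr D A' B' g = tr (C ++ D) (A ++ A') (B ++ B')
      ((id A + (sig A' C + id D)) * ((f + g) * (id B + (sig C B' + id D)))) := by
  -- The loop `D` is closed first; it only concerns `g`.
  have e1 : tr D (A ++ C ++ A') (B ++ C ++ B') (f + g) = f + tr D A' B' g := by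
    have : f + g = (f + id (A' ++ D)) * (id (B ++ C) + g) := by
      rw [add_mul_add (by simp [hf']) (by simp [hg]), mul_id hf', id_mul hg]
    have h1 := mul_tr (f := id (B ++ C) + g) (g := f + id A') (P := B ++ C ++ A')
      (Q := B ++ C ++ B') (R := D)
      (by simp [hg]) (by simp [hg']) (by simp [hf']) rfl
    rw [this]
    rw [id_append A' D, ← add_assoc]
    rw [← hf] at *
    rw [show f.dom ++ A' = (f + id A').dom by simp, ← h1, ← id_add_tr _ hg hg',
      add_mul_add (by simp [hf']) (by simp), id_mul (by simp), mul_id (by simp [hf'])]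
  have e2 : tr D (A ++ A' ++ C) (B ++ B' ++ C)
      ((id A + (sig A' C + id D)) * ((f + g) * (id B + (sig C B' + id D)))) =
      (id A + sig A' C) * ((f + tr D A' B' g) * (id B + sig C B')) := by
    rw [← e1, mul_tr_mul (by simp [hf, hg]) (by simp [hf', hg']) (by simp) (by simp) (by simp; rfl)
      (by simp; rfl)]
    simp only [add_assoc, List.append_assoc]
  -- With `D` closed, `tr D A' B' g` slides out of the loop `C`, which leaves the trace of `f + 1`.
  have e3 : (id A + sig A' C) * ((f + tr D A' B' g) * (id B + sig C B')) =
    ((id A + tr D A' B' g) + id C) * ((id A + sig B' C) * ((f + id B') * (id B + sig C B'))) := by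
    apply hom_ext₃ (P := A) (Q := A') (R := C) (by simp) (by simp) (by simp) <;>
      simp [hf, hf']
  rw [tr_append (by simp) (by simp), e2, e3, ← mul_tr (P := A ++ B') (by simp)
    (by simp) (by simp) (by simp),
    ← tr_add_id _ hf hf', add_mul_add (by simp) (by simp), id_mul (by simp), mul_id (by simp)]

end Trace
end Arr
end Abacus
namespace Abacus

/-! ### Products of polynomials -/

section Objects
variable (U V : Mon) (P Q R : Poly)

@[simp] theorem mulL_nil : mulL U [] = [] := rfl
@[simp] theorem mulL_cons : mulL U (V :: P) = (U ++ V) :: mulL U P := rfl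
@[simp] theorem mulL_append' : mulL U (P ++ Q) = mulL U P ++ mulL U Q := mulL_append U P Q
@[simp] theorem mulL_one : mulL [] P = P := by simp [mulL]
@[simp] theorem mulL_mulL : mulL U (mulL V P) = mulL (U ++ V) P := by simp [mulL]
@[simp] theorem mulObj_nil_left : mulObj [] Q = [] := rfl
@[simp] theorem mulObj_nil_right : mulObj P [] = [] := mulObj_nil P
@[simp] theorem mulObj_cons : mulObj (U :: P) Q = mulL U Q ++ mulObj P Q := rfl

@[simp] theorem mulObj_append : mulObj (P ++ Q) R = mulObj P R ++ mulObj Q R := by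
  induction P with
  | nil => rfl
  | cons V P ih => simp [ih]

@[simp] theorem mulObj_mulL : mulObj (mulL U P) Q = mulL U (mulObj P Q) := by
  induction P with
  | nil => rfl
  | cons V P ih => simp [ih]

@[simp] theorem mulObj_assoc : mulObj (mulObj P Q) R = mulObj P (mulObj Q R) := by
  induction P with
  | nil => rfl
  | cons V P ih => simp [ih]

@[simp] theorem mulObj_one : mulObj P [[]] = P := by
  induction P with
  | nil => rfl
  | cons V P ih => simp [ih]

/-- Multiplication by a monomial on the right is the product with a one-term polynomial. As a `simp`
rule this makes `mulObj` the normal form, so that `mulObj_assoc` applies. -/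
@[simp] theorem mulR_eq : mulR U P = mulObj P [U] := (mulObj_mon P U).symm

end Objects

namespace Arr

/-! ### Monomial whiskering -/

section MonomialWhiskering
variable {f g : Arr} (U V : Mon) {P Q R : Poly}

@[simp] theorem lwMon_mul (e : f.cod = g.dom) : lwMon U (f * g) = lwMon U f * lwMon U g := by
  induction f using rec_ofTm with | H s A B hs => ?_
  induction g using rec_ofTm with | H t A' B' ht => ?_
  simp only [dom_ofTm, cod_ofTm] at e
  subst e
  rw [ofTm_mul hs ht rfl (.comp hs ht), lwMon_ofTm, lwMon_ofTm, lwMon_ofTm]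
  exact ofTm_comp _ _ _ rfl rfl rfl

@[simp] theorem rwMon_mul (e : f.cod = g.dom) : rwMon U (f * g) = rwMon U f * rwMon U g := by
  induction f using rec_ofTm with | H s A B hs => ?_
  induction g using rec_ofTm with | H t A' B' ht => ?_
  simp only [dom_ofTm, cod_ofTm] at e
  subst e
  rw [ofTm_mul hs ht rfl (.comp hs ht), rwMon_ofTm, rwMon_ofTm, rwMon_ofTm]
  exact ofTm_comp _ _ _ rfl rfl rfl

@[simp] theorem lwMon_add (f g : Arr) : lwMon U (f + g) = lwMon U f + lwMon U g := by
  induction f using rec_ofTm with | H s A B hs => ?_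
  induction g using rec_ofTm with | H t A' B' ht => ?_
  exact ofTm_congr rfl _ _ (mulL_append ..) (mulL_append ..)

@[simp] theorem rwMon_add (f g : Arr) : rwMon U (f + g) = rwMon U f + rwMon U g := by
  induction f using rec_ofTm with | H s A B hs => ?_
  induction g using rec_ofTm with | H t A' B' ht => ?_
  exact ofTm_congr rfl _ _ (mulR_append ..) (mulR_append ..)

theorem lwMon_tr (hP : f.dom = P ++ R) (hQ : f.cod = Q ++ R) :
    lwMon U (tr R P Q f) = tr (mulL U R) (mulL U P) (mulL U Q) (lwMon U f) := by
  induction f using rec_ofTm with | H s A B hs => ?_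
  simp only [dom_ofTm, cod_ofTm] at hP hQ
  subst hP hQ
  rw [tr_ofTm hs rfl rfl (trT_type _ hs), lwMon_ofTm, lwMon_ofTm,
    tr_ofTm _ (by simp) (by simp) (trT_type _ ((lwM_type U hs).cast (by simp) (by simp)))]
  exact ofTm_congr (lwM_trT ..) _ _ rfl rfl

theorem rwMon_tr (hP : f.dom = P ++ R) (hQ : f.cod = Q ++ R) :
    rwMon U (tr R P Q f) =
      tr (mulObj R [U]) (mulObj P [U]) (mulObj Q [U]) (rwMon U f) := by
  induction f using rec_ofTm with | H s A B hs => ?_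
  simp only [dom_ofTm, cod_ofTm] at hP hQ
  subst hP hQ
  rw [tr_ofTm hs rfl rfl (trT_type _ hs), rwMon_ofTm, rwMon_ofTm,
    tr_ofTm _ (by simp) (by simp) (trT_type _ ((rwM_type U hs).cast (by simp) (by simp)))]
  exact ofTm_congr (by rw [rwM_trT, mulR_eq]) _ _ (by simp) (by simp)

@[simp] theorem lwMon_id (P : Poly) : lwMon U (id P) = id (mulL U P) :=
  ofTm_congr (lwM_idT ..) _ _ rfl rfl
@[simp] theorem rwMon_id (P : Poly) : rwMon U (id P) = id (mulObj P [U]) :=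
  ofTm_congr (by rw [rwM_idT, mulR_eq]) _ _ (by simp) (by simp)
@[simp] theorem lwMon_sig (P Q : Poly) : lwMon U (sig P Q) = sig (mulL U P) (mulL U Q) :=
  ofTm_congr (lwM_sigmaT ..) _ _ (by simp) (by simp)
@[simp] theorem rwMon_sig (P Q : Poly) :
    rwMon U (sig P Q) = sig (mulObj P [U]) (mulObj Q [U]) :=
  ofTm_congr (by rw [rwM_sigmaT, mulR_eq, mulR_eq]) _ _ (by simp) (by simp)
@[simp] theorem rwMon_mu (P : Poly) : rwMon U (mu P) = mu (mulObj P [U]) :=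
  ofTm_congr (by rw [rwM_muT, mulR_eq]) _ _ (by simp) (by simp)

theorem _root_.Abacus.lwM_nil (t : Tm) : lwM [] t = t := by
  induction t <;> simp_all [lwM]

theorem _root_.Abacus.rwM_nil (t : Tm) : rwM [] t = t := by
  induction t <;> simp_all [rwM]

theorem _root_.Abacus.lwM_lwM (t : Tm) : lwM U (lwM V t) = lwM (U ++ V) t := by
  induction t <;> simp_all [lwM]

theorem _root_.Abacus.rwM_rwM (t : Tm) : rwM V (rwM U t) = rwM (U ++ V) t := by
  induction t <;> simp_all [rwM]

theorem _root_.Abacus.rwM_lwM (t : Tm) : rwM V (lwM U t) = lwM U (rwM V t) := by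
  induction t <;> simp_all [rwM, lwM]

@[simp] theorem lwMon_nil (f : Arr) : lwMon [] f = f := by
  induction f using rec_ofTm with | H s A B hs => ?_
  exact ofTm_congr (lwM_nil s) _ _ (by simp) (by simp)

@[simp] theorem rwMon_nil (f : Arr) : rwMon [] f = f := by
  induction f using rec_ofTm with | H s A B hs => ?_
  exact ofTm_congr (rwM_nil s) _ _ (by simp) (by simp)

theorem lwMon_lwMon (f : Arr) : lwMon U (lwMon V f) = lwMon (U ++ V) f := by
  induction f using rec_ofTm with | H s A B hs => ?_
  exact ofTm_congr (lwM_lwM U V s) _ _ (by simp) (by simp)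

theorem rwMon_rwMon (f : Arr) : rwMon V (rwMon U f) = rwMon (U ++ V) f := by
  induction f using rec_ofTm with | H s A B hs => ?_
  exact ofTm_congr (rwM_rwM U V s) _ _ (by simp) (by simp)

theorem rwMon_lwMon (f : Arr) : rwMon V (lwMon U f) = lwMon U (rwMon V f) := by
  induction f using rec_ofTm with | H s A B hs => ?_
  exact ofTm_congr (rwM_lwM U V s) _ _ (by simp) (by simp)

end MonomialWhiskering

/-! ### The left distributor -/

section Distributor
variable (U : Mon) (P Q R S : Poly)

@[simp] theorem delta_nil : delta [] Q R = id [] := rfl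

theorem delta_cons : delta (U :: P) Q R =
    (id (mulL U Q) + (id (mulL U R) + delta P Q R)) *
      (id (mulL U Q) + (sig (mulL U R) (mulObj P Q) + id (mulObj P R))) := by
  rw [← add_assoc, ← id_append]
  exact ofTm_comp _ (HasType.add (idT_type _) (deltaT_type P Q R))
    (HasType.add (idT_type _) (HasType.add (sigmaT_type _ _) (idT_type _)))
    (by simp) (by simp) (by simp)

@[simp] theorem delta_mul_deltaInv : delta P Q R * deltaInv P Q R = id (mulObj P (Q ++ R)) := by
  rw [delta, deltaInv, ofTm_mul _ _ rfl (.comp (deltaT_type P Q R) (deltaInvT_type P Q R))]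
  exact ofTm_eq (deltaT_deltaInvT P Q R) _ _ rfl rfl

@[simp] theorem deltaInv_mul_delta :
    deltaInv P Q R * delta P Q R = id (mulObj P Q) + id (mulObj P R) := by
  rw [← id_append, delta, deltaInv,
    ofTm_mul _ _ rfl (.comp (deltaInvT_type P Q R) (deltaT_type P Q R))]
  exact ofTm_eq (deltaInvT_deltaT P Q R) _ _ rfl rfl

@[simp] theorem delta_mul_deltaInv_assoc {f : Arr} {P Q R : Poly} (e : f.dom = mulObj P (Q ++ R)) :
    delta P Q R * (deltaInv P Q R * f) = f := by
  rw [← mul_assoc (by simp) (by simp [e]), delta_mul_deltaInv, id_mul e]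

@[simp] theorem deltaInv_mul_delta_assoc {f : Arr} {P Q R : Poly}
    (e : f.dom = mulObj P Q ++ mulObj P R) : deltaInv P Q R * (delta P Q R * f) = f := by
  rw [← mul_assoc (by simp) (by simp [e]), deltaInv_mul_delta, id_add_id_mul e]

/-- A left inverse of the distributor is its inverse. -/
theorem eq_deltaInv {f : Arr} {P Q R : Poly} (e : f.cod = mulObj P (Q ++ R))
    (h : f * delta P Q R = id (mulObj P Q ++ mulObj P R)) : f = deltaInv P Q R := by
  rw [← mul_id e, ← delta_mul_deltaInv, ← mul_assoc (by simp [e]) (by simp), h,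
    id_mul (dom_deltaInv ..)]

/-- The left distributor of a monomial is an identity. -/
theorem delta_mon : delta [U] Q R = id (mulL U Q) + id (mulL U R) := by
  simp only [delta_cons, delta_nil, mulObj_nil_left, sig_nil_right, add_id_nil]
  rw [mul_id_add_id (by simp)]

@[simp] theorem delta_nil_mid : delta P [] R = id (mulObj P R) := by
  induction P with
  | nil => rfl
  | cons U P ih =>
    simp only [delta_cons, ih, mulL_nil, mulObj_nil_right, sig_nil_right, id_nil_add, mulObj_cons,
      id_append]
    rw [id_add_id_mul (by simp)]

@[simp] theorem delta_nil_right : delta P Q [] = id (mulObj P Q) := by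
  induction P with
  | nil => rfl
  | cons U P ih =>
    simp only [delta_cons, ih, mulL_nil, mulObj_nil_right, sig_nil_left, id_nil_add, mulObj_cons,
      id_append, add_id_nil]
    rw [id_add_id_mul (by simp)]

/-- The left distributor of a sum, by induction on the first summand: the recursive definition is
the case of a monomial as first summand. -/
theorem delta_append : delta (P ++ Q) R S = (delta P R S + delta Q R S) *
    (id (mulObj P R) + (sig (mulObj P S) (mulObj Q R) + id (mulObj Q S))) := by
  induction P with
  | nil => simp
  | cons U P ih =>
    rw [List.cons_append, delta_cons, ih, delta_cons]
    apply hom_ext₄ (P := mulL U R) (Q := mulL U S) (R := mulObj P (R ++ S))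
      (S := mulObj Q (R ++ S)) (by simp) (by simp) (by simp)
    · simp [sig_append_left, sig_append_right, mul_add_eq, add_mul_eq, add_assoc]
    · simp [sig_append_left, sig_append_right, mul_add_eq, add_mul_eq, add_assoc]
    · simp [sig_append_left, sig_append_right, mul_add_eq, add_mul_eq, add_assoc]
      congr 1
      apply hom_ext (P := mulObj P R) (Q := mulObj P S) (by simp) (by simp) (by simp) <;> simp
    · simp [sig_append_left, sig_append_right, mul_add_eq, add_mul_eq, add_assoc]

/-- The left distributor commutes with the symmetry. -/
theorem delta_mul_sig :
    delta P Q R * sig (mulObj P Q) (mulObj P R) = lwPoly P (sig Q R) * delta P R Q := by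
  induction P with
  | nil => simp; rfl
  | cons U P ih =>
    have e : lwPoly (U :: P) (sig Q R) = sig (mulL U Q) (mulL U R) + lwPoly P (sig Q R) := by
      rw [← lwMon_sig]; rfl
    rw [e, delta_cons, delta_cons]
    -- The induction hypothesis solved for `δ_{P,Q,R}`, after which both sides start with the same
    -- arrow.
    have key : delta P Q R =
        lwPoly P (sig Q R) * (delta P R Q * sig (mulObj P R) (mulObj P Q)) := by
      rw [← mul_assoc (by simp) (by simp), ← ih]
      simp
    apply hom_ext₃ (P := mulL U Q) (Q := mulL U R) (R := mulObj P (Q ++ R)) (by simp) (by simp)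
      (by simp)
    · simp [sig_append_left, sig_append_right, mul_add_eq, add_mul_eq, add_assoc]
    · simp [sig_append_left, sig_append_right, mul_add_eq, add_mul_eq, add_assoc]
    · rw [key]
      simp [sig_append_left, sig_append_right, mul_add_eq, add_mul_eq, add_assoc]
      congr 2
      apply hom_ext (P := mulObj P R) (Q := mulObj P Q) (by simp) (by simp) (by simp) <;>
        simp

/-- Distributing over a sum of three summands does not depend on the bracketing. -/
theorem delta_add_right : delta P (Q ++ R) S * (delta P Q R + id (mulObj P S)) =
    delta P Q (R ++ S) * (id (mulObj P Q) + delta P R S) := by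
  induction P with
  | nil => simp
  | cons U P ih =>
    -- The induction hypothesis solved for `δ_{P,Q,R+S}`.
    have key : delta P Q (R ++ S) = delta P (Q ++ R) S *
        ((delta P Q R + id (mulObj P S)) * (id (mulObj P Q) + deltaInv P R S)) := by
      rw [← mul_assoc (by simp) (by simp), ih, mul_assoc (by simp) (by simp),
        add_mul_add (by simp) (by simp), delta_mul_deltaInv, id_mul (by simp),
        mul_id_add_id (by simp)]
    simp only [delta_cons]
    rw [key]
    apply hom_ext₄ (P := mulL U Q) (Q := mulL U R) (R := mulL U S) (S := mulObj P (Q ++ (R ++ S)))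
      (by simp) (by simp) (by simp)
    · simp [sig_append_left, mul_add_eq, add_mul_eq, add_assoc]
    · simp [sig_append_left, mul_add_eq, add_mul_eq, add_assoc]
    · simp [sig_append_left, mul_add_eq, add_mul_eq, add_assoc]
    · simp [sig_append_left, mul_add_eq, add_mul_eq, add_assoc]
      congr 1
      apply hom_ext (P := mulObj P (Q ++ R)) (Q := mulObj P S) (by simp) (by simp) (by simp)
      · simp
        congr 1
        apply hom_ext (P := mulObj P Q) (Q := mulObj P R) (by simp) (by simp) (by simp) <;>
          simp
      · simp

end Distributor
end Arr
end Abacus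
namespace Abacus
namespace Arr

section DistributorInverse
variable (U : Mon) (P Q R S : Poly)

@[simp] theorem deltaInv_nil : deltaInv [] Q R = id [] := rfl

theorem deltaInv_cons : deltaInv (U :: P) Q R =
    (id (mulL U Q) + (sig (mulObj P Q) (mulL U R) + id (mulObj P R))) *
      (id (mulL U Q) + (id (mulL U R) + deltaInv P Q R)) := by
  rw [← add_assoc (id (mulL U Q)) (id (mulL U R)), ← id_append (mulL U Q) (mulL U R)]
  exact ofTm_comp _
    (HasType.add (idT_type _) (HasType.add (sigmaT_type _ _) (idT_type _)))
    (HasType.add (idT_type _) (deltaInvT_type P Q R)) (by simp) (by simp) (by simp)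

theorem delta_left_cancel {f g : Arr} {P Q R : Poly} (hf : f.dom = mulObj P Q ++ mulObj P R)
    (hg : g.dom = mulObj P Q ++ mulObj P R) (h : delta P Q R * f = delta P Q R * g) : f = g := by
  rw [← deltaInv_mul_delta_assoc hf, h, deltaInv_mul_delta_assoc hg]

theorem delta_right_cancel {f g : Arr} {P Q R : Poly} (hf : f.cod = mulObj P (Q ++ R))
    (hg : g.cod = mulObj P (Q ++ R)) (h : f * delta P Q R = g * delta P Q R) : f = g := by
  have e : ∀ k : Arr, k.cod = mulObj P (Q ++ R) → k = k * delta P Q R * deltaInv P Q R := by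
    intro k hk
    rw [mul_assoc (by simp [hk]) (by simp), delta_mul_deltaInv, mul_id hk]
  rw [e f hf, e g hg, h]

@[simp] theorem lwMon_delta : lwMon U (delta P Q R) = delta (mulL U P) Q R := by
  induction P with
  | nil => rfl
  | cons V P ih => simp [delta_cons, ih]

@[simp] theorem lwMon_deltaInv : lwMon U (deltaInv P Q R) = deltaInv (mulL U P) Q R := by
  refine eq_deltaInv (by simp) ?_
  rw [← lwMon_delta, ← lwMon_mul _ (by simp), deltaInv_mul_delta]
  simp

/-- A monomial on the right of the left factor can be moved into the summands. -/
theorem delta_mulObj_mon :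
    delta (mulObj P [U]) Q R = delta P (mulL U Q) (mulL U R) := by
  induction P with
  | nil => rfl
  | cons V P ih =>
    rw [mulObj_cons, mulL_cons, mulL_nil, List.singleton_append, delta_cons, delta_cons, ih]
    simp

theorem deltaInv_mulObj_mon :
    deltaInv (mulObj P [U]) Q R = deltaInv P (mulL U Q) (mulL U R) := by
  refine eq_deltaInv (by simp) ?_
  rw [← delta_mulObj_mon]
  simp

end DistributorInverse

/-! ### Polynomial whiskering -/

section PolynomialWhiskering
variable (f g : Arr) (U V : Mon) (P Q R S : Poly)

@[simp] theorem lwPoly_nil : lwPoly [] f = id [] := by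
  induction f using rec_ofTm with | H s A B hs => ?_
  rfl

theorem lwPoly_cons : lwPoly (U :: P) f = lwMon U f + lwPoly P f := by
  induction f using rec_ofTm with | H s A B hs => ?_
  rfl

@[simp] theorem rwPoly_nil : rwPoly f [] = id [] := by
  induction f using rec_ofTm with | H s A B hs => ?_
  exact ofTm_congr rfl _ _ (by simp) (by simp)

theorem rwPoly_cons : rwPoly f (U :: P) =
    delta f.dom [U] P * ((rwMon U f + rwPoly f P) * deltaInv f.cod [U] P) := by
  induction f using rec_ofTm with | H s A B hs => ?_
  have h : HasType (.add (rwM U s) (rwT A B s P)) (mulObj A [U] ++ mulObj A P)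
      (mulObj B [U] ++ mulObj B P) :=
    (HasType.add (rwM_type U hs) (rwT_type hs P)).cast (by simp) (by simp)
  refine (ofTm_comp _ (deltaT_type A [U] P) (HasType.comp h (deltaInvT_type B [U] P))
    rfl rfl rfl).trans (congrArg (delta A [U] P * ·) ?_)
  exact ofTm_comp _ (HasType.add (rwM_type U hs) (rwT_type hs P)) (deltaInvT_type B [U] P)
    (by simp) (by simp) rfl

/-- The recursive definition of right whiskering, without the inverse distributor: `δ` is natural
between `f ⋊ (U + P)` and `(f ⋊ U) + (f ⋊ P)`. -/
theorem rwPoly_cons_mul_delta : rwPoly f (U :: P) * delta f.cod [U] P =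
    delta f.dom [U] P * (rwMon U f + rwPoly f P) := by
  rw [rwPoly_cons]
  simp

@[simp] theorem lwPoly_mon : lwPoly [U] f = lwMon U f := by simp [lwPoly_cons]

@[simp] theorem rwPoly_mon : rwPoly f [U] = rwMon U f := by
  have h := rwPoly_cons_mul_delta f U []
  simpa using h

@[simp] theorem lwPoly_mul {f g : Arr} (e : f.cod = g.dom) :
    lwPoly P (f * g) = lwPoly P f * lwPoly P g := by
  induction P with
  | nil => simp
  | cons U P ih => simp [lwPoly_cons, ih, e, add_mul_add]

@[simp] theorem rwPoly_mul {f g : Arr} (e : f.cod = g.dom) :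
    rwPoly (f * g) P = rwPoly f P * rwPoly g P := by
  induction P with
  | nil => simp
  | cons U P ih =>
    apply delta_right_cancel (P := g.cod) (Q := [U]) (R := P) (by simp) (by simp)
    rw [mul_assoc (by simp [e]) (by simp), rwPoly_cons_mul_delta, ← e,
      ← mul_assoc (by simp) (by simp [e]), rwPoly_cons_mul_delta,
      mul_assoc (by simp) (by simp [e]), add_mul_add (by simp [e]) (by simp [e]), ← ih,
      ← rwMon_mul _ e]
    exact rwPoly_cons_mul_delta (f * g) U P

@[simp] theorem lwPoly_id : lwPoly P (id Q) = id (mulObj P Q) := by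
  induction P with
  | nil => simp
  | cons U P ih => simp [lwPoly_cons, ih]

@[simp] theorem rwPoly_id : rwPoly (id P) Q = id (mulObj P Q) := by
  induction Q with
  | nil => simp
  | cons U Q ih =>
    rw [rwPoly_cons, ih]
    simp

theorem lwPoly_append : lwPoly (P ++ Q) f = lwPoly P f + lwPoly Q f := by
  induction P with
  | nil => simp
  | cons U P ih => rw [List.cons_append, lwPoly_cons, lwPoly_cons, ih, add_assoc]

/-- The middle interchange is natural. -/
theorem add_add_mul_midSwap (a b c d : Arr) :
    (a + b + (c + d)) * (id a.cod + (sig b.cod c.cod + id d.cod)) =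
      (id a.dom + (sig b.dom c.dom + id d.dom)) * (a + c + (b + d)) := by
  have e : a + b + (c + d) = a + ((b + c) + d) := by simp only [add_assoc]
  have e' : a + c + (b + d) = a + ((c + b) + d) := by simp only [add_assoc]
  rw [e, e', add_mul_add (by simp) (by simp), add_mul_add (by simp) (by simp),
    add_mul_sig rfl rfl, add_mul_add (by simp) (by simp), add_mul_add (by simp) (by simp)]
  simp

theorem midSwap_mul_midSwap (P Q R S : Poly) :
    (id P + (sig Q R + id S)) * (id P + (sig R Q + id S)) = id (P ++ (Q ++ (R ++ S))) := by
  rw [add_mul_add (by simp) (by simp), add_mul_add (by simp) (by simp), sig_mul_sig,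
    id_mul (dom_id _), id_mul (dom_id _), add_assoc, ← id_append, ← id_append, ← id_append]

theorem midSwap_mul_midSwap_assoc {f : Arr} {P Q R S : Poly} (e : f.dom = P ++ (Q ++ (R ++ S))) :
    (id P + (sig Q R + id S)) * ((id P + (sig R Q + id S)) * f) = f := by
  rw [← mul_assoc (by simp) (by simp [e]), midSwap_mul_midSwap, id_mul e]

/-- The left distributor is natural in its second and third variables. -/
theorem lwPoly_add_mul_delta : lwPoly P (f + g) * delta P f.cod g.cod =
    delta P f.dom g.dom * (lwPoly P f + lwPoly P g) := by
  induction P with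
  | nil => simp
  | cons U P ih =>
    simp only [lwPoly_cons, delta_cons, lwMon_add]
    have h := add_add_mul_midSwap (lwMon U f) (lwMon U g) (lwPoly P f) (lwPoly P g)
    simp only [dom_lwMon, dom_lwPoly, cod_lwMon, cod_lwPoly] at h
    have e : (lwMon U f + lwMon U g + lwPoly P (f + g)) *
        (id (mulL U f.cod) + (id (mulL U g.cod) + delta P f.cod g.cod)) =
        (id (mulL U f.dom) + (id (mulL U g.dom) + delta P f.dom g.dom)) *
          (lwMon U f + lwMon U g + (lwPoly P f + lwPoly P g)) := by
      simp [add_assoc, add_mul_add, ih]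
    rw [mul_assoc (by simp) (by simp), ← h, ← mul_assoc (by simp) (by simp),
      ← mul_assoc (by simp) (by simp), e]

/-- The left distributor is natural in its first variable. For a monomial as second variable this is
the definition of right whiskering; coherence of `δ` over three summands propagates it. -/
theorem rwPoly_append_mul_delta : rwPoly f (P ++ Q) * delta f.cod P Q =
    delta f.dom P Q * (rwPoly f P + rwPoly f Q) := by
  induction P with
  | nil => simp
  | cons U P ih =>
    have d1 : delta f.dom (U :: P) Q * (delta f.dom [U] P + id (mulObj f.dom Q)) =
        delta f.dom [U] (P ++ Q) * (id (mulObj f.dom [U]) + delta f.dom P Q) :=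
      delta_add_right f.dom [U] P Q
    have d2 : delta f.cod (U :: P) Q * (delta f.cod [U] P + id (mulObj f.cod Q)) =
        delta f.cod [U] (P ++ Q) * (id (mulObj f.cod [U]) + delta f.cod P Q) :=
      delta_add_right f.cod [U] P Q
    have key : rwPoly f (U :: P ++ Q) * delta f.cod (U :: P) Q *
        (delta f.cod [U] P + id (mulObj f.cod Q)) =
        delta f.dom (U :: P) Q * (rwPoly f (U :: P) + rwPoly f Q) *
          (delta f.cod [U] P + id (mulObj f.cod Q)) := by
      rw [mul_assoc (by simp) (by simp), d2, ← mul_assoc (by simp) (by simp), List.cons_append,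
        rwPoly_cons_mul_delta, mul_assoc (by simp) (by simp), add_mul_add (by simp) (by simp),
        ih, mul_assoc (by simp) (by simp), add_mul_add (by simp) (by simp),
        rwPoly_cons_mul_delta, mul_id (by simp)]
      have e : delta f.dom [U] P * (rwMon U f + rwPoly f P) + rwPoly f Q * id (mulObj f.cod Q) =
          (delta f.dom [U] P + id (mulObj f.dom Q)) * (rwMon U f + (rwPoly f P + rwPoly f Q)) := by
        rw [← add_assoc, add_mul_add (by simp) (by simp), mul_id (by simp), id_mul (by simp)]
      have e' : rwMon U f + delta f.dom P Q * (rwPoly f P + rwPoly f Q) =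
          (id (mulObj f.dom [U]) + delta f.dom P Q) *
            (rwMon U f + (rwPoly f P + rwPoly f Q)) := by
        rw [add_mul_add (by simp) (by simp), id_mul (by simp)]
      rw [e, e', ← mul_assoc (by simp) (by simp), ← mul_assoc (by simp) (by simp), d1]
    -- `δ + 1` is invertible and can be cancelled.
    have c : ∀ k : Arr, k.cod = mulObj f.cod (U :: P) ++ mulObj f.cod Q →
        k = k * (delta f.cod [U] P + id (mulObj f.cod Q)) *
          (deltaInv f.cod [U] P + id (mulObj f.cod Q)) := by
      intro k hk
      rw [mul_assoc (by simp [hk]) (by simp), add_mul_add (by simp) (by simp),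
        delta_mul_deltaInv, id_mul (by simp), mul_id_add_id (by simpa using hk)]
    exact (c _ (by simp)).trans ((congrArg (· * _) key).trans (c _ (by simp)).symm)

/-- Right whiskering preserves sums on the nose, while left whiskering preserves them only up to the
left distributor. -/
theorem rwPoly_add : rwPoly (f + g) P = rwPoly f P + rwPoly g P := by
  induction P with
  | nil => simp
  | cons U P ih =>
    apply delta_right_cancel (P := f.cod ++ g.cod) (Q := [U]) (R := P) (by simp) (by simp)
    have h := add_add_mul_midSwap (rwMon U f) (rwPoly f P) (rwMon U g) (rwPoly g P)
    simp only [dom_rwMon, dom_rwPoly, cod_rwMon, cod_rwPoly, mulR_eq] at h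
    have e1 := rwPoly_cons_mul_delta (f + g) U P
    have e2 : (rwPoly f (U :: P) + rwPoly g (U :: P)) * (delta f.cod [U] P + delta g.cod [U] P) =
        (delta f.dom [U] P + delta g.dom [U] P) *
          (rwMon U f + rwPoly f P + (rwMon U g + rwPoly g P)) := by
      rw [add_mul_add (by simp) (by simp), rwPoly_cons_mul_delta, rwPoly_cons_mul_delta,
        add_mul_add (by simp) (by simp)]
    rw [dom_add, cod_add, delta_append f.dom, ih, rwMon_add,
      mul_assoc (by simp) (by simp), ← h] at e1
    rw [e1, delta_append f.cod, ← mul_assoc (by simp) (by simp),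
      ← mul_assoc (by simp) (by simp), e2]

theorem rwPoly_lwMon : rwPoly (lwMon U f) P = lwMon U (rwPoly f P) := by
  induction P with
  | nil => simp
  | cons V P ih =>
    simp [rwPoly_cons, ih, rwMon_lwMon]

theorem rwPoly_lwPoly : rwPoly (lwPoly P f) Q = lwPoly P (rwPoly f Q) := by
  induction P with
  | nil => simp
  | cons U P ih => rw [lwPoly_cons, lwPoly_cons, rwPoly_add, rwPoly_lwMon, ih]

theorem lwPoly_mulL : lwPoly (mulL U P) f = lwMon U (lwPoly P f) := by
  induction P with
  | nil => simp
  | cons V P ih => simp [lwPoly_cons, ih, lwMon_lwMon]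

theorem lwPoly_lwPoly : lwPoly P (lwPoly Q f) = lwPoly (mulObj P Q) f := by
  induction P with
  | nil => simp
  | cons V P ih => rw [lwPoly_cons, ih, mulObj_cons, lwPoly_append, lwPoly_mulL]

theorem rwPoly_rwMon : rwPoly (rwMon U f) P = rwPoly f (mulL U P) := by
  induction P with
  | nil => simp
  | cons V P ih =>
    simp [rwPoly_cons, ih, rwMon_rwMon, delta_mulObj_mon, deltaInv_mulObj_mon]

@[simp] theorem rwPoly_sig : rwPoly (sig P Q) R = sig (mulObj P R) (mulObj Q R) := by
  induction R with
  | nil => simp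
  | cons U R ih =>
    apply delta_right_cancel (P := Q ++ P) (Q := [U]) (R := R) (by simp) (by simp)
    have h := rwPoly_cons_mul_delta (sig P Q) U R
    have h' : sig (mulObj P (U :: R)) (mulObj Q (U :: R)) * (delta Q [U] R + delta P [U] R) =
        (delta P [U] R + delta Q [U] R) *
          sig (mulObj P [U] ++ mulObj P R) (mulObj Q [U] ++ mulObj Q R) := by
      rw [add_mul_sig (by simp) (by simp)]
      rfl
    rw [cod_sig, dom_sig, ih, rwMon_sig, delta_append P] at h
    rw [h, delta_append Q, ← mul_assoc (by simp) (by simp), h', mul_assoc (by simp) (by simp),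
      mul_assoc (by simp) (by simp)]
    congr 1
    apply hom_ext₄ (P := mulObj P [U]) (Q := mulObj P R) (R := mulObj Q [U]) (S := mulObj Q R)
      (by simp) (by simp) (by simp) <;>
      simp [sig_append_left, sig_append_right, mul_add_eq, add_mul_eq, add_assoc]

@[simp] theorem rwPoly_mu : rwPoly (mu P) R = mu (mulObj P R) := by
  induction R with
  | nil => simp
  | cons U R ih =>
    apply delta_right_cancel (P := P) (Q := [U]) (R := R) (by simp) (by simp)
    have h := rwPoly_cons_mul_delta (mu P) U R
    have h' := add_self_mul_mu (delta P [U] R)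
    rw [cod_delta, dom_delta, mu_append] at h'
    rw [cod_mu, dom_mu, ih, rwMon_mu, delta_append P, mul_assoc (by simp) (by simp)] at h
    rw [h, h']
    rfl

@[simp] theorem rwPoly_eta : rwPoly (eta P) R = eta (mulObj P R) := eq_eta (by simp)

@[simp] theorem lwPoly_eta : lwPoly R (eta P) = eta (mulObj R P) := eq_eta (by simp)

/-- Left whiskering sends the codiagonal to the codiagonal up to the distributor, because the
inverse of the distributor is the copairing of the two whiskered injections. -/
theorem lwPoly_mu : lwPoly R (mu P) = delta R P P * mu (mulObj R P) := by
  have h1 := lwPoly_add_mul_delta (id P) (eta P) R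
  have h2 := lwPoly_add_mul_delta (eta P) (id P) R
  have h3 : lwPoly R (inl P P) * lwPoly R (mu P) = id (mulObj R P) := by
    rw [← lwPoly_mul _ (by simp), inl_mu, lwPoly_id]
  have h4 : lwPoly R (inr P P) * lwPoly R (mu P) = id (mulObj R P) := by
    rw [← lwPoly_mul _ (by simp), inr_mu, lwPoly_id]
  simp only [lwPoly_id, lwPoly_eta, cod_id, cod_eta, dom_id, dom_eta, delta_nil_mid,
    delta_nil_right, ← inl.eq_1, ← inr.eq_1] at h1 h2
  rw [id_mul (by simp)] at h1 h2
  have h5 : deltaInv R P P * lwPoly R (mu P) = mu (mulObj R P) := by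
    apply hom_ext (P := mulObj R P) (Q := mulObj R P) (by simp) (by simp) (by simp)
    · rw [inl_mu, ← h1, mul_assoc (by simp) (by simp), delta_mul_deltaInv_assoc (by simp), h3]
    · rw [inr_mu, ← h2, mul_assoc (by simp) (by simp), delta_mul_deltaInv_assoc (by simp), h4]
  rw [← h5, delta_mul_deltaInv_assoc (by simp)]

/-- Right whiskering preserves the left distributor, because it preserves identities, sums and
symmetries. -/
theorem rwPoly_delta : rwPoly (delta P Q R) S = delta P (mulObj Q S) (mulObj R S) := by
  induction P with
  | nil => simp
  | cons U P ih => simp [delta_cons, rwPoly_add, ih]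

/-- Right whiskering by a product. The distributor in the definition of the inner whiskering is
preserved by the outer one, by `rwPoly_delta`. -/
theorem rwPoly_rwPoly : rwPoly (rwPoly f P) Q = rwPoly f (mulObj P Q) := by
  induction P with
  | nil => simp
  | cons U P ih =>
    apply delta_right_cancel (P := f.cod) (Q := mulL U Q) (R := mulObj P Q) (by simp) (by simp)
    have h : rwPoly (rwPoly f (U :: P) * delta f.cod [U] P) Q =
        rwPoly (delta f.dom [U] P * (rwMon U f + rwPoly f P)) Q := by
      rw [rwPoly_cons_mul_delta]
    rw [rwPoly_mul _ (by simp), rwPoly_mul _ (by simp), rwPoly_delta, rwPoly_delta, rwPoly_add, ih,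
      rwPoly_rwMon] at h
    rw [mulObj_cons, rwPoly_append_mul_delta]
    simpa using h

/-- The left distributor of a product. -/
theorem delta_mulObj : delta (mulObj P Q) R S =
    lwPoly P (delta Q R S) * delta P (mulObj Q R) (mulObj Q S) := by
  induction P with
  | nil => simp
  | cons U P ih =>
    rw [mulObj_cons, delta_append, lwPoly_cons, delta_cons, ih, lwMon_delta]
    rw [← mul_assoc (by simp) (by simp)]
    congr 1
    · rw [← add_assoc, add_mul_add (by simp) (by simp), mul_id_add_id (by simp)]
    · simp

/-! ### Whiskering of traces -/

/-- Left whiskering of a trace is the trace of the whiskering conjugated by the distributor. -/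
theorem lwPoly_tr {f : Arr} {P Q R : Poly} (hf : f.dom = P ++ R) (hf' : f.cod = Q ++ R) :
    lwPoly S (tr R P Q f) = tr (mulObj S R) (mulObj S P) (mulObj S Q)
      (deltaInv S P R * (lwPoly S f * delta S Q R)) := by
  induction S with
  | nil => simp [tr_nil]
  | cons U S ih =>
    rw [lwPoly_cons, ih, lwMon_tr U hf hf', tr_add_tr (by simp [hf]) (by simp [hf']) (by simp)
      (by simp)]
    have e : (id (mulL U P) + (id (mulL U R) + deltaInv S P R)) *
        ((lwMon U f + lwPoly S f) * (id (mulL U Q) + (id (mulL U R) + delta S Q R))) =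
        lwMon U f + deltaInv S P R * (lwPoly S f * delta S Q R) := by
      rw [← add_assoc, ← add_assoc, add_mul_add (by simp [hf']) (by simp [hf']),
        add_mul_add (by simp [hf]) (by simp [hf]), mul_id_add_id (by simp [hf']),
        id_add_id_mul (by simp [hf])]
    rw [← e, deltaInv_cons, delta_cons, lwPoly_cons]
    simp [hf, hf']

/-- Right whiskering commutes with the trace. The trace obtained from `tr_add_tr` runs over
`R U + R S`; uniformity along the distributor replaces it by a trace over `R (U + S)`. -/
theorem rwPoly_tr {f : Arr} {P Q R : Poly} (hf : f.dom = P ++ R) (hf' : f.cod = Q ++ R) :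
    rwPoly (tr R P Q f) S = tr (mulObj R S) (mulObj P S) (mulObj Q S) (rwPoly f S) := by
  induction S with
  | nil => simp [tr_nil]
  | cons U S ih =>
    rw [rwPoly_cons, ih, rwMon_tr U hf hf', tr_add_tr (by simp [hf]) (by simp [hf']) (by simp [hf])
      (by simp [hf']), mul_tr_mul (by simp) (by simp) (by simp) (by simp) rfl rfl]
    symm
    have h := rwPoly_cons_mul_delta f U S
    rw [hf, hf', delta_append, delta_append, mul_assoc (by simp) (by simp [hf])] at h
    have e : id (mulObj Q (U :: S)) + delta R [U] S = (delta Q [U] S + delta R [U] S) *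
        (id (mulObj Q [U]) + (sig (mulObj Q S) (mulObj R [U]) + id (mulObj R S))) *
        ((id (mulObj Q [U]) + (sig (mulObj R [U]) (mulObj Q S) + id (mulObj R S))) *
        (deltaInv Q [U] S + (id (mulObj R [U]) + id (mulObj R S)))) := by
      rw [mul_assoc (by simp) (by simp), midSwap_mul_midSwap_assoc (by simp),
        add_mul_add (by simp) (by simp), delta_mul_deltaInv, mul_id_add_id (by simp)]
      rfl
    have e' : (id (mulObj P (U :: S)) + delta R [U] S) *
        (delta P [U] S + (id (mulObj R [U]) + id (mulObj R S))) =
          delta P [U] S + delta R [U] S := by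
      rw [add_mul_add (by simp) (by simp), id_mul (by simp), mul_id_add_id (by simp)]
    apply tr_uniform (h := delta R [U] S) (by simp [hf]) (by simp [hf']) (by simp [hf])
      (by simp) rfl rfl
    rw [e, ← mul_assoc (by simp [hf']) (by simp), h]
    rw [← e']
    simp [hf, hf']

end PolynomialWhiskering
end Arr
end Abacus
namespace Abacus
namespace Arr

/-! ### Interchange of the two whiskerings -/

/-- The successor `succ_{U,V}`. -/
def succ (U V : Mon) : Arr := ofTm (.succ U V) (.succ U V)

/-- The zero `zero_{U,V}`. -/
def zero (U V : Mon) : Arr := ofTm (.zero U V) (.zero U V)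

/-- The predecessor `pred_{U,V}`. -/
def pred (U V : Mon) : Arr := ofTm (.pred U V) (.pred U V)

section Generators
variable (U V W : Mon)

@[simp] theorem dom_succ : (succ U V).dom = [U ++ () :: V] := (rfl)
@[simp] theorem cod_succ : (succ U V).cod = [U ++ () :: V] := (rfl)
@[simp] theorem dom_zero : (zero U V).dom = [U ++ V] := (rfl)
@[simp] theorem cod_zero : (zero U V).cod = [U ++ () :: V] := (rfl)
@[simp] theorem dom_pred : (pred U V).dom = [U ++ () :: V] := (rfl)
@[simp] theorem cod_pred : (pred U V).cod = [U ++ V, U ++ () :: V] := (rfl)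

@[simp] theorem lwMon_succ : lwMon W (succ U V) = succ (W ++ U) V :=
  ofTm_congr rfl _ _ (by simp) (by simp)
@[simp] theorem lwMon_zero : lwMon W (zero U V) = zero (W ++ U) V :=
  ofTm_congr rfl _ _ (by simp) (by simp)
@[simp] theorem lwMon_pred : lwMon W (pred U V) = pred (W ++ U) V :=
  ofTm_congr rfl _ _ (by simp) (by simp)
@[simp] theorem rwMon_succ : rwMon W (succ U V) = succ U (V ++ W) :=
  ofTm_congr rfl _ _ (by simp) (by simp)
@[simp] theorem rwMon_zero : rwMon W (zero U V) = zero U (V ++ W) :=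
  ofTm_congr rfl _ _ (by simp) (by simp)
@[simp] theorem rwMon_pred : rwMon W (pred U V) = pred U (V ++ W) :=
  ofTm_congr rfl _ _ (by simp) (by simp)

/-- A derivable equation between composites holds for bundled arrows. -/
theorem mul_eq_mul {s t s' t' : Tm} {P P₁ P₂ Q Q₁ Q' Q₂ R R₁ R₂ : Poly}
    (h : Eqn P R (.comp s t) (.comp s' t')) {hs : HasType s P₁ Q} {ht : HasType t Q₁ R₁}
    {hs' : HasType s' P₂ Q'} {ht' : HasType t' Q₂ R₂} (eP : P = P₁) (eP' : P = P₂) (eQ : Q = Q₁)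
    (eQ' : Q' = Q₂) (eR : R = R₁) (eR' : R = R₂) :
    ofTm s hs * ofTm t ht = ofTm s' hs' * ofTm t' ht' := by
  subst eQ eQ' eP eR eP' eR'
  rw [ofTm_mul _ _ rfl (.comp hs ht), ofTm_mul _ _ rfl (.comp hs' ht')]
  exact ofTm_eq h _ _ rfl rfl

theorem succ_mul_succ : succ U (V ++ () :: W) * succ (U ++ () :: V) W =
    succ (U ++ () :: V) W * succ U (V ++ () :: W) :=
  mul_eq_mul (.N3 U V W) (by simp) (by simp) (by simp) (by simp) (by simp) (by simp)

theorem succ_mul_zero : succ U (V ++ W) * zero (U ++ () :: V) W =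
    zero (U ++ () :: V) W * succ U (V ++ () :: W) :=
  mul_eq_mul (.N4 U V W) (by simp) (by simp) (by simp) (by simp) (by simp) (by simp)

theorem zero_mul_succ : zero U (V ++ () :: W) * succ (U ++ () :: V) W =
    succ (U ++ V) W * zero U (V ++ () :: W) :=
  mul_eq_mul (.N5 U V W) (by simp) (by simp) (by simp) (by simp) (by simp) (by simp)

theorem zero_mul_zero : zero U (V ++ W) * zero (U ++ () :: V) W =
    zero (U ++ V) W * zero U (V ++ () :: W) :=
  mul_eq_mul (.N6 U V W) (by simp) (by simp) (by simp) (by simp) (by simp) (by simp)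

theorem succ_mul_pred : succ U (V ++ () :: W) * pred (U ++ () :: V) W =
    pred (U ++ () :: V) W * (succ U (V ++ W) + succ U (V ++ () :: W)) :=
  mul_eq_mul (.N7 U V W) (by simp) (by simp) (by simp) (by simp) (by simp) (by simp)

theorem zero_mul_pred : zero U (V ++ () :: W) * pred (U ++ () :: V) W =
    pred (U ++ V) W * (zero U (V ++ W) + zero U (V ++ () :: W)) :=
  mul_eq_mul (.N8 U V W) (by simp) (by simp) (by simp) (by simp) (by simp) (by simp)

theorem pred_mul_succ : succ (U ++ () :: V) W * pred U (V ++ () :: W) =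
    pred U (V ++ () :: W) * (succ (U ++ V) W + succ (U ++ () :: V) W) :=
  mul_eq_mul (.N9 U V W) (by simp) (by simp) (by simp) (by simp) (by simp) (by simp)

theorem pred_mul_zero : zero (U ++ () :: V) W * pred U (V ++ () :: W) =
    pred U (V ++ W) * (zero (U ++ V) W + zero (U ++ () :: V) W) :=
  mul_eq_mul (.N10 U V W) (by simp) (by simp) (by simp) (by simp) (by simp) (by simp)

/-- Predecessors at two different factors commute, up to the middle interchange of the four
branches. -/
theorem pred_mul_pred :
    pred U (V ++ () :: W) * (pred (U ++ V) W + pred (U ++ () :: V) W) =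
      pred (U ++ () :: V) W * ((pred U (V ++ W) + pred U (V ++ () :: W)) *
        (id [U ++ V ++ W] + (sig [U ++ () :: V ++ W] [U ++ V ++ () :: W] +
          id [U ++ () :: V ++ () :: W]))) := by
  rw [← ofTm_one, ← ofTm_one, ← ofTm_sigma]
  simp only [pred, ofTm_add]
  rw [ofTm_mul _ _ (by simp) (.comp (HasType.add (.pred U (V ++ W)) (.pred U (V ++ () :: W)))
    ((HasType.add (.one (U ++ V ++ W)) (.add (.sigma (U ++ () :: V ++ W) (U ++ V ++ () :: W))
      (.one (U ++ () :: V ++ () :: W)))).cast (by simp) rfl))]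
  exact mul_eq_mul (.N11 U V W) (by simp) (by simp) (by simp) (by simp) (by simp) (by simp)

end Generators

/-- Induction on arrows: a property of arrows which holds for the generators and is stable under
composition, sum and trace holds for all arrows. -/
theorem induction_on {p : Arr → Prop} (f : Arr) (succ : ∀ U V, p (succ U V))
    (zero : ∀ U V, p (zero U V)) (pred : ∀ U V, p (pred U V)) (id : ∀ P, p (id P))
    (eta : ∀ P, p (eta P)) (mu : ∀ P, p (mu P)) (sig : ∀ P Q, p (sig P Q))
    (mul : ∀ f g : Arr, f.cod = g.dom → p f → p g → p (f * g))
    (add : ∀ f g, p f → p g → p (f + g))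
    (tr : ∀ (f : Arr) (R P Q), f.dom = P ++ R → f.cod = Q ++ R → p f → p (tr R P Q f)) :
    p f := by
  induction f using rec_ofTm with | H t P Q h => ?_
  induction h with
  | succ U V => exact succ U V
  | zero U V => exact zero U V
  | pred U V => exact pred U V
  | one U => exact ofTm_one U ▸ id [U]
  | eta U => exact ofTm_eta U ▸ eta [U]
  | mu U => exact ofTm_mu U ▸ mu [U]
  | oneZ => exact id []
  | sigma U W => exact ofTm_sigma U W ▸ sig [U] [W]
  | comp hs ht ihs iht => exact ofTm_mul hs ht rfl (.comp hs ht) ▸ mul _ _ rfl ihs iht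
  | add _ _ ihs iht => exact add _ _ ihs iht
  | tr hs ih => exact tr_ofTm hs rfl rfl (.tr hs) ▸ tr _ _ _ _ rfl rfl ih

/-- The arrows `f` and `g` satisfy the interchange law `(f ⋊ R') (S ⋉ g) = (R ⋉ g) (f ⋊ S')`. -/
def Interchange (f g : Arr) : Prop :=
  rwPoly f g.dom * lwPoly f.cod g = lwPoly f.dom g * rwPoly f g.cod

namespace Interchange
variable {f f' g g' : Arr} {P Q R : Poly}

theorem id_left (P : Poly) (g : Arr) : Interchange (id P) g := by
  simp [Interchange]

theorem id_right (f : Arr) (P : Poly) : Interchange f (id P) := by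
  simp [Interchange]

theorem eta_left (P : Poly) (g : Arr) : Interchange (eta P) g := by
  refine (eq_eta (by simp)).trans (Eq.trans ?_ (eq_eta (by simp)).symm)
  simp

theorem eta_right (f : Arr) (P : Poly) : Interchange f (eta P) := by
  refine (eq_eta (by simp)).trans (Eq.trans ?_ (eq_eta (by simp)).symm)
  simp

-- For the structural arrows the interchange law is naturality of the corresponding structure.
theorem sig_left (P Q : Poly) (g : Arr) : Interchange (sig P Q) g := by
  rw [Interchange, rwPoly_sig, rwPoly_sig, cod_sig, dom_sig, lwPoly_append, lwPoly_append,
    add_mul_sig (by simp) (by simp)]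
  simp

theorem mu_left (P : Poly) (g : Arr) : Interchange (mu P) g := by
  rw [Interchange, rwPoly_mu, rwPoly_mu, cod_mu, dom_mu, lwPoly_append]
  simpa using (add_self_mul_mu (lwPoly P g)).symm

theorem mul_left (e : f.cod = f'.dom) (h : Interchange f g) (h' : Interchange f' g) :
    Interchange (f * f') g := by
  rw [Interchange] at *
  rw [rwPoly_mul _ e, rwPoly_mul _ e, mul_assoc (by simp [e]) (by simp), cod_mul, h',
    ← mul_assoc (by simp [e]) (by simp), ← e, h, mul_assoc (by simp) (by simp [e])]
  rfl

theorem mul_right (e : g.cod = g'.dom) (h : Interchange f g) (h' : Interchange f g') :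
    Interchange f (g * g') := by
  rw [Interchange] at *
  rw [lwPoly_mul _ e, lwPoly_mul _ e, ← mul_assoc (by simp) (by simp [e]), dom_mul, h,
    mul_assoc (by simp) (by simp [e]), e, h', mul_assoc (by simp [e]) (by simp)]
  rfl

theorem add_left (h : Interchange f g) (h' : Interchange f' g) : Interchange (f + f') g := by
  rw [Interchange] at *
  rw [rwPoly_add, rwPoly_add, cod_add, dom_add, lwPoly_append, lwPoly_append,
    add_mul_add (by simp) (by simp), add_mul_add (by simp) (by simp), h, h']

theorem add_right (h : Interchange f g) (h' : Interchange f g') : Interchange f (g + g') := by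
  rw [Interchange] at *
  apply delta_right_cancel (P := f.cod) (Q := g.cod) (R := g'.cod) (by simp) (by simp)
  rw [mul_assoc (by simp) (by simp), mul_assoc (by simp) (by simp), lwPoly_add_mul_delta, cod_add,
    rwPoly_append_mul_delta, dom_add, ← mul_assoc (by simp) (by simp), rwPoly_append_mul_delta,
    ← mul_assoc (by simp) (by simp), lwPoly_add_mul_delta, mul_assoc (by simp) (by simp),
    mul_assoc (by simp) (by simp), add_mul_add (by simp) (by simp), add_mul_add (by simp) (by simp),
    h, h']

theorem sig_right (f : Arr) (P Q : Poly) : Interchange f (sig P Q) := by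
  apply delta_right_cancel (P := f.cod) (Q := Q) (R := P) (by simp) (by simp)
  rw [mul_assoc (by simp) (by simp), mul_assoc (by simp) (by simp), ← delta_mul_sig, cod_sig,
    rwPoly_append_mul_delta, dom_sig, ← mul_assoc (by simp) (by simp), rwPoly_append_mul_delta,
    ← mul_assoc (by simp) (by simp), ← delta_mul_sig, mul_assoc (by simp) (by simp),
    mul_assoc (by simp) (by simp), add_mul_sig (by simp) (by simp)]
  rfl

theorem mu_right (f : Arr) (P : Poly) : Interchange f (mu P) := by
  rw [Interchange, lwPoly_mu, lwPoly_mu, cod_mu, dom_mu, ← mul_assoc (by simp) (by simp),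
    rwPoly_append_mul_delta, mul_assoc (by simp) (by simp), mul_assoc (by simp) (by simp)]
  exact congrArg _ (add_self_mul_mu (rwPoly f P))

/-- The interchange law is inherited by a trace of the first arrow, by uniformity along `R ⋉ g`: an
arrow that commutes with the body of a loop commutes with the loop. -/
theorem tr_left (hf : f.dom = P ++ R) (hf' : f.cod = Q ++ R) (h : Interchange f g) :
    Interchange (tr R P Q f) g := by
  rw [Interchange] at *
  rw [hf, hf', lwPoly_append, lwPoly_append] at h
  rw [rwPoly_tr _ hf hf', rwPoly_tr _ hf hf', cod_tr, dom_tr,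
    tr_mul (by simp [hf]) (by simp [hf']) (by simp) (cod_lwPoly ..),
    mul_tr (by simp [hf]) (by simp [hf']) (by simp) (dom_lwPoly ..)]
  apply tr_uniform (h := lwPoly R g) (by simp [hf]) (by simp) (by simp) (by simp [hf']) rfl rfl
  have e1 : (lwPoly Q g + id (mulObj R g.dom)) * (id (mulObj Q g.cod) + lwPoly R g) =
      lwPoly Q g + lwPoly R g := by
    rw [add_mul_add (by simp) (by simp), mul_id (by simp), id_mul (by simp)]
  have e2 : (id (mulObj P g.dom) + lwPoly R g) * (lwPoly P g + id (mulObj R g.cod)) =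
      lwPoly P g + lwPoly R g := by
    rw [add_mul_add (by simp) (by simp), mul_id (by simp), id_mul (by simp)]
  rw [mul_assoc (by simp [hf']) (by simp), e1, ← mul_assoc (by simp) (by simp [hf]), e2, h]

/-- The interchange law is inherited by a trace of the second arrow, by uniformity along `f ⋊ R`. -/
theorem tr_right (hg : g.dom = P ++ R) (hg' : g.cod = Q ++ R) (h : Interchange f g) :
    Interchange f (tr R P Q g) := by
  rw [Interchange] at *
  rw [hg, hg'] at h
  rw [lwPoly_tr _ hg hg', lwPoly_tr _ hg hg', cod_tr, dom_tr,
    tr_mul (by simp) (by simp) (by simp) (cod_rwPoly ..),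
    mul_tr (by simp) (by simp) (by simp) (dom_rwPoly ..)]
  symm
  apply tr_uniform (h := rwPoly f R) (by simp) (by simp) (by simp) (by simp) rfl rfl
  have e : (rwPoly f P + rwPoly f R) * deltaInv f.cod P R =
      deltaInv f.dom P R * rwPoly f (P ++ R) := by
    apply delta_left_cancel (P := f.dom) (Q := P) (R := R) (by simp) (by simp)
    rw [← mul_assoc (by simp) (by simp), ← rwPoly_append_mul_delta]
    simp
  have e1 : (rwPoly f Q + id (mulObj f.dom R)) * (id (mulObj f.cod Q) + rwPoly f R) =
      rwPoly f Q + rwPoly f R := by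
    rw [add_mul_add (by simp) (by simp), mul_id (by simp), id_mul (by simp)]
  have e2 : (id (mulObj f.dom P) + rwPoly f R) * (rwPoly f P + id (mulObj f.cod R)) =
      rwPoly f P + rwPoly f R := by
    rw [add_mul_add (by simp) (by simp), mul_id (by simp), id_mul (by simp)]
  rw [mul_assoc (by simp) (by simp), e1,
    ← mul_assoc (f := id (mulObj f.dom P) + rwPoly f R) (by simp) (by simp), e2,
    ← mul_assoc (f := rwPoly f P + rwPoly f R) (by simp) (by simp [hg]), e,
    mul_assoc (by simp [hg]) (by simp),
    mul_assoc (by simp [hg']) (by simp), ← rwPoly_append_mul_delta,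
    mul_assoc (by simp) (by simp [hg]),
    ← mul_assoc (f := rwPoly f (P ++ R)) (by simp [hg]) (by simp [hg']), h]
  simp [hg']

end Interchange

/-- An arrow which interchanges with the arithmetic generators interchanges with all arrows. -/
theorem interchange_of_generators {f : Arr} (hs : ∀ U V, Interchange f (succ U V))
    (hz : ∀ U V, Interchange f (zero U V)) (hp : ∀ U V, Interchange f (pred U V)) (g : Arr) :
    Interchange f g :=
  induction_on g hs hz hp (.id_right f) (.eta_right f) (.mu_right f) (.sig_right f)
    (fun _ _ => .mul_right) (fun _ _ => .add_right) (fun _ _ _ _ => .tr_right)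

/-- Right whiskering by a sum of two monomials. -/
theorem rwPoly_pair (f : Arr) (U V : Mon) : rwPoly f [U, V] * delta f.cod [U] [V] =
    delta f.dom [U] [V] * (rwMon U f + rwMon V f) := by
  simpa using rwPoly_cons_mul_delta f U [V]

theorem interchange_succ (U V : Mon) (g : Arr) : Interchange (succ U V) g := by
  apply interchange_of_generators
  · intro U' V'
    simpa [Interchange] using succ_mul_succ U (V ++ U') V'
  · intro U' V'
    simpa [Interchange] using succ_mul_zero U (V ++ U') V'
  · intro U' V'
    have h := rwPoly_pair (succ U V) (U' ++ V') (U' ++ () :: V')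
    simp only [dom_succ, cod_succ, delta_mon] at h
    rw [mul_id_add_id (by simp), id_add_id_mul (by simp)] at h
    simpa [Interchange, h] using succ_mul_pred U (V ++ U') V'

theorem interchange_zero (U V : Mon) (g : Arr) : Interchange (zero U V) g := by
  apply interchange_of_generators
  · intro U' V'
    simpa [Interchange] using zero_mul_succ U (V ++ U') V'
  · intro U' V'
    simpa [Interchange] using zero_mul_zero U (V ++ U') V'
  · intro U' V'
    have h := rwPoly_pair (zero U V) (U' ++ V') (U' ++ () :: V')
    simp only [dom_zero, cod_zero, delta_mon] at h
    rw [mul_id_add_id (by simp), id_add_id_mul (by simp)] at h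
    simpa [Interchange, h] using zero_mul_pred U (V ++ U') V'

theorem interchange_pred (U V : Mon) (g : Arr) : Interchange (pred U V) g := by
  apply interchange_of_generators
  · intro U' V'
    simpa [Interchange, lwPoly_cons] using (pred_mul_succ U (V ++ U') V').symm
  · intro U' V'
    simpa [Interchange, lwPoly_cons] using (pred_mul_zero U (V ++ U') V').symm
  · intro U' V'
    have h := rwPoly_pair (pred U V) (U' ++ V') (U' ++ () :: V')
    -- The codomain of `pred` has two terms, and here the distributor is not an identity but a
    -- middle interchange.
    have d : delta [U ++ V, U ++ () :: V] [U' ++ V'] [U' ++ () :: V'] =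
        id [U ++ V ++ (U' ++ V')] + (sig [U ++ V ++ (U' ++ () :: V')]
          [U ++ () :: V ++ (U' ++ V')] + id [U ++ () :: V ++ (U' ++ () :: V')]) := by
      rw [delta_cons, delta_mon, ← id_append, ← id_append, ← id_append, id_mul (by simp)]
      rfl
    rw [dom_pred, delta_mon, id_add_id_mul (by simp), cod_pred, d, rwMon_pred, rwMon_pred] at h
    have h' : rwPoly (pred U V) [U' ++ V', U' ++ () :: V'] =
        (pred U (V ++ (U' ++ V')) + pred U (V ++ (U' ++ () :: V'))) *
          (id [U ++ V ++ (U' ++ V')] + (sig [U ++ () :: V ++ (U' ++ V')]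
            [U ++ V ++ (U' ++ () :: V')] + id [U ++ () :: V ++ (U' ++ () :: V')])) := by
      rw [← h, mul_assoc (by simp) (by simp), midSwap_mul_midSwap, mul_id (by simp)]
    simpa [Interchange, h', lwPoly_cons] using pred_mul_pred U (V ++ U') V'

/-- The interchange law holds for all arrows, by induction on the first one; for a generator it is
proved by induction on the second one. -/
theorem interchange (f g : Arr) : Interchange f g :=
  induction_on (p := (Interchange · g)) f (interchange_succ · · g) (interchange_zero · · g)
    (interchange_pred · · g) (Interchange.id_left · g) (Interchange.eta_left · g)
    (Interchange.mu_left · g) (Interchange.sig_left · · g) (fun _ _ => Interchange.mul_left)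
    (fun _ _ => Interchange.add_left) (fun _ _ _ _ => Interchange.tr_left)

end Arr
end Abacus
namespace Abacus

/-! ### From bundled arrows to the category -/

/-- The polynomial underlying an object of the category. -/
def poly (P : Abacus) : Poly := P

theorem poly_add (P Q : Abacus) : poly (elgotData.add.obj P Q) = poly P ++ poly Q := (rfl)
theorem poly_zero : poly elgotData.add.unit = [] := (rfl)
theorem poly_mul (P Q : Abacus) : poly (elgotData.mul.obj P Q) = mulObj (poly P) (poly Q) := (rfl)
theorem poly_one : poly elgotData.mul.unit = [[]] := (rfl)

/-- The definitional equality `P = poly P`, kept as a lemma since `poly` marks the passage between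
objects of the category and polynomials. -/
theorem poly_inj {P Q : Abacus} (h : poly P = poly Q) : P = Q := h

/-- The bundled arrow underlying an arrow of the category. -/
def toArr {P Q : Abacus} (f : P ⟶ Q) : Arr := ⟨poly P, poly Q, f⟩

/-- Equations between arrows of the category may be checked on the bundled arrows. -/
theorem toArr_inj {P Q : Abacus} {f g : P ⟶ Q} (h : toArr f = toArr g) : f = g := by
  have h' := (Arr.mk.injEq ..).mp h
  exact eq_of_heq h'.2.2

open Arr

section ToArr
variable {P Q R S P' Q' : Abacus}

@[simp] theorem dom_toArr (f : P ⟶ Q) : (toArr f).dom = poly P := (rfl)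
@[simp] theorem cod_toArr (f : P ⟶ Q) : (toArr f).cod = poly Q := (rfl)

theorem mk_mul_mk {P Q R : Poly} (f : Hom P Q) (g : Hom Q R) :
    Arr.mk P Q f * Arr.mk Q R g = Arr.mk P R (f.comp g) :=
  congrArg (Arr.mk P R) (dif_pos rfl)

theorem toArr_comp (f : P ⟶ Q) (g : Q ⟶ R) : toArr (f ≫ g) = toArr f * toArr g :=
  (mk_mul_mk (P := P) (Q := Q) (R := R) f g).symm

theorem toArr_id (P : Abacus) : toArr (𝟙 P) = Arr.id (poly P) := rfl

theorem toArr_eqToHom (h : P = Q) : toArr (eqToHom h) = Arr.id (poly P) := by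
  subst h; rfl

/-- Transports along equalities of objects disappear in bundled arrows. -/
theorem toArr_eqToHom_comp (h : P = Q) (f : Q ⟶ R) : toArr (eqToHom h ≫ f) = toArr f := by
  subst h; rw [eqToHom_refl, Category.id_comp]

theorem toArr_comp_eqToHom (f : P ⟶ Q) (h : Q = R) : toArr (f ≫ eqToHom h) = toArr f := by
  subst h; rw [eqToHom_refl, Category.comp_id]

theorem toArr_add (f : P ⟶ Q) (g : P' ⟶ Q') :
    toArr (elgotData.add.hom f g) = toArr f + toArr g := rfl

theorem toArr_mul (f : P ⟶ Q) (g : P' ⟶ Q') :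
    toArr (elgotData.mul.hom f g) = rwPoly (toArr f) (poly P') * lwPoly (poly Q) (toArr g) :=
  (mk_mul_mk (Hom.whiskerRight (R := poly P) (S := poly Q) f (poly P'))
    (Hom.whiskerLeft (poly Q) (R := poly P') (S := poly Q') g)).symm

theorem toArr_sigma (P Q : Abacus) : toArr (elgotData.sigma P Q) = sig (poly P) (poly Q) := rfl
theorem toArr_delta (P Q R : Abacus) :
    toArr (elgotData.delta P Q R) = delta (poly P) (poly Q) (poly R) := rfl

theorem tr_mk {P Q R : Poly} (f : Hom (P ++ R) (Q ++ R)) :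
    tr R P Q (Arr.mk _ _ f) = Arr.mk P Q (Hom.tr R P Q f) := by
  rw [Arr.tr, dif_pos ⟨rfl, rfl⟩]; rfl

theorem toArr_tr (f : elgotData.add.obj P R ⟶ elgotData.add.obj Q R) :
    toArr (elgotData.tr R P Q f) = tr (poly R) (poly P) (poly Q) (toArr f) :=
  (tr_mk (P := poly P) (Q := poly Q) (R := poly R) f).symm

theorem toArr_midSwap (hT : elgotData.add.IsMonoidal) (P Q R S : Abacus) :
    toArr (elgotData.add.midSwap hT elgotData.sigma P Q R S) =
      Arr.id (poly P) + (sig (poly Q) (poly R) + Arr.id (poly S)) := by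
  simp only [Elgot.Tensor.midSwap, ↓toArr_eqToHom_comp, ↓toArr_comp_eqToHom]
  rfl

end ToArr

/-! ### The right-strict Elgot structure -/

theorem add_obj_assoc (P Q R : Abacus) : elgotData.add.obj (elgotData.add.obj P Q) R =
    elgotData.add.obj P (elgotData.add.obj Q R) :=
  poly_inj (List.append_assoc ..)

theorem zero_add_obj (P : Abacus) : elgotData.add.obj elgotData.add.unit P = P :=
  poly_inj (List.nil_append _)

theorem add_zero_obj (P : Abacus) : elgotData.add.obj P elgotData.add.unit = P :=
  poly_inj (List.append_nil _)

theorem mul_obj_assoc (P Q R : Abacus) : elgotData.mul.obj (elgotData.mul.obj P Q) R =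
    elgotData.mul.obj P (elgotData.mul.obj Q R) :=
  poly_inj (mulObj_assoc ..)

theorem one_mul_obj (P : Abacus) : elgotData.mul.obj elgotData.mul.unit P = P :=
  poly_inj (by simp [poly_mul, poly_one])

theorem mul_one_obj (P : Abacus) : elgotData.mul.obj P elgotData.mul.unit = P :=
  poly_inj (mulObj_one _)

theorem mul_zero_obj (P : Abacus) : elgotData.mul.obj P elgotData.add.unit = elgotData.add.unit :=
  poly_inj (mulObj_nil _)

theorem zero_mul_obj (P : Abacus) : elgotData.mul.obj elgotData.add.unit P = elgotData.add.unit :=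
  rfl

theorem add_mul_obj (P Q R : Abacus) : elgotData.mul.obj (elgotData.add.obj P Q) R =
    elgotData.add.obj (elgotData.mul.obj P R) (elgotData.mul.obj Q R) :=
  poly_inj (mulObj_append ..)

theorem add_isMonoidal : elgotData.add.IsMonoidal where
  assoc := add_obj_assoc
  unit_obj := zero_add_obj
  obj_unit := add_zero_obj
  hom_id P Q := toArr_inj (Arr.id_append (poly P) (poly Q)).symm
  hom_comp f f' g g' := toArr_inj <| by
    simp only [toArr_comp, toArr_add]
    exact (add_mul_add (by simp) (by simp)).symm
  hom_assoc f g h := toArr_inj <| by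
    simp only [↓toArr_eqToHom_comp, ↓toArr_comp_eqToHom, toArr_add]
    exact Arr.add_assoc _ _ _
  unit_hom f := toArr_inj <| by
    simp only [↓toArr_eqToHom_comp, ↓toArr_comp_eqToHom, toArr_add, toArr_id]
    exact id_nil_add _
  hom_unit f := toArr_inj <| by
    simp only [↓toArr_eqToHom_comp, ↓toArr_comp_eqToHom, toArr_add, toArr_id]
    exact add_id_nil _

theorem add_isSymmetric : elgotData.add.IsSymmetric elgotData.sigma where
  toIsMonoidal := add_isMonoidal
  sigma_natural f g := toArr_inj <| by
    simp only [toArr_comp, toArr_add, toArr_sigma]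
    exact add_mul_sig (by simp) (by simp)
  sigma_sigma P Q := toArr_inj <| by
    rw [toArr_comp]
    exact (sig_mul_sig (poly P) (poly Q)).trans (Arr.id_append (poly P) (poly Q)).symm
  sigma_tensor P Q R := toArr_inj <| by
    simp only [↓toArr_eqToHom_comp, ↓toArr_comp_eqToHom, toArr_comp, toArr_add, toArr_id]
    exact sig_append_right (poly P) (poly Q) (poly R)

theorem add_isCocartesian :
    elgotData.add.IsCocartesian elgotData.sigma elgotData.mu elgotData.eta where
  toIsSymmetric := add_isSymmetric
  mu_natural f := toArr_inj <| by
    simp only [toArr_comp, toArr_add]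
    exact (add_self_mul_mu (toArr f)).symm
  eta_natural f := toArr_inj <| by
    rw [toArr_comp]
    exact eta_mul rfl
  mu_unit := toArr_inj <| by
    rw [toArr_eqToHom]
    rfl
  mu_tensor P Q := toArr_inj <| by
    simp only [toArr_comp, toArr_add, toArr_midSwap]
    exact mu_append (poly P) (poly Q)
  eta_unit := rfl
  eta_tensor P Q := toArr_inj <| by
    simp only [↓toArr_eqToHom_comp, toArr_add]
    exact eta_append (poly P) (poly Q)
  mu_assoc P := toArr_inj <| by
    simp only [↓toArr_eqToHom_comp, toArr_comp, toArr_add]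
    exact Arr.mu_assoc (poly P)
  mu_comm P := toArr_inj <| by
    rw [toArr_comp]
    exact sig_mul_mu (poly P)
  one_eta_mu P := toArr_inj <| by
    rw [toArr_comp, toArr_add, toArr_eqToHom, poly_add, poly_zero, List.append_nil]
    exact id_add_eta_mul_mu (poly P)
  eta_one_mu P := toArr_inj <| by
    rw [toArr_comp, toArr_add, toArr_eqToHom]
    exact eta_add_id_mul_mu (poly P)

theorem add_isTraced : elgotData.add.IsTraced elgotData.sigma elgotData.tr where
  toIsSymmetric := add_isSymmetric
  tr_unit f := toArr_inj <| by
    simp only [↓toArr_eqToHom_comp, ↓toArr_comp_eqToHom, toArr_tr]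
    exact tr_nil (by simp [poly_add, poly_zero]) (by simp [poly_add, poly_zero])
  tr_tensor f := toArr_inj <| by
    simp only [↓toArr_eqToHom_comp, ↓toArr_comp_eqToHom, toArr_tr]
    exact tr_append rfl rfl
  tr_natural g f h := toArr_inj <| by
    simp only [toArr_comp, toArr_add, toArr_tr, toArr_id]
    exact mul_tr_mul rfl rfl rfl rfl rfl rfl
  tr_superpose R f := toArr_inj <| by
    simp only [↓toArr_eqToHom_comp, ↓toArr_comp_eqToHom, toArr_add, toArr_tr, toArr_id]
    exact id_add_tr (poly R) rfl rfl
  tr_slide h f := toArr_inj <| by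
    simp only [toArr_comp, toArr_add, toArr_tr, toArr_id]
    exact tr_slide rfl rfl rfl rfl
  tr_yank P := toArr_inj <| by
    rw [toArr_tr]
    exact tr_sig (poly P)

theorem add_isUniform : elgotData.add.IsUniform elgotData.tr := by
  intro A B D E f g h e
  apply toArr_inj
  rw [toArr_tr, toArr_tr]
  refine tr_uniform (h := toArr h) rfl rfl rfl rfl rfl rfl ?_
  have e' := congrArg toArr e
  rwa [toArr_comp, toArr_comp] at e'

theorem mul_isMonoidal : elgotData.mul.IsMonoidal where
  assoc := mul_obj_assoc
  unit_obj := one_mul_obj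
  obj_unit := mul_one_obj
  hom_id P Q := toArr_inj <| by
    simp [toArr_mul, toArr_id, poly_mul]
  -- Functoriality of the product amounts to the interchange law for `f'` and `g`.
  hom_comp {A A' A'' B B' B''} f f' g g' := toArr_inj <| by
    simp only [toArr_comp, toArr_mul]
    have h : rwPoly (toArr f') (poly B) * lwPoly (poly A'') (toArr g) =
        lwPoly (poly A') (toArr g) * rwPoly (toArr f') (poly B') :=
      interchange (toArr f') (toArr g)
    rw [rwPoly_mul _ (by simp), lwPoly_mul _ (by simp), Arr.mul_assoc (by simp) (by simp),
      ← Arr.mul_assoc (f := rwPoly (toArr f') (poly B)) (by simp) (by simp), h]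
    simp
  hom_assoc {A A' B B' D D'} f g h := toArr_inj <| by
    simp only [↓toArr_eqToHom_comp, ↓toArr_comp_eqToHom, toArr_mul, poly_mul]
    simp [rwPoly_rwPoly, rwPoly_lwPoly, lwPoly_lwPoly]
  unit_hom f := toArr_inj <| by
    simp only [↓toArr_eqToHom_comp, ↓toArr_comp_eqToHom, toArr_mul, toArr_id, poly_one]
    simp
  hom_unit f := toArr_inj <| by
    simp only [↓toArr_eqToHom_comp, ↓toArr_comp_eqToHom, toArr_mul, toArr_id, poly_one]
    simp

theorem isRightStrictDistributive : elgotData.IsRightStrictDistributive where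
  additive := add_isCocartesian
  multiplicative := mul_isMonoidal
  mul_zero := mul_zero_obj
  zero_mul := zero_mul_obj
  add_mul := add_mul_obj
  hom_mul_zero f := toArr_inj <| by
    simp only [toArr_mul, toArr_eqToHom, toArr_id, poly_zero, poly_mul]
    simp
  hom_zero_mul f := toArr_inj <| by
    simp only [toArr_mul, toArr_eqToHom, toArr_id, poly_zero, poly_mul]
    simp
  hom_add_mul f g h := toArr_inj <| by
    simp only [↓toArr_eqToHom_comp, ↓toArr_comp_eqToHom, toArr_mul, toArr_add, poly_add]
    simp [rwPoly_add, lwPoly_append, add_mul_add]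
  delta_natural {A A' B B' D D'} f g h := toArr_inj <| by
    simp only [toArr_comp, toArr_mul, toArr_add, toArr_delta, poly_add]
    have h1 := lwPoly_add_mul_delta (toArr g) (toArr h) (poly A')
    have h2 := rwPoly_append_mul_delta (toArr f) (poly B) (poly D)
    simp only [dom_toArr, cod_toArr] at h1 h2
    rw [Arr.mul_assoc (by simp) (by simp), h1, ← Arr.mul_assoc (by simp) (by simp), h2,
      Arr.mul_assoc (by simp) (by simp), add_mul_add (by simp) (by simp)]
  delta_iso P Q R := by
    refine ⟨⟨Hom.mk (deltaInvT P Q R) (deltaInvT_type P Q R), toArr_inj ?_, toArr_inj ?_⟩⟩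
    · rw [toArr_comp]
      exact delta_mul_deltaInv (poly P) (poly Q) (poly R)
    · rw [toArr_comp]
      exact (deltaInv_mul_delta (poly P) (poly Q) (poly R)).trans (Arr.id_append _ _).symm
  delta_zero_left P Q := toArr_inj <| by
    rw [toArr_eqToHom]
    rfl
  delta_zero_mid P Q := toArr_inj <| by
    simp only [toArr_eqToHom, toArr_delta, poly_zero, poly_mul, poly_add]
    simp
  delta_zero_right P Q := toArr_inj <| by
    simp only [toArr_eqToHom, toArr_delta, poly_zero, poly_mul, poly_add]
    simp
  delta_unit P Q := toArr_inj <| by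
    simp only [toArr_eqToHom, toArr_delta, poly_one, poly_mul, poly_add]
    simp [delta_mon]
  delta_sigma P Q R := toArr_inj <| by
    simp only [toArr_comp, toArr_mul, toArr_delta, toArr_sigma, toArr_id, poly_mul, poly_add]
    simp [delta_mul_sig]
  sigma_mul P Q R := toArr_inj <| by
    simp only [↓toArr_eqToHom_comp, ↓toArr_comp_eqToHom, toArr_mul, toArr_sigma, toArr_id,
      poly_mul, poly_add]
    simp
  delta_add_right P Q R S := toArr_inj <| by
    simp only [↓toArr_eqToHom_comp, ↓toArr_comp_eqToHom, toArr_comp, toArr_add, toArr_delta,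
      toArr_id, poly_mul, poly_add]
    exact delta_add_right _ _ _ _
  delta_mul_left P Q R S := toArr_inj <| by
    simp only [↓toArr_eqToHom_comp, ↓toArr_comp_eqToHom, toArr_comp, toArr_mul, toArr_delta,
      toArr_id, poly_mul, poly_add]
    simp [delta_mulObj]
  delta_mul_right P Q R S := toArr_inj <| by
    simp only [↓toArr_eqToHom_comp, ↓toArr_comp_eqToHom, toArr_mul, toArr_delta,
      toArr_id, poly_mul, poly_add]
    simp [rwPoly_delta]
  delta_add_left P Q R S := toArr_inj <| by
    simp only [↓toArr_eqToHom_comp, ↓toArr_comp_eqToHom, toArr_comp, toArr_add, toArr_delta,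
      toArr_midSwap, poly_mul, poly_add]
    exact delta_append _ _ _ _

/-- The inverse of the copairing of zero and successor is the predecessor. -/
theorem isIso_iota : IsIso elgotData.iota := by
  refine ⟨⟨Hom.mk (.pred [] []) (.pred [] []), ?_, ?_⟩⟩
  · exact Quotient.sound (s := homSetoid _ _) (Eqn.N1 [] [])
  · refine toArr_inj ?_
    exact (ofTm_eq (Eqn.N2 [] []) _ _ rfl rfl).trans (ofTm_one [()])

end Abacus

theorem mainTheorem3 :
    Abacus.elgotData.IsRightStrictElgot ∧
      ∀ {R S R' S' : Abacus} (f : R ⟶ S) (g : R' ⟶ S'),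
        Abacus.elgotData.mul.hom f g =
          Abacus.Hom.comp (Abacus.Hom.whiskerLeft R g) (Abacus.Hom.whiskerRight f S') := by
  refine ⟨⟨Abacus.isRightStrictDistributive, Abacus.add_isTraced, Abacus.add_isUniform,
    Abacus.isIso_iota⟩, fun {R S R' S'} f g => Abacus.toArr_inj ?_⟩
  rw [Abacus.toArr_mul]
  refine (Abacus.Arr.interchange (Abacus.toArr f) (Abacus.toArr g)).trans ?_
  exact Abacus.mk_mul_mk (Abacus.Hom.whiskerLeft (Abacus.poly R) g)
    (Abacus.Hom.whiskerRight f (Abacus.poly S'))
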